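/- All graphs are finite, simple and undirected. A \emph{split} of a graph $G$ is a partition $(A,B)$ of $V(G)$ with $|A|,|B|\ge 2$ for which there are $A'\subseteq A$ and $B'\subseteq B$ such that $x\in A$ is adjacent to $y\in B$ if and only if $x\in A'$ and $y\in B'$; a graph is \emph{prime} if it has no split. The \emph{local complementation} $G*v$ of $G$ at a vertex $v$ is the graph obtained from $G$ by replacing the subgraph induced by the neighbourhood of $v$ with its complement. A graph $H$ is a \emph{vertex-minor} of $G$ if $H$ is an induced subgraph of a graph obtained from $G$ by a finite sequence of local complementations. The length of a path or cycle is its number of edges. \textbf{Theorem.} Let $n\ge 3$ be an integer. If a prime graph $G$ has an induced path of length $\lceil 6.75\,n^7\rceil$, then $G$ has a vertex-minor isomorphic to $C_n$, the cycle of length $n$. -/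

import Mathlib

open scoped SimpleGraph

namespace VertexMinor

variable {V W : Type*}

/-- The local complementation `G * v`: flip the adjacency of every pair of distinct neighbours
of `v`. -/
def localComplement (G : SimpleGraph V) (v : V) : SimpleGraph V where
  Adj x y := x ≠ y ∧ Xor (G.Adj x y) (G.Adj v x ∧ G.Adj v y)
  symm := ⟨by
    intro x y h
    rw [G.adj_comm y x, and_comm (a := G.Adj v y)]
    exact ⟨h.1.symm, h.2⟩⟩
  loopless := ⟨fun _ h => h.1 rfl⟩

/-- `H` is obtained from `G` by a finite sequence `G * v₁ * v₂ * ⋯ * vₖ` of local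
complementations (the `vᵢ` need not be distinct). -/
def LocallyEquivalent (G H : SimpleGraph V) : Prop :=
  ∃ l : List V, H = l.foldl localComplement G

/-- `G` has a vertex-minor isomorphic to `H`, i.e. `H` is isomorphic to an induced subgraph of a
graph locally equivalent to `G`. -/
def HasVertexMinor (G : SimpleGraph V) (H : SimpleGraph W) : Prop :=
  ∃ G' : SimpleGraph V, LocallyEquivalent G G' ∧ H ⊴ G'

/-- The pair `(A, B)` is a split of `G`: a partition of the vertex set into two parts with at
least two vertices each, such that the edges between `A` and `B` form all of `A' × B'` for some
`A' ⊆ A` and `B' ⊆ B`. -/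
def IsSplit (G : SimpleGraph V) (A B : Set V) : Prop :=
  Disjoint A B ∧ A ∪ B = Set.univ ∧ A.Nontrivial ∧ B.Nontrivial ∧
    ∃ A' ⊆ A, ∃ B' ⊆ B, ∀ x ∈ A, ∀ y ∈ B, G.Adj x y ↔ x ∈ A' ∧ y ∈ B'

/-- A graph is prime (with respect to split decomposition) if it has no splits. -/
def IsPrime (G : SimpleGraph V) : Prop :=
  ∀ A B : Set V, ¬ IsSplit G A B

/-- `G` has an induced path of length `k`, i.e. with `k` edges and `k + 1` vertices. -/
def HasInducedPath (G : SimpleGraph V) (k : ℕ) : Prop :=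
  SimpleGraph.pathGraph (k + 1) ⊴ G

end VertexMinor

/-! The rank over `𝔽₂` of the adjacency matrix across a partition (the cut-rank) is submodular and
invariant under local complementation. A partition into parts with at least two vertices is a split
exactly when its cut-rank is at most one. Primality therefore says that the two end edges of the
path are linked: every partition separating them has cut-rank at least two. Let `W` be a minimal set
of vertices off the path that keeps the ends linked within `W` and the path (`exists_pathState`).
The size of `W` decides between two sources of cycles.

If `W` is small, look at short stretches of the path. When no inner vertex of a stretch has a
neighbour in `W`, either a shortest detour closes the stretch into a long induced cycle, or a single
edge carries the whole connection between the ends, contradicting linkedness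
(`PathState.exists_adj`). So there are many edges from the path to `W`, some vertex of `W` has many
neighbours on the path, and local complementations turn this fan into a cycle (`hasCyc_of_fan`).

If `W` is large, contract path vertices until every remaining vertex between the ends lies on the
boundary of a partition of cut-rank two. Uncrossing such partitions orders the vertices so that all
initial segments have cut-rank two, and a linking argument moves this rank onto the two ends
(`Chain`). In such an order the adjacency of an earlier `x` and a later `y` is a bilinear form `dot
(α x) (β y)` on the plane `𝔽₂²`. Minimality of `W` forces every thirty consecutive vertices to
contain a pair for which the form depends on the order (`Chain.exists_noncommuting`). There are only
256 types of pairs, so one type repeats often. The repeated pairs form a half graph, possibly with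
cliques as sides (`Alternating`). Pivoting turns it into a long induced path, which either a vertex
of the configuration or a detour through the two ends closes up (`Alternating.hasCyc`). -/

namespace VertexMinor

/-! ### Cut-rank over the field with two elements -/

section

open Module Submodule

variable {V : Type*}

/-- The rank over `𝔽₂` of the submatrix of `M` with rows `R` and columns `C`. -/
noncomputable def rk (M : V → V → ZMod 2) (R C : Set V) : ℕ :=
  finrank (ZMod 2) (span (ZMod 2) ((fun x => C.indicator (M x)) '' R))

theorem rk_le_of_factor {M : V → V → ZMod 2} {R C : Set V} {k : ℕ}
    (f : V → Fin k → ZMod 2) (g : Fin k → V → ZMod 2)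
    (h : ∀ x ∈ R, ∀ y ∈ C, M x y = ∑ i, f x i * g i y) : rk M R C ≤ k := by
  have hle : span (ZMod 2) ((fun x => C.indicator (M x)) '' R) ≤
      span (ZMod 2) (Set.range fun i => C.indicator (g i)) := by
    rw [span_le]
    rintro _ ⟨x, hx, rfl⟩
    have : C.indicator (M x) = ∑ i, f x i • C.indicator (g i) := by
      ext y
      by_cases hy : y ∈ C
      · simp [Finset.sum_apply, hy, h x hx y hy]
      · simp [Finset.sum_apply, hy]
    show C.indicator (M x) ∈ _
    rw [this]
    exact sum_mem fun i _ => smul_mem _ _ (subset_span ⟨i, rfl⟩)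
  have hfin : FiniteDimensional (ZMod 2)
      (span (ZMod 2) (Set.range fun i => C.indicator (g i))) :=
    FiniteDimensional.span_of_finite _ (Set.finite_range _)
  calc rk M R C ≤ finrank (ZMod 2) (span (ZMod 2) (Set.range fun i => C.indicator (g i))) :=
        finrank_mono hle
    _ ≤ k := by
        simpa [Set.finrank] using finrank_range_le_card (R := ZMod 2) (fun i => C.indicator (g i))

theorem exists_factor_of_rk_le [Finite V] {M : V → V → ZMod 2} {R C : Set V} {k : ℕ}
    (h : rk M R C ≤ k) :
    ∃ (f : V → Fin k → ZMod 2) (g : Fin k → V → ZMod 2),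
      ∀ x ∈ R, ∀ y ∈ C, M x y = ∑ i, f x i * g i y := by
  classical
  have := Fintype.ofFinite V
  let S := span (ZMod 2) ((fun x => C.indicator (M x)) '' R)
  let b := finBasis (ZMod 2) S
  have hd : finrank (ZMod 2) S ≤ k := h
  have hmem : ∀ x ∈ R, C.indicator (M x) ∈ S := fun x hx => subset_span ⟨x, hx, rfl⟩
  refine ⟨fun x i => if hx : x ∈ R ∧ (i : ℕ) < finrank (ZMod 2) S then
      b.repr ⟨_, hmem x hx.1⟩ ⟨i, hx.2⟩ else 0,
    fun i y => if hi : (i : ℕ) < finrank (ZMod 2) S then (b ⟨i, hi⟩ : V → ZMod 2) y else 0, ?_⟩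
  intro x hx y hy
  have h1 := b.sum_repr ⟨_, hmem x hx⟩
  have h2 := congrArg (fun v : S => (v : V → ZMod 2) y) h1
  simp only [Submodule.coe_sum, Submodule.coe_smul, Finset.sum_apply, Pi.smul_apply, smul_eq_mul,
    Set.indicator_of_mem hy] at h2
  rw [← h2]
  rw [← Finset.sum_subset (Finset.subset_univ
    (Finset.univ.filter fun i : Fin k => (i : ℕ) < finrank (ZMod 2) S))]
  · refine Finset.sum_bij (fun i _ => ⟨i, i.2.trans_le hd⟩) ?_ ?_ ?_ ?_
    · intro i _; simp
    · intro i _ j _ hij; simpa [Fin.ext_iff] using hij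
    · intro j hj
      simp only [Finset.mem_filter, Finset.mem_univ, true_and] at hj
      exact ⟨⟨j, hj⟩, Finset.mem_univ _, rfl⟩
    · intro i _
      simp [hx]
  · intro i _ hi
    simp only [Finset.mem_filter, Finset.mem_univ, true_and] at hi
    simp [hi]

/-- Rank bounds are used in this form, as factorisations of the block through a `k`-dimensional
space; the factors can then be edited entry by entry. -/
theorem rk_le_iff [Finite V] {M : V → V → ZMod 2} {R C : Set V} {k : ℕ} :
    rk M R C ≤ k ↔ ∃ (f : V → Fin k → ZMod 2) (g : Fin k → V → ZMod 2),
      ∀ x ∈ R, ∀ y ∈ C, M x y = ∑ i, f x i * g i y :=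
  ⟨exists_factor_of_rk_le, fun ⟨f, g, h⟩ => rk_le_of_factor f g h⟩

/-- The functions that vanish on `C`. -/
def vanishing (C : Set V) : Submodule (ZMod 2) (V → ZMod 2) where
  carrier := {v | ∀ y ∈ C, v y = 0}
  add_mem' ha hb y hy := by simp [ha y hy, hb y hy]
  zero_mem' _ _ := rfl
  smul_mem' c v hv y hy := by simp [hv y hy]

theorem mem_vanishing {C : Set V} {v : V → ZMod 2} : v ∈ vanishing C ↔ ∀ y ∈ C, v y = 0 := Iff.rfl

theorem vanishing_inf (C₁ C₂ : Set V) : vanishing C₁ ⊓ vanishing C₂ = vanishing (C₁ ∪ C₂) := by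
  ext v
  simp only [mem_inf, mem_vanishing, Set.mem_union]
  exact ⟨fun h y hy => hy.elim (h.1 y) (h.2 y), fun h => ⟨fun y hy => h y (Or.inl hy),
    fun y hy => h y (Or.inr hy)⟩⟩

theorem vanishing_sup (C₁ C₂ : Set V) : vanishing C₁ ⊔ vanishing C₂ = vanishing (C₁ ∩ C₂) := by
  apply le_antisymm
  · rw [sup_le_iff]
    exact ⟨fun v hv y hy => hv y hy.1, fun v hv y hy => hv y hy.2⟩
  · intro v hv
    rw [mem_sup]
    refine ⟨C₁ᶜ.indicator v, fun y hy => by simp [hy], C₁.indicator v, fun y hy => ?_, ?_⟩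
    · by_cases h : y ∈ C₁
      · rw [Set.indicator_of_mem h]; exact hv y ⟨h, hy⟩
      · simp [h]
    · rw [add_comm]; exact Set.indicator_self_add_compl C₁ v

/-- Restricting rows to `C` amounts to working modulo the functions vanishing on `C`. This makes the
rank a dimension of a sum of subspaces, to which the dimension formula applies. -/
theorem rk_add_finrank_vanishing [Finite V] (M : V → V → ZMod 2) (R C : Set V) :
    rk M R C + finrank (ZMod 2) (vanishing C) =
      finrank (ZMod 2) ↥(span (ZMod 2) (M '' R) ⊔ vanishing C) := by
  have h1 : span (ZMod 2) (M '' R) ⊔ vanishing C =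
      span (ZMod 2) ((fun x => C.indicator (M x)) '' R) ⊔ vanishing C := by
    have key : ∀ x, M x - C.indicator (M x) ∈ vanishing C := fun x y hy => by simp [hy]
    apply le_antisymm
    · refine sup_le (span_le.2 ?_) le_sup_right
      rintro _ ⟨x, hx, rfl⟩
      have := add_mem (mem_sup_left (T := vanishing C) (subset_span (R := ZMod 2)
        (Set.mem_image_of_mem (fun x => C.indicator (M x)) hx)))
        (mem_sup_right (key x))
      simpa using this
    · refine sup_le (span_le.2 ?_) le_sup_right
      rintro _ ⟨x, hx, rfl⟩
      have := sub_mem (mem_sup_left (T := vanishing C) (subset_span (R := ZMod 2)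
        (Set.mem_image_of_mem M hx)))
        (mem_sup_right (key x))
      simpa using this
  have h2 : span (ZMod 2) ((fun x => C.indicator (M x)) '' R) ⊓ vanishing C = ⊥ := by
    have hle : span (ZMod 2) ((fun x => C.indicator (M x)) '' R) ≤ vanishing Cᶜ := by
      rw [span_le]
      rintro _ ⟨x, _, rfl⟩ y hy
      exact Set.indicator_of_notMem hy _
    rw [eq_bot_iff]
    rintro v ⟨hv1, hv2⟩
    have h3 := hle hv1
    show v = 0
    ext y
    by_cases hy : y ∈ C
    · exact hv2 y hy
    · exact h3 y hy
  have h3 := finrank_sup_add_finrank_inf_eq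
    (span (ZMod 2) ((fun x => C.indicator (M x)) '' R)) (vanishing C)
  rw [h2, finrank_bot, add_zero] at h3
  rw [h1, h3, rk]

/-- The subspaces `span (rows of Rᵢ) ⊔ vanishing Cᵢ` have as their sum exactly the subspace of the
first block on the left, while their intersection contains that of the second; the dimension formula
gives the rest. -/
theorem rk_submodular [Finite V] (M : V → V → ZMod 2) (R₁ R₂ C₁ C₂ : Set V) :
    rk M (R₁ ∪ R₂) (C₁ ∩ C₂) + rk M (R₁ ∩ R₂) (C₁ ∪ C₂) ≤ rk M R₁ C₁ + rk M R₂ C₂ := by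
  have e1 := rk_add_finrank_vanishing M R₁ C₁
  have e2 := rk_add_finrank_vanishing M R₂ C₂
  have e3 := rk_add_finrank_vanishing M (R₁ ∪ R₂) (C₁ ∩ C₂)
  have e4 := rk_add_finrank_vanishing M (R₁ ∩ R₂) (C₁ ∪ C₂)
  have hd := finrank_sup_add_finrank_inf_eq (vanishing C₁) (vanishing C₂)
  rw [vanishing_inf, vanishing_sup] at hd
  have hs := finrank_sup_add_finrank_inf_eq (span (ZMod 2) (M '' R₁) ⊔ vanishing C₁)
    (span (ZMod 2) (M '' R₂) ⊔ vanishing C₂)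
  have l1 : span (ZMod 2) (M '' (R₁ ∪ R₂)) ⊔ vanishing (C₁ ∩ C₂) =
      (span (ZMod 2) (M '' R₁) ⊔ vanishing C₁) ⊔ (span (ZMod 2) (M '' R₂) ⊔ vanishing C₂) := by
    rw [Set.image_union, span_union, ← vanishing_sup, sup_sup_sup_comm]
  have l2 : span (ZMod 2) (M '' (R₁ ∩ R₂)) ⊔ vanishing (C₁ ∪ C₂) ≤
      (span (ZMod 2) (M '' R₁) ⊔ vanishing C₁) ⊓ (span (ZMod 2) (M '' R₂) ⊔ vanishing C₂) := by
    rw [← vanishing_inf]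
    refine le_inf (sup_le_sup (span_mono (Set.image_mono Set.inter_subset_left)) inf_le_left)
      (sup_le_sup (span_mono (Set.image_mono Set.inter_subset_right)) inf_le_right)
  have l3 := finrank_mono l2
  rw [← l1] at hs
  omega

theorem rk_le_comm [Finite V] {M : V → V → ZMod 2} (hM : ∀ x y, M x y = M y x) {R C : Set V}
    {k : ℕ} (h : rk M R C ≤ k) : rk M C R ≤ k := by
  obtain ⟨f, g, h⟩ := exists_factor_of_rk_le h
  exact rk_le_of_factor (fun x i => g i x) (fun i y => f y i) fun x hx y hy => by
    rw [hM, h y hy x hx]; exact Finset.sum_congr rfl fun _ _ => mul_comm _ _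

theorem rk_comm [Finite V] {M : V → V → ZMod 2} (hM : ∀ x y, M x y = M y x) (R C : Set V) :
    rk M R C = rk M C R :=
  le_antisymm (rk_le_comm hM le_rfl) (rk_le_comm hM le_rfl)

theorem rk_mono [Finite V] (M : V → V → ZMod 2) {R R' C C' : Set V} (hR : R ⊆ R') (hC : C ⊆ C') :
    rk M R C ≤ rk M R' C' := by
  obtain ⟨f, g, h⟩ := exists_factor_of_rk_le (le_refl (rk M R' C'))
  exact rk_le_of_factor f g fun x hx y hy => h x (hR hx) y (hC hy)

theorem rk_congr [Finite V] {M N : V → V → ZMod 2} {R C : Set V}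
    (h : ∀ x ∈ R, ∀ y ∈ C, M x y = N x y) : rk M R C = rk N R C := by
  apply le_antisymm <;> refine rk_le_iff.2 ?_
  · obtain ⟨f, g, h'⟩ := exists_factor_of_rk_le (le_refl (rk N R C))
    exact ⟨f, g, fun x hx y hy => by rw [h x hx y hy, h' x hx y hy]⟩
  · obtain ⟨f, g, h'⟩ := exists_factor_of_rk_le (le_refl (rk M R C))
    exact ⟨f, g, fun x hx y hy => by rw [← h x hx y hy, h' x hx y hy]⟩

theorem rk_le_one_iff [Finite V] {M : V → V → ZMod 2} {R C : Set V} :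
    rk M R C ≤ 1 ↔ ∃ f g : V → ZMod 2, ∀ x ∈ R, ∀ y ∈ C, M x y = f x * g y := by
  rw [rk_le_iff]
  constructor
  · rintro ⟨f, g, h⟩
    exact ⟨fun x => f x 0, g 0, fun x hx y hy => by simp [h x hx y hy]⟩
  · rintro ⟨f, g, h⟩
    exact ⟨fun x _ => f x, fun _ => g, fun x hx y hy => by simp [h x hx y hy]⟩

theorem rk_le_two_iff [Finite V] {M : V → V → ZMod 2} {R C : Set V} :
    rk M R C ≤ 2 ↔ ∃ f g f' g' : V → ZMod 2, ∀ x ∈ R, ∀ y ∈ C,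
      M x y = f x * g y + f' x * g' y := by
  rw [rk_le_iff]
  constructor
  · rintro ⟨f, g, h⟩
    exact ⟨fun x => f x 0, g 0, fun x => f x 1, g 1,
      fun x hx y hy => by simp [h x hx y hy, Fin.sum_univ_two]⟩
  · rintro ⟨f, g, f', g', h⟩
    exact ⟨fun x => ![f x, f' x], ![g, g'],
      fun x hx y hy => by simp [h x hx y hy, Fin.sum_univ_two]⟩

theorem zmod_two_cases (a : ZMod 2) : a = 0 ∨ a = 1 := by
  revert a; decide

/-- The `2 × 2` minors of a matrix of rank at most one vanish. -/
theorem minor_eq_of_rk_le_one [Finite V] {M : V → V → ZMod 2} {R C : Set V} (h : rk M R C ≤ 1)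
    {x x' y y' : V} (hx : x ∈ R) (hx' : x' ∈ R) (hy : y ∈ C) (hy' : y' ∈ C) :
    M x y * M x' y' = M x y' * M x' y := by
  obtain ⟨f, g, h⟩ := rk_le_one_iff.1 h
  rw [h x hx y hy, h x' hx' y' hy', h x hx y' hy', h x' hx' y hy]
  ring

theorem exists_minor_of_one_lt_rk [Finite V] {M : V → V → ZMod 2} {R C : Set V}
    (h : ¬ rk M R C ≤ 1) :
    ∃ x ∈ R, ∃ x' ∈ R, ∃ y ∈ C, ∃ y' ∈ C, M x y * M x' y' ≠ M x y' * M x' y := by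
  by_contra! hc
  apply h
  rw [rk_le_one_iff]
  by_cases h0 : ∃ u ∈ R, ∃ v ∈ C, M u v ≠ 0
  · obtain ⟨u, hu, v, hv, huv⟩ := h0
    have huv : M u v = 1 := (zmod_two_cases _).resolve_left huv
    exact ⟨fun x => M x v, fun y => M u y, fun x hx y hy => by
      have := hc x hx u hu y hy v hv
      rw [huv, mul_one] at this
      exact this⟩
  · push Not at h0
    exact ⟨0, 0, fun x hx y hy => by simp [h0 x hx y hy]⟩

theorem rk_insert_left_le [Finite V] (M : V → V → ZMod 2) (R C : Set V) (v : V) :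
    rk M (insert v R) C ≤ rk M R C + 1 := by
  classical
  obtain ⟨f, g, h⟩ := exists_factor_of_rk_le (le_refl (rk M R C))
  refine rk_le_of_factor (fun x => Fin.snoc (α := fun _ => ZMod 2)
    (if x = v then 0 else f x) (if x = v then 1 else 0))
    (Fin.snoc (α := fun _ => V → ZMod 2) g (M v)) fun x hx y hy => ?_
  rw [Fin.sum_univ_castSucc]
  simp only [Fin.snoc_castSucc, Fin.snoc_last]
  by_cases hxv : x = v
  · simp [hxv]
  · simp [hxv, h x (hx.resolve_left hxv) y hy]

theorem rk_insert_right_le [Finite V] {M : V → V → ZMod 2} (hM : ∀ x y, M x y = M y x)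
    (R C : Set V) (v : V) : rk M R (insert v C) ≤ rk M R C + 1 := by
  rw [rk_comm hM, rk_comm hM R C]
  exact rk_insert_left_le M C R v

open Classical in
/-- The adjacency matrix over `𝔽₂`. -/
noncomputable def adjF (G : SimpleGraph V) (x y : V) : ZMod 2 := if G.Adj x y then 1 else 0

theorem adjF_comm (G : SimpleGraph V) (x y : V) : adjF G x y = adjF G y x := by
  by_cases h : G.Adj x y <;> simp [adjF, h, G.adj_comm y x]

@[simp] theorem adjF_self (G : SimpleGraph V) (x : V) : adjF G x x = 0 := by simp [adjF]

theorem adjF_eq_one {G : SimpleGraph V} {x y : V} : adjF G x y = 1 ↔ G.Adj x y := by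
  simp [adjF]

theorem adjF_eq_zero {G : SimpleGraph V} {x y : V} : adjF G x y = 0 ↔ ¬ G.Adj x y := by
  simp [adjF]

theorem adjF_localComplement (G : SimpleGraph V) (v : V) {x y : V} (hxy : x ≠ y) :
    adjF (localComplement G v) x y = adjF G x y + adjF G v x * adjF G v y := by
  by_cases h1 : G.Adj x y <;> by_cases h2 : G.Adj v x <;> by_cases h3 : G.Adj v y <;>
    (simp [adjF, localComplement, hxy, h1, h2, h3, Xor]; try decide)

/-- Across a partition, local complementation at `v` is an elementary operation: it adds the row of
`v` to the rows of its neighbours on the same side, or does the same with columns if `v` lies in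
`Y`. -/
theorem rk_localComplement_le [Finite V] (G : SimpleGraph V) {v : V} {X Y : Set V}
    (hd : Disjoint X Y) (hv : v ∈ X ∪ Y) :
    rk (adjF (localComplement G v)) X Y ≤ rk (adjF G) X Y := by
  obtain ⟨f, g, h⟩ := exists_factor_of_rk_le (le_refl (rk (adjF G) X Y))
  have hne : ∀ x ∈ X, ∀ y ∈ Y, x ≠ y := fun x hx y hy e => Set.disjoint_left.1 hd hx (e ▸ hy)
  rcases hv with hv | hv
  · refine rk_le_of_factor (fun x i => f x i + adjF G v x * f v i) g fun x hx y hy => ?_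
    rw [adjF_localComplement G v (hne x hx y hy), h x hx y hy, h v hv y hy, Finset.mul_sum,
      ← Finset.sum_add_distrib]
    exact Finset.sum_congr rfl fun _ _ => by ring
  · refine rk_le_of_factor f (fun i y => g i y + adjF G v y * g i v) fun x hx y hy => ?_
    rw [adjF_localComplement G v (hne x hx y hy), h x hx y hy, adjF_comm G v x, h x hx v hv,
      Finset.sum_mul, ← Finset.sum_add_distrib]
    exact Finset.sum_congr rfl fun _ _ => by ring

theorem localComplement_localComplement (G : SimpleGraph V) (v : V) :
    localComplement (localComplement G v) v = G := by
  ext x y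
  by_cases h : x = y
  · simp [h]
  rw [← adjF_eq_one, adjF_localComplement _ _ h, adjF_localComplement _ _ h]
  have : ∀ z, adjF (localComplement G v) v z = adjF G v z := by
    intro z
    by_cases hz : v = z
    · simp [hz]
    · simp [adjF_localComplement _ _ hz]
  rw [this, this, add_assoc, CharTwo.add_self_eq_zero, add_zero, adjF_eq_one]

theorem rk_localComplement [Finite V] (G : SimpleGraph V) {v : V} {X Y : Set V}
    (hd : Disjoint X Y) (hv : v ∈ X ∪ Y) :
    rk (adjF (localComplement G v)) X Y = rk (adjF G) X Y := by
  refine le_antisymm (rk_localComplement_le G hd hv) ?_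
  have := rk_localComplement_le (localComplement G v) hd hv
  rwa [localComplement_localComplement] at this

end

/-! ### Induced paths and cycles under local complementation -/

section

variable {V : Type*}

theorem localComplement_adj {G : SimpleGraph V} {v x y : V} :
    (localComplement G v).Adj x y ↔ x ≠ y ∧ (G.Adj x y ↔ ¬ (G.Adj v x ∧ G.Adj v y)) := by
  simp only [localComplement, Xor]
  tauto

theorem LocallyEquivalent.refl (G : SimpleGraph V) : LocallyEquivalent G G := ⟨[], rfl⟩

theorem LocallyEquivalent.trans {G H K : SimpleGraph V} (h : LocallyEquivalent G H)
    (h' : LocallyEquivalent H K) : LocallyEquivalent G K := by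
  obtain ⟨l, rfl⟩ := h
  obtain ⟨l', rfl⟩ := h'
  exact ⟨l ++ l', by rw [List.foldl_append]⟩

theorem LocallyEquivalent.localComplement (G : SimpleGraph V) (v : V) :
    LocallyEquivalent G (localComplement G v) := ⟨[v], rfl⟩

/-- `c 0, …, c (m - 1)` is an induced cycle. -/
def IsCyc (G : SimpleGraph V) (c : ℕ → V) (m : ℕ) : Prop :=
  (∀ i < m, ∀ j < m, c i = c j → i = j) ∧ ∀ i < m, ∀ j < m,
    (G.Adj (c i) (c j) ↔ j = i + 1 ∨ i = j + 1 ∨ (i = 0 ∧ j + 1 = m) ∨ (j = 0 ∧ i + 1 = m))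

/-- `p 0, …, p r` is an induced path. -/
def IsPath (G : SimpleGraph V) (p : ℕ → V) (r : ℕ) : Prop :=
  (∀ i ≤ r, ∀ j ≤ r, p i = p j → i = j) ∧ ∀ i ≤ r, ∀ j ≤ r,
    (G.Adj (p i) (p j) ↔ j = i + 1 ∨ i = j + 1)

/-- Some graph locally equivalent to `G` has an induced cycle of length `n`. -/
def HasCyc (G : SimpleGraph V) (n : ℕ) : Prop :=
  ∃ (H : SimpleGraph V) (c : ℕ → V), LocallyEquivalent G H ∧ IsCyc H c n

theorem HasCyc.of_locallyEquivalent {G H : SimpleGraph V} {n : ℕ} (h : LocallyEquivalent G H)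
    (hH : HasCyc H n) : HasCyc G n := by
  obtain ⟨K, c, hK, hc⟩ := hH
  exact ⟨K, c, h.trans hK, hc⟩

/-- The last vertex has only two neighbours on the cycle, and they are not adjacent to each other
because the cycle has length at least four. Local complementation joins them, so dropping the vertex
leaves a shorter cycle. -/
theorem IsCyc.localComplement {G : SimpleGraph V} {c : ℕ → V} {m : ℕ} (hm : 3 ≤ m)
    (h : IsCyc G c (m + 1)) : IsCyc (localComplement G (c m)) c m := by
  refine ⟨fun i hi j hj => h.1 i (by omega) j (by omega), fun i hi j hj => ?_⟩
  rw [localComplement_adj, h.2 i (by omega) j (by omega), h.2 m (by omega) i (by omega),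
    h.2 m (by omega) j (by omega)]
  have : c i ≠ c j ↔ i ≠ j := ⟨fun h e => h (by rw [e]), fun hn e =>
    hn (h.1 i (by omega) j (by omega) e)⟩
  rw [this]
  omega

theorem HasCyc.mono {G : SimpleGraph V} {m n : ℕ} (hn : 3 ≤ n) (hnm : n ≤ m) (h : HasCyc G m) :
    HasCyc G n := by
  induction m, hnm using Nat.le_induction with
  | base => exact h
  | succ m hm ih =>
    obtain ⟨H, c, hH, hc⟩ := h
    exact ih ⟨_, c, hH.trans (LocallyEquivalent.localComplement _ (c m)),
      hc.localComplement (by omega)⟩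

theorem HasCyc.hasVertexMinor {G : SimpleGraph V} {n : ℕ} (hn : 3 ≤ n) (h : HasCyc G n) :
    HasVertexMinor G (SimpleGraph.cycleGraph n) := by
  obtain ⟨H, c, hH, hc⟩ := h
  refine ⟨H, hH, ⟨⟨fun i => c i, fun i j hij => Fin.ext (hc.1 i i.2 j j.2 hij)⟩, ?_⟩⟩
  intro a b
  have ha := a.2
  have hb := b.2
  refine (hc.2 a a.2 b b.2).trans (Iff.trans ?_ SimpleGraph.cycleGraph_adj'.symm)
  rcases lt_trichotomy a b with h | rfl | h
  · rw [Fin.coe_sub_iff_lt.2 h, Fin.sub_val_of_le h.le]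
    rw [Fin.lt_def] at h
    omega
  · rw [Fin.sub_val_of_le le_rfl]
    omega
  · rw [Fin.coe_sub_iff_lt.2 h, Fin.sub_val_of_le h.le]
    rw [Fin.lt_def] at h
    omega

/-- The sequence `p` with its `i`-th term left out. -/
def skip (i : ℕ) (p : ℕ → V) (j : ℕ) : V := p (if j < i then j else j + 1)

theorem IsPath.ne_iff {G : SimpleGraph V} {p : ℕ → V} {r : ℕ} (h : IsPath G p r) {i j : ℕ}
    (hi : i ≤ r) (hj : j ≤ r) : p i ≠ p j ↔ i ≠ j :=
  ⟨fun h e => h (by rw [e]), fun hn e => hn (h.1 i hi j hj e)⟩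

theorem IsPath.contract {G : SimpleGraph V} {p : ℕ → V} {r i : ℕ} (h : IsPath G p (r + 1))
    (_hi : 0 < i) (hir : i ≤ r) : IsPath (localComplement G (p i)) (skip i p) r := by
  refine ⟨fun a ha b hb hab => ?_, fun a ha b hb => ?_⟩
  · have := h.1 _ (by split_ifs <;> omega) _ (by split_ifs <;> omega) hab
    split_ifs at this <;> omega
  · unfold skip
    have ha' : (if a < i then a else a + 1) ≤ r + 1 := by split_ifs <;> omega
    have hb' : (if b < i then b else b + 1) ≤ r + 1 := by split_ifs <;> omega
    rw [localComplement_adj, h.2 _ ha' _ hb', h.2 i (by omega) _ ha', h.2 i (by omega) _ hb',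
      h.ne_iff ha' hb']
    split_ifs <;> omega

theorem IsPath.skip_first {G : SimpleGraph V} {p : ℕ → V} {r : ℕ} (h : IsPath G p (r + 1)) :
    IsPath G (fun i => p (i + 1)) r :=
  ⟨fun a ha b hb hab => by have := h.1 _ (by omega) _ (by omega) hab; omega,
    fun a ha b hb => by rw [h.2 (a + 1) (by omega) (b + 1) (by omega)]; omega⟩

theorem IsPath.of_le {G : SimpleGraph V} {p : ℕ → V} {r s : ℕ} (h : IsPath G p r) (hs : s ≤ r) :
    IsPath G p s :=
  ⟨fun a ha b hb => h.1 a (by omega) b (by omega), fun a ha b hb => h.2 a (by omega) b (by omega)⟩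

theorem IsPath.reverse {G : SimpleGraph V} {p : ℕ → V} {r : ℕ} (h : IsPath G p r) :
    IsPath G (fun i => p (r - i)) r :=
  ⟨fun a ha b hb hab => by have := h.1 _ (by omega) _ (by omega) hab; omega,
    fun a ha b hb => by rw [h.2 (r - a) (by omega) (r - b) (by omega)]; omega⟩

/-- A path closed up by two further paths with a common cap vertex set is an induced cycle. -/
theorem IsCyc.of_two_paths {G : SimpleGraph V} {p x : ℕ → V} {r d : ℕ} (hr : 1 ≤ r) (hd : 2 ≤ d)
    (hp : IsPath G p r) (h0 : x 0 = p 0) (hxd : x d = p r)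
    (hx : ∀ i ≤ d, ∀ j ≤ d, i < j → (i, j) ≠ (0, d) → x i ≠ x j ∧ (G.Adj (x i) (x j) ↔ j = i + 1))
    (hpx : ∀ i, 0 < i → i < r → ∀ j, 0 < j → j < d → p i ≠ x j ∧ ¬ G.Adj (p i) (x j)) :
    IsCyc G (fun i => if i ≤ r then p i else x (r + d - i)) (r + d) := by
  have key : ∀ i ≤ r, ∀ e, 0 < e → e < d → p i ≠ x e ∧
      (G.Adj (p i) (x e) ↔ (i = 0 ∧ e = 1) ∨ (i = r ∧ e + 1 = d)) := by
    intro i hi e he hed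
    rcases Nat.eq_zero_or_pos i with rfl | h0i
    · rw [← h0]
      have := hx 0 (by omega) e (by omega) he (by simp; omega)
      refine ⟨this.1, this.2.trans ?_⟩
      omega
    rcases Nat.lt_or_ge i r with hir | hir
    · have := hpx i h0i hir e he hed
      refine ⟨this.1, ⟨fun h => absurd h this.2, fun h => ?_⟩⟩
      omega
    · obtain rfl : i = r := by omega
      rw [← hxd]
      have := hx e (by omega) d (by omega) hed (by simp; omega)
      refine ⟨this.1.symm, ?_⟩
      rw [G.adj_comm, this.2]
      omega
  have xsym : ∀ i j, 0 < i → i < d → 0 < j → j < d → i ≠ j →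
      x i ≠ x j ∧ (G.Adj (x i) (x j) ↔ j = i + 1 ∨ i = j + 1) := by
    intro i j hi hid hj hjd hij
    rcases Nat.lt_or_gt_of_ne hij with h | h
    · have := hx i hid.le j hjd.le h (by simp; omega)
      refine ⟨this.1, this.2.trans ?_⟩
      omega
    · have := hx j hjd.le i hid.le h (by simp; omega)
      refine ⟨this.1.symm, ?_⟩
      rw [G.adj_comm, this.2]
      omega
  constructor
  · intro i hi j hj hij
    by_contra hne
    simp only at hij
    split_ifs at hij with h1 h2 h2
    · exact hne (hp.1 _ h1 _ h2 hij)
    · exact (key i h1 (r + d - j) (by omega) (by omega)).1 hij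
    · exact (key j h2 (r + d - i) (by omega) (by omega)).1 hij.symm
    · exact (xsym (r + d - i) (r + d - j) (by omega) (by omega) (by omega) (by omega)
        (by omega)).1 hij
  · intro i hi j hj
    simp only
    split_ifs with h1 h2 h2
    · rw [hp.2 i h1 j h2]; omega
    · rw [(key i h1 (r + d - j) (by omega) (by omega)).2]; omega
    · rw [G.adj_comm, (key j h2 (r + d - i) (by omega) (by omega)).2]; omega
    · by_cases hij : i = j
      · subst hij; simp; omega
      rw [(xsym (r + d - i) (r + d - j) (by omega) (by omega) (by omega) (by omega)
        (by omega)).2]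
      omega

/-- A fan whose hub misses an initial part of its path. -/
theorem hasCyc_of_partial_fan {n : ℕ} (hn : 3 ≤ n) (t : ℕ) : ∀ (G : SimpleGraph V) (p : ℕ → V)
    (w : V) (r j : ℕ), IsPath G p r → (∀ i ≤ r, w ≠ p i) → 1 ≤ j →
    (∀ i ≤ r, (G.Adj w (p i) ↔ i = 0 ∨ j ≤ i)) → j + 3 * t ≤ r → n ≤ j + 2 + 2 * t →
    HasCyc G n := by
  induction t with
  | zero =>
    intro G p w r j hp hw hj hadj hr hn'
    -- The hub together with `p 0, …, p j` is an induced cycle of length `j + 2`.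
    refine HasCyc.mono hn hn' ⟨G, _, LocallyEquivalent.refl G,
      IsCyc.of_two_paths (p := p) (x := fun i => if i = 0 then p 0 else if i = 1 then w else p j)
        (r := j) (d := 2) hj le_rfl (hp.of_le (by omega)) rfl rfl ?_ ?_⟩
    · intro a ha b hb hab hne
      have : (a = 0 ∧ b = 1) ∨ (a = 1 ∧ b = 2) := by
        simp at hne; omega
      rcases this with ⟨rfl, rfl⟩ | ⟨rfl, rfl⟩
      · simp only [if_true, one_ne_zero, if_false]
        exact ⟨(hw 0 (by omega)).symm, by simp [G.adj_comm _ w, hadj 0 (Nat.zero_le _)]⟩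
      · simp only [if_true, one_ne_zero, if_false]
        exact ⟨hw j (by omega), by simp [hadj j (by omega)]⟩
    · intro a ha har b hb hb2
      obtain rfl : b = 1 := by omega
      simp only [if_true, one_ne_zero, if_false]
      exact ⟨(hw a (by omega)).symm, by rw [G.adj_comm, hadj a (by omega)]; omega⟩
  | succ t ih =>
    intro G p w r j hp hw hj hadj hr hn'
    obtain ⟨r, rfl⟩ : ∃ r', r = r' + 1 := ⟨r - 1, by omega⟩
    -- Contracting `p (j + 1)` detaches the hub from `p j` and `p (j + 2)`, which become consecutive
    -- at positions `j` and `j + 1`. The gap grows by two and the path loses one vertex, hence the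
    -- cost of three path edges for each gain of two.
    refine HasCyc.of_locallyEquivalent (LocallyEquivalent.localComplement G (p (j + 1)))
      (ih _ (skip (j + 1) p) w r (j + 2) (hp.contract (by omega) (by omega)) ?_ (by omega) ?_
        (by omega) (by omega))
    · intro i hi
      exact hw _ (by split_ifs <;> omega)
    · intro i hi
      unfold skip
      have hi' : (if i < j + 1 then i else i + 1) ≤ r + 1 := by split_ifs <;> omega
      rw [localComplement_adj, hadj _ hi', G.adj_comm _ w, hadj _ (by omega),
        hp.2 _ (by omega) _ hi']
      have := hw _ hi'
      simp only [ne_eq, this, not_false_eq_true, true_and]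
      split_ifs <;> omega

open Classical in
/-- A vertex with many neighbours on an induced path gives a long cycle. -/
theorem hasCyc_of_fan {n t : ℕ} (hn : 3 ≤ n) (hnt : n ≤ 3 + 2 * t) (r : ℕ) :
    ∀ (G : SimpleGraph V) (p : ℕ → V) (w : V), IsPath G p r → (∀ i ≤ r, w ≠ p i) →
    2 + 3 * t ≤ ((Finset.range (r + 1)).filter fun i => G.Adj w (p i)).card → HasCyc G n := by
  induction r with
  | zero =>
    intro G p w _ _ hc
    have := Finset.card_filter_le (Finset.range (0 + 1)) (fun i => G.Adj w (p i))
    simp at this hc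
    omega
  | succ r ih =>
    intro G p w hp hw hc
    by_cases hall : ∀ i ≤ r + 1, G.Adj w (p i)
    · refine hasCyc_of_partial_fan hn t G p w (r + 1) 1 hp hw le_rfl ?_ ?_ (by omega)
      · intro i hi
        simp only [hall i hi, true_iff]
        omega
      · have := Finset.card_filter_le (Finset.range (r + 1 + 1)) (fun i => G.Adj w (p i))
        simp at this
        omega
    push Not at hall
    obtain ⟨i, hi, hwi⟩ := hall
    have hcard : ((Finset.range (r + 1 + 1)).filter fun j => G.Adj w (p j)).card ≤
        ((Finset.range (r + 1)).filter fun j => G.Adj w (skip i p j)).card := by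
      refine Finset.card_le_card_of_injOn (fun j => if j < i then j else j - 1) ?_ ?_
      · intro j hj
        simp only [Finset.coe_filter, Finset.mem_range, Set.mem_ofPred_eq] at hj ⊢
        have hji : j ≠ i := fun e => hwi (e ▸ hj.2)
        refine ⟨by split_ifs <;> omega, ?_⟩
        unfold skip
        have : (if (if j < i then j else j - 1) < i then (if j < i then j else j - 1)
          else (if j < i then j else j - 1) + 1) = j := by split_ifs <;> omega
        rw [this]
        exact hj.2
      · intro j hj k hk hjk
        simp only [Finset.coe_filter, Finset.mem_range, Set.mem_ofPred_eq] at hj hk hjk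
        have hji : j ≠ i := fun e => hwi (e ▸ hj.2)
        have hki : k ≠ i := fun e => hwi (e ▸ hk.2)
        split_ifs at hjk <;> omega
    have hw' : ∀ j ≤ r, w ≠ skip i p j := fun j hj => hw _ (by split_ifs <;> omega)
    -- A non-neighbour of the hub is removed without changing the hub's adjacencies: inner vertices
    -- are contracted, end vertices deleted.
    by_cases hmid : 0 < i ∧ i ≤ r
    · refine HasCyc.of_locallyEquivalent (LocallyEquivalent.localComplement G (p i))
        (ih _ (skip i p) w (hp.contract hmid.1 hmid.2) hw' (hc.trans (hcard.trans_eq ?_)))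
      congr 1
      apply Finset.filter_congr
      intro j hj
      rw [localComplement_adj, G.adj_comm _ w]
      have := hw' j (by simp at hj; omega)
      tauto
    · refine ih G (skip i p) w ?_ hw' (hc.trans hcard)
      rcases Nat.eq_zero_or_pos i with rfl | hi0
      · exact hp.skip_first
      · obtain rfl : i = r + 1 := by omega
        refine ⟨fun a ha b hb hab => ?_, fun a ha b hb => ?_⟩
        · simp only [skip, show a < r + 1 by omega, show b < r + 1 by omega, if_true] at hab
          exact hp.1 _ (by omega) _ (by omega) hab
        · simp only [skip, show a < r + 1 by omega, show b < r + 1 by omega, if_true]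
          exact hp.2 _ (by omega) _ (by omega)

/-- An induced path whose interior has no neighbours in `N` is part of a long induced cycle,
unless its ends are separated in `N`. -/
theorem hasCyc_or_separated {G : SimpleGraph V} {p : ℕ → V} {r n : ℕ} {N : Set V} (hn : 3 ≤ n)
    (hr : 1 ≤ r) (hnr : n ≤ r + 2) (hp : IsPath G p r) (hN : ∀ i ≤ r, p i ∉ N)
    (hint : ∀ i, 0 < i → i < r → ∀ y ∈ N, ¬ G.Adj (p i) y) :
    HasCyc G n ∨ ∃ K ⊆ N, (∀ y ∈ N, G.Adj (p 0) y → y ∈ K) ∧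
      (∀ x ∈ K, ∀ y ∈ N, G.Adj x y → y ∈ K) ∧ ∀ x ∈ K, ¬ G.Adj x (p r) := by
  classical
  -- `Good d`: there is a walk of length `d ≥ 2` between the ends of the path with all inner
  -- vertices in `N`. A shortest one closes the path into an induced cycle.
  let Good : ℕ → Prop := fun d => 2 ≤ d ∧ ∃ x : ℕ → V, x 0 = p 0 ∧ x d = p r ∧
    (∀ i, 0 < i → i < d → x i ∈ N) ∧ ∀ i < d, G.Adj (x i) (x (i + 1))
  by_cases hex : ∃ d, Good d
  · left
    obtain ⟨hd, x, h0, hxd, hxN, hxa⟩ := Nat.find_spec hex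
    set d := Nat.find hex with hd_def
    have hmin : ∀ d', d' < d → ¬ Good d' := fun d' h => Nat.find_min hex h
    -- A repetition or a chord would give a shorter walk. The pair `(0, d)` is exempt: those two
    -- vertices are the ends of the path and may be adjacent.
    have hx : ∀ i ≤ d, ∀ j ≤ d, i < j → (i, j) ≠ (0, d) →
        x i ≠ x j ∧ (G.Adj (x i) (x j) ↔ j = i + 1) := by
      intro i hi j hj hij hne
      have hne' : ¬ (i = 0 ∧ j = d) := by simpa using hne
      constructor
      · intro e
        by_cases h0i : i = 0
        · exact hN 0 (by omega) (h0 ▸ h0i ▸ e ▸ hxN j (by omega) (by omega))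
        by_cases hjd : j = d
        · exact hN r le_rfl (hxd ▸ hjd ▸ e ▸ hxN i (by omega) (by omega))
        refine hmin (d - (j - i)) (by omega) ⟨by omega,
          fun a => if a ≤ i then x a else x (a + (j - i)), ?_, ?_, ?_, ?_⟩
        · simp [h0]
        · simp only [show ¬ (d - (j - i) ≤ i) by omega, if_false]
          rw [show d - (j - i) + (j - i) = d by omega, hxd]
        · intro a ha had
          simp only
          split_ifs
          · exact hxN a ha (by omega)
          · exact hxN _ (by omega) (by omega)
        · intro a ha
          simp only
          split_ifs with h1 h2 h2
          · exact hxa a (by omega)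
          · obtain rfl : a = i := by omega
            rw [e, show a + 1 + (j - a) = j + 1 by omega]
            exact hxa j (by omega)
          · omega
          · rw [show a + 1 + (j - i) = a + (j - i) + 1 by omega]
            exact hxa _ (by omega)
      · refine ⟨fun hadj => ?_, fun e => e ▸ hxa i (by omega)⟩
        by_contra hji
        refine hmin (d - (j - i - 1)) (by omega) ⟨by omega,
          fun a => if a ≤ i then x a else x (a + (j - i - 1)), ?_, ?_, ?_, ?_⟩
        · simp [h0]
        · simp only [show ¬ (d - (j - i - 1) ≤ i) by omega, if_false]
          rw [show d - (j - i - 1) + (j - i - 1) = d by omega, hxd]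
        · intro a ha had
          simp only
          split_ifs
          · exact hxN a ha (by omega)
          · exact hxN _ (by omega) (by omega)
        · intro a ha
          simp only
          split_ifs with h1 h2 h2
          · exact hxa a (by omega)
          · obtain rfl : a = i := by omega
            rw [show a + 1 + (j - a - 1) = j by omega]
            exact hadj
          · omega
          · rw [show a + 1 + (j - i - 1) = a + (j - i - 1) + 1 by omega]
            exact hxa _ (by omega)
    refine HasCyc.mono hn (m := r + d) (by omega) ⟨G, _, LocallyEquivalent.refl G,
      IsCyc.of_two_paths hr hd hp h0 hxd hx ?_⟩
    intro i hi hir j hj hjd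
    exact ⟨fun e => hN i hir.le (e ▸ hxN j hj hjd), hint i hi hir _ (hxN j hj hjd)⟩
  · right
    -- `K` is the set of vertices of `N` reachable from `p 0` by walks through `N`.
    refine ⟨{y | ∃ d, 1 ≤ d ∧ ∃ x : ℕ → V, x 0 = p 0 ∧ x d = y ∧
      (∀ i, 0 < i → i ≤ d → x i ∈ N) ∧ ∀ i < d, G.Adj (x i) (x (i + 1))}, ?_, ?_, ?_, ?_⟩
    · rintro y ⟨d, hd, x, -, rfl, hx, -⟩
      exact hx d hd le_rfl
    · intro y hy hadj
      refine ⟨1, le_rfl, fun a => if a = 0 then p 0 else y, rfl, rfl, ?_, ?_⟩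
      · intro i hi _
        simp [hi.ne', hy]
      · intro i hi
        obtain rfl : i = 0 := by omega
        simpa using hadj
    · rintro z ⟨d, hd, x, h0, rfl, hx, hxa⟩ y hy hadj
      refine ⟨d + 1, by omega, fun a => if a ≤ d then x a else y, ?_, ?_, ?_, ?_⟩
      · simp [h0]
      · simp
      · intro i hi _
        simp only
        split_ifs
        · exact hx i hi (by omega)
        · exact hy
      · intro i hi
        simp only [show i ≤ d by omega, if_true]
        split_ifs
        · exact hxa i (by omega)
        · obtain rfl : i = d := by omega
          exact hadj
    · rintro z ⟨d, hd, x, h0, rfl, hx, hxa⟩ hadj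
      refine hex ⟨d + 1, by omega, fun a => if a ≤ d then x a else p r, ?_, ?_, ?_, ?_⟩
      · simp [h0]
      · simp
      · intro i hi _
        simp only [show i ≤ d by omega, if_true]
        exact hx i hi (by omega)
      · intro i hi
        simp only [show i ≤ d by omega, if_true]
        split_ifs
        · exact hxa i (by omega)
        · obtain rfl : i = d := by omega
          exact hadj

end

/-! ### Linkedness, tight sets and uncrossing -/

section

variable {V : Type*}

/-- `(X, Y)` is a partition of `U`. -/
structure Part (U X Y : Set V) : Prop where
  disj : ∀ x ∈ X, x ∉ Y
  mem_iff : ∀ x, x ∈ U ↔ x ∈ X ∨ x ∈ Y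

theorem Part.symm {U X Y : Set V} (h : Part U X Y) : Part U Y X :=
  ⟨fun x hx hx' => h.disj x hx' hx, fun x => by rw [h.mem_iff]; tauto⟩

theorem Part.diff {U X : Set V} (h : X ⊆ U) : Part U X (U \ X) :=
  ⟨fun _ hx hx' => hx'.2 hx, fun x => ⟨fun hx => by by_cases h' : x ∈ X <;> simp [h', hx],
    fun hx => hx.elim (fun a => h a) fun a => a.1⟩⟩

theorem Part.insert_left {U X Y : Set V} {z : V} (h : Part (U \ {z}) X Y) (hz : z ∈ U) :
    Part U (insert z X) Y := by
  refine ⟨?_, fun x => ?_⟩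
  · rintro x (rfl | hx) hy
    · exact ((h.mem_iff x).2 (Or.inr hy)).2 rfl
    · exact h.disj x hx hy
  · have := h.mem_iff x
    by_cases hxz : x = z
    · simp [hxz, hz]
    · simpa [hxz] using this

theorem Part.insert_right {U X Y : Set V} {z : V} (h : Part (U \ {z}) X Y) (hz : z ∈ U) :
    Part U X (insert z Y) := (h.symm.insert_left hz).symm

theorem Part.diff_eq {U X Y : Set V} (h : Part U X Y) : U \ X = Y := by
  ext x
  exact ⟨fun hx => ((h.mem_iff x).1 hx.1).resolve_left hx.2,
    fun hx => ⟨(h.mem_iff x).2 (Or.inr hx), fun hx' => h.disj x hx' hx⟩⟩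

theorem Part.union_inter {U X Y X' Y' : Set V} (h : Part U X Y) (h' : Part U X' Y') :
    Part U (X ∪ X') (Y ∩ Y') := by
  refine ⟨fun x hx hy => hx.elim (fun hx => h.disj x hx hy.1) fun hx => h'.disj x hx hy.2,
    fun x => ?_⟩
  have h1 := h.mem_iff x
  have h2 := h'.mem_iff x
  simp only [Set.mem_union, Set.mem_inter_iff]
  tauto

theorem Part.notMem {U X Y : Set V} {z : V} (h : Part (U \ {z}) X Y) : z ∉ X ∧ z ∉ Y := by
  have := h.mem_iff z
  simp only [Set.mem_sdiff, Set.mem_singleton_iff, not_true_eq_false, and_false, false_iff,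
    not_or] at this
  exact this

theorem Part.union_insert {U X Y X' Y' : Set V} {z : V} (h : Part (U \ {z}) X Y)
    (h' : Part (U \ {z}) X' Y') (hz : z ∈ U) : Part U (X ∪ insert z X') (Y ∩ insert z Y') := by
  have := (h.insert_right hz).union_inter (h'.insert_left hz)
  have e : insert z Y ∩ Y' = Y ∩ insert z Y' := by
    ext x
    by_cases hx : x = z
    · subst hx; simp [h.notMem, h'.notMem]
    · simp [hx]
  rwa [e] at this

theorem Part.disjoint {U X Y : Set V} (h : Part U X Y) : Disjoint X Y :=
  Set.disjoint_left.2 h.disj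

/-- Every partition of `U` separating `A` from `B` has cut-rank at least two. -/
def Linked (G : SimpleGraph V) (U A B : Set V) : Prop :=
  ∀ X Y, A ⊆ X → B ⊆ Y → Part U X Y → ¬ rk (adjF G) X Y ≤ 1

theorem Linked.mono {G : SimpleGraph V} {U A B A' B' : Set V} (h : Linked G U A B) (hA : A ⊆ A')
    (hB : B ⊆ B') : Linked G U A' B' :=
  fun X Y hX hY => h X Y (hA.trans hX) (hB.trans hY)

theorem Linked.symm [Finite V] {G : SimpleGraph V} {U A B : Set V} (h : Linked G U A B) :
    Linked G U B A := fun X Y hX hY hP hr =>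
  h Y X hY hX hP.symm (rk_le_comm (adjF_comm G) hr)

/-- If both operations failed, there would be two partitions of `U \ {z}` of rank at most one, one
for `G` and one for `localComplement G z`. Putting `z` on both sides of the second costs one unit of
rank, so submodularity bounds two cut-ranks of `G` by `1 + 2` in total, whereas linkedness makes
each at least two. -/
theorem linked_delete_or_contract [Finite V] {G : SimpleGraph V} {U A B : Set V}
    (h : Linked G U A B) {z : V} (hz : z ∈ U) :
    Linked G (U \ {z}) A B ∨ Linked (localComplement G z) (U \ {z}) A B := by
  classical
  by_contra! hc
  obtain ⟨h1, h2⟩ := hc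
  simp only [Linked, not_forall, not_not] at h1 h2
  obtain ⟨X₁, Y₁, hA₁, hB₁, hP₁, hr₁⟩ := h1
  obtain ⟨X₂, Y₂, hA₂, hB₂, hP₂, hr₂⟩ := h2
  have hz1 := hP₁.notMem
  -- With a one in the diagonal position of `z`, eliminating that entry produces `localComplement G
  -- z` off the diagonal; this is why the block enlarged by `z` has rank at most `1 + 1`.
  let M : V → V → ZMod 2 := fun x y => if x = z ∧ y = z then 1 else adjF G x y
  have hM : rk M (insert z X₂) (insert z Y₂) ≤ 2 := by
    obtain ⟨f, g, hfg⟩ := rk_le_one_iff.1 hr₂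
    refine rk_le_two_iff.2 ⟨fun x => if x = z then 0 else f x, fun y => if y = z then 0 else g y,
      fun x => if x = z then 1 else adjF G z x, fun x => if x = z then 1 else adjF G z x, ?_⟩
    intro x hx y hy
    by_cases hxz : x = z
    · by_cases hyz : y = z <;> simp [M, hxz, hyz]
    by_cases hyz : y = z
    · simp [M, hxz, hyz, adjF_comm G x z]
    have hx' := hx.resolve_left hxz
    have hy' := hy.resolve_left hyz
    have hne : x ≠ y := fun e => hP₂.disj x hx' (e ▸ hy')
    have := hfg x hx' y hy'
    rw [adjF_localComplement G z hne] at this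
    simp only [M, hxz, hyz, false_and, if_false]
    rw [← this, add_assoc, CharTwo.add_self_eq_zero, add_zero]
  have hs := rk_submodular M X₁ (insert z X₂) Y₁ (insert z Y₂)
  have e1 : rk M X₁ Y₁ = rk (adjF G) X₁ Y₁ := rk_congr fun x hx y _ => by
    have : x ≠ z := fun e => hz1.1 (e ▸ hx)
    simp [M, this]
  have e2 : rk M (X₁ ∪ insert z X₂) (Y₁ ∩ insert z Y₂) =
      rk (adjF G) (X₁ ∪ insert z X₂) (Y₁ ∩ insert z Y₂) := rk_congr fun x _ y hy => by
    have : y ≠ z := fun e => hz1.2 (e ▸ hy.1)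
    simp [M, this]
  have e3 : rk M (X₁ ∩ insert z X₂) (Y₁ ∪ insert z Y₂) =
      rk (adjF G) (X₁ ∩ insert z X₂) (Y₁ ∪ insert z Y₂) := rk_congr fun x hx y _ => by
    have : x ≠ z := fun e => hz1.1 (e ▸ hx.1)
    simp [M, this]
  have l1 := h (X₁ ∪ insert z X₂) (Y₁ ∩ insert z Y₂) (fun x hx => Or.inl (hA₁ hx))
    (fun x hx => ⟨hB₁ hx, Or.inr (hB₂ hx)⟩) (hP₁.union_insert hP₂ hz)
  have l2 := h (X₁ ∩ insert z X₂) (Y₁ ∪ insert z Y₂) (fun x hx => ⟨hA₁ hx, Or.inr (hA₂ hx)⟩)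
    (fun x hx => Or.inl (hB₁ hx)) (hP₁.symm.union_insert hP₂.symm hz).symm
  omega

/-- Linking: local complementations at `D` realise the connectivity between `A` and `B`. -/
theorem exists_linking [Finite V] {A B : Set V} (n : ℕ) : ∀ (G : SimpleGraph V) (D : Set V),
    D.ncard = n → Linked G (A ∪ D ∪ B) A B → (∀ x ∈ A, x ∉ B) → (∀ x ∈ D, x ∉ A ∧ x ∉ B) →
    ∃ l : List V, (∀ v ∈ l, v ∈ D) ∧ ¬ rk (adjF (l.foldl localComplement G)) A B ≤ 1 := by
  induction n with
  | zero =>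
    intro G D hD h hAB _
    rw [Set.ncard_eq_zero] at hD
    subst hD
    exact ⟨[], by simp, h A B subset_rfl subset_rfl ⟨hAB, fun x => by simp⟩⟩
  | succ n ih =>
    intro G D hD h hAB hDAB
    obtain ⟨z, hz⟩ : D.Nonempty := by
      rw [← Set.ncard_pos]; omega
    have hset : (A ∪ D ∪ B) \ {z} = A ∪ (D \ {z}) ∪ B := by
      ext x
      by_cases hx : x = z
      · subst hx; have := hDAB x hz; simp [this]
      · simp [hx]
    have hcard : (D \ {z}).ncard = n := by
      rw [Set.ncard_sdiff_singleton_of_mem hz, hD]; rfl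
    -- Deleting `z` adds nothing to the list, contracting it adds one local complementation.
    rcases linked_delete_or_contract h (z := z) (Or.inl (Or.inr hz)) with h' | h'
    · rw [hset] at h'
      obtain ⟨l, hl, hr⟩ := ih G _ hcard h' hAB fun x hx => hDAB x hx.1
      exact ⟨l, fun v hv => (hl v hv).1, hr⟩
    · rw [hset] at h'
      obtain ⟨l, hl, hr⟩ := ih _ _ hcard h' hAB fun x hx => hDAB x hx.1
      refine ⟨z :: l, ?_, hr⟩
      intro v hv
      rcases List.mem_cons.1 hv with rfl | hv
      · exact hz
      · exact (hl v hv).1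

/-- Uncross with a partition `(X', Y')` of rank at most one that exists because `w` is essential.
Against `(X, insert w Y)` this shows that `(X' ∪ X, Y' ∩ Y)` still has rank at most one; against
`(insert w X, Y)` it then brings `(X, Y)` down to one. Linkedness bounds the other term from below
both times. -/
theorem rk_le_one_of_not_linked [Finite V] {G : SimpleGraph V} {U A B X Y : Set V} {w : V}
    (h : Linked G U A B) (hwU : w ∈ U) (hw : ¬ Linked G (U \ {w}) A B)
    (hA : A ⊆ X) (hB : B ⊆ Y) (hP : Part (U \ {w}) X Y)
    (h1 : rk (adjF G) X (insert w Y) ≤ 2) (h2 : rk (adjF G) (insert w X) Y ≤ 2) :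
    rk (adjF G) X Y ≤ 1 := by
  simp only [Linked, not_forall, not_not] at hw
  obtain ⟨X', Y', hA', hB', hP', hr'⟩ := hw
  have hz2 := hP'.notMem
  have key : rk (adjF G) (X' ∪ X) (Y' ∩ Y) ≤ 1 := by
    have hs := rk_submodular (adjF G) X' X Y' (insert w Y)
    have e' : X' ∩ insert w X = X' ∩ X := by
      ext x
      by_cases hxz : x = w
      · subst hxz; simp [hz2]
      · simp [hxz]
    have l := h (X' ∩ X) (Y' ∪ insert w Y) (fun x hx => ⟨hA' hx, hA hx⟩)
      (fun x hx => Or.inl (hB' hx)) (by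
        have := (hP'.symm.union_insert hP.symm hwU).symm
        rwa [e'] at this)
    have e : Y' ∩ insert w Y = Y' ∩ Y := by
      ext x
      by_cases hxz : x = w
      · subst hxz; simp [hz2]
      · simp [hxz]
    rw [e] at hs
    omega
  have hs := rk_submodular (adjF G) (X' ∪ X) (insert w X) (Y' ∩ Y) Y
  have l := h ((X' ∪ X) ∪ insert w X) ((Y' ∩ Y) ∩ Y) (fun x hx => Or.inl (Or.inl (hA' hx)))
    (fun x hx => ⟨⟨hB' hx, hB hx⟩, hB hx⟩) (by
      have := (hP'.union_insert hP hwU).union_inter (hP.insert_left hwU)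
      have e1 : X' ∪ insert w X ∪ insert w X = X' ∪ X ∪ insert w X := by
        ext x; simp only [Set.mem_union, Set.mem_insert_iff]; tauto
      have e2 : Y' ∩ insert w Y ∩ Y = Y' ∩ Y ∩ Y := by
        ext x; simp only [Set.mem_inter_iff, Set.mem_insert_iff]; tauto
      rwa [e1, e2] at this)
  have m := rk_mono (adjF G) (R := X) (R' := (X' ∪ X) ∩ insert w X) (C := Y)
    (C' := (Y' ∩ Y) ∪ Y) (fun x hx => ⟨Or.inr hx, Or.inr hx⟩) (fun x hx => Or.inr hx)
  omega

/-- A set separating `A` from `B` with cut-rank at most two. -/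
structure TightSet (G : SimpleGraph V) (U A B X : Set V) : Prop where
  left : A ⊆ X
  sub : X ⊆ U
  right : ∀ x ∈ B, x ∉ X
  le : rk (adjF G) X (U \ X) ≤ 2

/-- Some tight set stays tight when `z` is added to it. -/
def TightAt (G : SimpleGraph V) (U A B : Set V) (z : V) : Prop :=
  ∃ X, z ∉ X ∧ TightSet G U A B X ∧ TightSet G U A B (insert z X)

/-- The two cut-ranks add up to at most four and linkedness makes each at least two. -/
theorem TightSet.union_inter [Finite V] {G : SimpleGraph V} {U A B X Y : Set V}
    (h : Linked G U A B) (hBU : B ⊆ U) (hX : TightSet G U A B X) (hY : TightSet G U A B Y) :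
    TightSet G U A B (X ∪ Y) ∧ TightSet G U A B (X ∩ Y) := by
  have hs := rk_submodular (adjF G) X Y (U \ X) (U \ Y)
  have e1 : (U \ X) ∩ (U \ Y) = U \ (X ∪ Y) := by ext; simp; tauto
  have e2 : (U \ X) ∪ (U \ Y) = U \ (X ∩ Y) := by ext; simp; tauto
  have hxy : X ∪ Y ⊆ U := Set.union_subset hX.sub hY.sub
  have hxy' : X ∩ Y ⊆ U := fun x hx => hX.sub hx.1
  have hb1 : ∀ x ∈ B, x ∉ X ∪ Y := fun x hx hx' => hx'.elim (hX.right x hx) (hY.right x hx)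
  have hb2 : ∀ x ∈ B, x ∉ X ∩ Y := fun x hx hx' => hX.right x hx hx'.1
  have l1 := h (X ∪ Y) (U \ (X ∪ Y)) (fun x hx => Or.inl (hX.left hx))
    (fun x hx => ⟨hBU hx, hb1 x hx⟩) (Part.diff hxy)
  have l2 := h (X ∩ Y) (U \ (X ∩ Y)) (fun x hx => ⟨hX.left hx, hY.left hx⟩)
    (fun x hx => ⟨hBU hx, hb2 x hx⟩) (Part.diff hxy')
  have h1 := hX.le
  have h2 := hY.le
  rw [e1, e2] at hs
  exact ⟨⟨fun x hx => Or.inl (hX.left hx), hxy, hb1, by omega⟩,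
    ⟨fun x hx => ⟨hX.left hx, hY.left hx⟩, hxy', hb2, by omega⟩⟩

/-- Tight sets can be grown one vertex at a time. Take a minimal tight `T` strictly above `X` and
any `z ∈ T \ X`, and let `Y` witness `TightAt` for `z`. Uncrossing `Y` and `insert z Y` with `X` and
`T` shows that `insert z X` is tight. -/
theorem TightSet.exists_insert [Finite V] {G : SimpleGraph V} {U A B X : Set V}
    (h : Linked G U A B) (hBU : B ⊆ U)
    (htop : TightSet G U A B (U \ B))
    (hz : ∀ z ∈ U, z ∉ A → z ∉ B → TightAt G U A B z) (hX : TightSet G U A B X)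
    (hne : ∃ z ∈ U, z ∉ B ∧ z ∉ X) : ∃ z ∈ U, z ∉ X ∧ z ∉ B ∧ TightSet G U A B (insert z X) := by
  obtain ⟨T, ⟨hT, hXT⟩, hmin⟩ := exists_minimal_of_wellFoundedLT
    (fun T => TightSet G U A B T ∧ X ⊂ T) ⟨U \ B, htop, by
      refine ⟨fun x hx => ⟨hX.sub hx, fun hb => hX.right x hb hx⟩, fun hs => ?_⟩
      obtain ⟨z, hzU, hzB, hzX⟩ := hne
      exact hzX (hs ⟨hzU, hzB⟩)⟩
  obtain ⟨z, hzT, hzX⟩ := Set.exists_of_ssubset hXT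
  have hzB : z ∉ B := fun hb => hT.right z hb hzT
  refine ⟨z, hT.sub hzT, hzX, hzB, ?_⟩
  obtain ⟨Y, hzY, hY, hY'⟩ := hz z (hT.sub hzT) (fun hA => hzX (hX.left hA)) hzB
  -- Both sets lie between `X` and `T`. The first omits `z`, so minimality of `T` forces it to be
  -- `X`; the second is then `insert z X`.
  have t1 := (TightSet.union_inter h hBU (TightSet.union_inter h hBU hX hY).1 hT).2
  have t2 := (TightSet.union_inter h hBU (TightSet.union_inter h hBU hX hY').1 hT).2
  have e1 : (X ∪ Y) ∩ T = X := by
    by_contra hne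
    have hss : X ⊂ (X ∪ Y) ∩ T := by
      refine ssubset_of_subset_of_ne (fun x hx => ⟨Or.inl hx, hXT.1 hx⟩) (Ne.symm hne)
    have := hmin ⟨t1, hss⟩ (fun x hx => hx.2) hzT
    exact this.1.elim hzX hzY
  have e2 : (X ∪ insert z Y) ∩ T = insert z X := by
    ext x
    have := Set.ext_iff.1 e1 x
    by_cases hxz : x = z
    · subst hxz; simp [hzT]
    · simp [hxz] at this ⊢; exact this
  rwa [e2] at t2

theorem exists_tight_enumeration [Finite V] {G : SimpleGraph V} {U A B : Set V}
    (h : Linked G U A B) (hAB : ∀ x ∈ A, x ∉ B) (hAU : A ⊆ U) (hBU : B ⊆ U)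
    (hA2 : rk (adjF G) A (U \ A) ≤ 2) (hB2 : rk (adjF G) (U \ B) B ≤ 2)
    (hz : ∀ z ∈ U, z ∉ A → z ∉ B → TightAt G U A B z) (v₀ : V) (k : ℕ)
    (hk : k ≤ ((U \ A) \ B).ncard) :
    ∃ z : ℕ → V, (∀ i < k, ∀ j < k, z i = z j → i = j) ∧
      (∀ i < k, z i ∈ U ∧ z i ∉ A ∧ z i ∉ B) ∧
      ∀ j ≤ k, TightSet G U A B (A ∪ z '' Set.Iio j) := by
  have hUB : U \ (U \ B) = B := by
    ext x; have := @hBU x; simp; tauto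
  have htop : TightSet G U A B (U \ B) :=
    ⟨fun x hx => ⟨hAU hx, hAB x hx⟩, fun x hx => hx.1, fun x hx hx' => hx'.2 hx, by rwa [hUB]⟩
  induction k with
  | zero =>
    refine ⟨fun _ => v₀, by omega, by omega, fun j hj => ?_⟩
    obtain rfl : j = 0 := by omega
    have : A ∪ (fun _ => v₀) '' Set.Iio 0 = A := by
      ext; simp
    rw [this]
    exact ⟨subset_rfl, hAU, fun x hx hx' => hAB x hx' hx, hA2⟩
  | succ k ih =>
    obtain ⟨z, hinj, hmem, htight⟩ := ih (by omega)
    have hex : ∃ y ∈ U, y ∉ B ∧ y ∉ A ∪ z '' Set.Iio k := by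
      by_contra! hc
      have hsub : (U \ A) \ B ⊆ z '' Set.Iio k := fun x hx => by
        by_contra hx'
        exact (hc x hx.1.1 hx.2).elim hx.1.2 hx'
      have h1 := Set.ncard_le_ncard hsub (Set.toFinite _)
      have h2 := Set.ncard_image_le (f := z) (Set.finite_Iio k)
      have h3 : (Set.Iio k).ncard = k := by
        rw [Set.ncard_eq_toFinset_card', Set.toFinset_Iio, Nat.card_Iio]
      omega
    obtain ⟨y, hyU, hyX, hyB, hyT⟩ := TightSet.exists_insert h hBU htop hz
      (htight k le_rfl) hex
    have hset : ∀ j ≤ k, (fun i => if i < k then z i else y) '' Set.Iio j = z '' Set.Iio j := by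
      intro j hj
      refine Set.image_congr fun i hi => ?_
      simp only [Set.mem_Iio] at hi
      simp [show i < k by omega]
    refine ⟨fun i => if i < k then z i else y, ?_, ?_, ?_⟩
    · intro i hi j hj hij
      simp only at hij
      split_ifs at hij with h1 h2 h2
      · exact hinj i h1 j h2 hij
      · exact absurd (Or.inr ⟨i, h1, hij⟩) hyX
      · exact absurd (Or.inr ⟨j, h2, hij.symm⟩) hyX
      · omega
    · intro i hi
      simp only
      split_ifs with h1
      · exact hmem i h1
      · exact ⟨hyU, fun hA => hyX (Or.inl hA), hyB⟩
    · intro j hj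
      rcases Nat.lt_or_ge j (k + 1) with hj' | hj'
      · rw [hset j (by omega)]
        exact htight j (by omega)
      · obtain rfl : j = k + 1 := by omega
        have : A ∪ (fun i => if i < k then z i else y) '' Set.Iio (k + 1) =
            insert y (A ∪ z '' Set.Iio k) := by
          have e : (Set.Iio (k + 1) : Set ℕ) = insert k (Set.Iio k) := by
            ext; simp only [Set.mem_Iio, Set.mem_insert_iff]; omega
          rw [e, Set.image_insert_eq, hset k le_rfl]
          simp [Set.union_insert]
        rw [this]
        exact hyT

/-- Every subset of `A` with at least two vertices has cut-rank at least two in `G[U]`. -/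
def Robust (G : SimpleGraph V) (U A : Set V) : Prop :=
  ∀ S ⊆ A, S.Nontrivial → ¬ rk (adjF G) S (U \ S) ≤ 1

/-- Submodularity for `S ⊆ A` says that shrinking `U` to `U'` costs `S` no more rank than it costs
`A`, and `A` keeps its rank two. -/
theorem Robust.subset [Finite V] {G : SimpleGraph V} {U U' A : Set V} (h : Robust G U A)
    (hU : U' ⊆ U) (hA : A ⊆ U') (h2 : rk (adjF G) A (U \ A) ≤ 2)
    (h1 : ¬ rk (adjF G) A (U' \ A) ≤ 1) : Robust G U' A := by
  intro S hS hS2 hr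
  refine h S hS hS2 ?_
  have hs := rk_submodular (adjF G) S A (U' \ S) (U \ A)
  have e1 : (U' \ S) ∩ (U \ A) = U' \ A := by
    ext x; have := @hS x; have := @hU x; simp; tauto
  have e2 : (U' \ S) ∪ (U \ A) = U \ S := by
    ext x; have := @hS x; have := @hU x; have := @hA x; simp; tauto
  rw [e1, e2, Set.union_eq_self_of_subset_left hS, Set.inter_eq_self_of_subset_left hS] at hs
  omega

theorem Robust.localComplement [Finite V] {G : SimpleGraph V} {U A : Set V} (h : Robust G U A)
    (hA : A ⊆ U) {v : V} (hv : v ∈ U) : Robust (localComplement G v) U A := by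
  intro S hS hS2 hr
  have hP := Part.diff (hS.trans hA)
  rw [rk_localComplement G hP.disjoint ((hP.mem_iff v).1 hv)] at hr
  exact h S hS hS2 hr

theorem not_rk_le_two [Finite V] {M : V → V → ZMod 2} {C : Set V} {a b c : V}
    (h : ∀ x y z : ZMod 2, (∀ v ∈ C, x * M a v + y * M b v + z * M c v = 0) →
      x = 0 ∧ y = 0 ∧ z = 0) : ¬ rk M {a, b, c} C ≤ 2 := by
  intro hr
  obtain ⟨f, g, f', g', hfg⟩ := rk_le_two_iff.1 hr
  have key : ∀ a1 a2 b1 b2 c1 c2 : ZMod 2, ∃ x y z : ZMod 2, ¬ (x = 0 ∧ y = 0 ∧ z = 0) ∧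
      x * a1 + y * b1 + z * c1 = 0 ∧ x * a2 + y * b2 + z * c2 = 0 := by decide
  obtain ⟨x, y, z, hne, h1, h2⟩ := key (f a) (f' a) (f b) (f' b) (f c) (f' c)
  refine hne (h x y z fun v hv => ?_)
  rw [hfg a (by simp) v hv, hfg b (by simp) v hv, hfg c (by simp) v hv]
  linear_combination g v * h1 + g' v * h2

theorem rk_le_two_of_dependent [Finite V] {M : V → V → ZMod 2} {C : Set V} {a b c : V}
    (hab : a ≠ b) (hac : a ≠ c) (hbc : b ≠ c) {x y z : ZMod 2}
    (hne : ¬ (x = 0 ∧ y = 0 ∧ z = 0)) (h : ∀ v ∈ C, x * M a v + y * M b v + z * M c v = 0) :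
    rk M {a, b, c} C ≤ 2 := by
  classical
  have neg : ∀ p q : ZMod 2, p + q = 0 → p = q := by decide
  rw [rk_le_two_iff]
  by_cases hx : x = 1
  · refine ⟨fun t => if t = b then 1 else if t = a then y else 0, M b,
      fun t => if t = c then 1 else if t = a then z else 0, M c, ?_⟩
    rintro _ (rfl | rfl | rfl) v hv
    · have := h v hv
      simp [hab, hac]
      rw [hx, one_mul, add_assoc] at this
      exact neg _ _ this
    · simp [hab.symm, hbc]
    · simp [hbc.symm, hac.symm]
  have hx0 : x = 0 := (zmod_two_cases x).resolve_right hx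
  by_cases hy : y = 1
  · refine ⟨fun t => if t = a then 1 else 0, M a,
      fun t => if t = c then 1 else if t = b then z else 0, M c, ?_⟩
    rintro _ (rfl | rfl | rfl) v hv
    · simp [hab, hac]
    · have := h v hv
      simp [hab.symm, hbc]
      rw [hx0, hy, zero_mul, one_mul, zero_add] at this
      exact neg _ _ this
    · simp [hac.symm]
  have hy0 : y = 0 := (zmod_two_cases y).resolve_right hy
  have hz : z = 1 := (zmod_two_cases z).resolve_left fun hz => hne ⟨hx0, hy0, hz⟩
  refine ⟨fun t => if t = a then 1 else 0, M a, fun t => if t = b then 1 else 0, M b, ?_⟩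
  rintro _ (rfl | rfl | rfl) v hv
  · simp [hab]
  · simp [hab.symm]
  · have := h v hv
    simp [hac.symm, hbc.symm]
    simpa [hx0, hy0, hz] using this

end

/-! ### Minimal linking sets and contraction of the path -/

section

variable {V : Type*}

/-- A graph on a path together with a set `W` of further vertices, none of which can be deleted
without losing the connectivity between the two ends of the path. -/
structure PathState (G : SimpleGraph V) (p : ℕ → V) (r : ℕ) (W : Set V) : Prop where
  path : IsPath G p r
  three_le : 3 ≤ r
  notMem : ∀ i ≤ r, p i ∉ W
  linked : Linked G (W ∪ p '' Set.Iic r) {p 0, p 1} {p (r - 1), p r}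
  essential : ∀ w ∈ W, ¬ Linked G ((W ∪ p '' Set.Iic r) \ {w}) {p 0, p 1} {p (r - 1), p r}

theorem PathState.mem {G : SimpleGraph V} {p : ℕ → V} {r : ℕ} {W : Set V}
    (_ : PathState G p r W) {i : ℕ} (hi : i ≤ r) : p i ∈ W ∪ p '' Set.Iic r :=
  Or.inr ⟨i, hi, rfl⟩

/-- A partition of rank at most one of the rest acquires rank at most two when `z` joins either
side. -/
theorem tightAt_of_not_linked [Finite V] {G : SimpleGraph V} {U A B : Set V} {z : V}
    (hz : z ∈ U) (hzB : z ∉ B) (h : ¬ Linked G (U \ {z}) A B) : TightAt G U A B z := by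
  simp only [Linked, not_forall, not_not] at h
  obtain ⟨X, Y, hA, hB, hP, hr⟩ := h
  have hn := hP.notMem
  have e1 : U \ X = insert z Y := (hP.insert_right hz).diff_eq
  have e2 : U \ insert z X = Y := (hP.insert_left hz).diff_eq
  refine ⟨X, hn.1, ⟨hA, fun x hx => ((hP.insert_left hz).mem_iff x).2 (Or.inl (Or.inr hx)),
    fun x hx hx' => hP.disj x hx' (hB hx), ?_⟩, ⟨fun x hx => Or.inr (hA hx),
    fun x hx => ((hP.insert_left hz).mem_iff x).2 (Or.inl hx), ?_, ?_⟩⟩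
  · rw [e1]
    have := rk_insert_right_le (adjF_comm G) X Y z
    omega
  · rintro x hx (rfl | hx')
    · exact hzB hx
    · exact hP.disj x hx' (hB hx)
  · rw [e2]
    have := rk_insert_left_le (adjF G) X Y z
    omega

/-- Contraction can destroy linkedness only at a vertex that is tight. The vertices of `W` stay
essential, since their low-rank partitions survive local complementation and restriction. -/
theorem PathState.contract [Finite V] {G : SimpleGraph V} {p : ℕ → V} {r i : ℕ} {W : Set V}
    (h : PathState G p (r + 1) W) (hi : 2 ≤ i) (hir : i + 2 ≤ r + 1)
    (ht : ¬ TightAt G (W ∪ p '' Set.Iic (r + 1)) {p 0, p 1} {p r, p (r + 1)} (p i)) :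
    PathState (localComplement G (p i)) (skip i p) r W := by
  have hU : W ∪ skip i p '' Set.Iic r = (W ∪ p '' Set.Iic (r + 1)) \ {p i} := by
    ext x
    simp only [Set.mem_union, Set.mem_image, Set.mem_Iic, Set.mem_sdiff, Set.mem_singleton_iff]
    constructor
    · rintro (hx | ⟨j, hj, rfl⟩)
      · exact ⟨Or.inl hx, fun e => h.notMem i (by omega) (e ▸ hx)⟩
      · refine ⟨Or.inr ⟨_, ?_, rfl⟩, (h.path.ne_iff ?_ (by omega)).2 ?_⟩ <;> split_ifs <;> omega
    · rintro ⟨hx | ⟨j, hj, rfl⟩, hne⟩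
      · exact Or.inl hx
      · right
        have hji : j ≠ i := fun e => hne (by rw [e])
        refine ⟨if j < i then j else j - 1, by split_ifs <;> omega, ?_⟩
        unfold skip
        congr 1
        split_ifs <;> omega
  have h0 : skip i p 0 = p 0 := by
    unfold skip; congr 1; split_ifs <;> omega
  have h1 : skip i p 1 = p 1 := by
    unfold skip; congr 1; split_ifs <;> omega
  have h2 : skip i p (r - 1) = p r := by
    unfold skip; congr 1; split_ifs <;> omega
  have h3 : skip i p r = p (r + 1) := by
    unfold skip; congr 1; split_ifs <;> omega
  have hiU : p i ∈ W ∪ p '' Set.Iic (r + 1) := h.mem (by omega)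
  have hlink := h.linked
  have hess := h.essential
  simp only [Nat.add_sub_cancel] at hlink hess
  have hB : p i ∉ ({p r, p (r + 1)} : Set V) := by
    have e1 := (h.path.ne_iff (i := i) (j := r) (by omega) (by omega)).2 (by omega)
    have e2 := (h.path.ne_iff (i := i) (j := r + 1) (by omega) (by omega)).2 (by omega)
    simp [e1, e2]
  refine ⟨h.path.contract (by omega) (by omega), by omega, ?_, ?_, ?_⟩
  · intro j hj
    exact h.notMem _ (by split_ifs <;> omega)
  · rw [hU, h0, h1, h2, h3]
    have := linked_delete_or_contract hlink hiU
    -- A failure makes `p i` tight in the locally complemented graph. The partitions involved cover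
    -- all of `U`, which contains `p i`, so their cut-ranks are the same in `G`.
    by_contra hc
    have hc' := tightAt_of_not_linked hiU hB hc
    refine ht ?_
    obtain ⟨X, hX, t1, t2⟩ := hc'
    refine ⟨X, hX, ⟨t1.left, t1.sub, t1.right, ?_⟩, ⟨t2.left, t2.sub, t2.right, ?_⟩⟩
    · have hP := Part.diff t1.sub
      rw [← rk_localComplement G hP.disjoint ((hP.mem_iff _).1 hiU)]
      exact t1.le
    · have hP := Part.diff t2.sub
      rw [← rk_localComplement G hP.disjoint ((hP.mem_iff _).1 hiU)]
      exact t2.le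
  · intro w hw
    rw [hU, h0, h1, h2, h3]
    have hwi : p i ≠ w := fun e => h.notMem i (by omega) (e ▸ hw)
    have := hess w hw
    simp only [Linked, not_forall, not_not] at this ⊢
    obtain ⟨X, Y, hX, hY, hP, hr⟩ := this
    refine ⟨X \ {p i}, Y \ {p i}, ?_, ?_, ⟨fun x hx hy => hP.disj x hx.1 hy.1, fun x => ?_⟩, ?_⟩
    · intro x hx
      refine ⟨hX hx, ?_⟩
      rcases hx with rfl | rfl
      · exact (h.path.ne_iff (by omega) (by omega)).2 (by omega)
      · exact (h.path.ne_iff (by omega) (by omega)).2 (by omega)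
    · exact fun x hx => ⟨hY hx, fun e => hB (e ▸ hx)⟩
    · have := hP.mem_iff x
      simp only [Set.mem_sdiff] at this ⊢
      tauto
    · refine (rk_mono _ Set.sdiff_subset Set.sdiff_subset).trans ?_
      rwa [rk_localComplement G hP.disjoint ((hP.mem_iff _).1 ⟨hiU, hwi⟩)]

theorem PathState.exists_all_tight [Finite V] {W : Set V} (r : ℕ) : ∀ {G : SimpleGraph V}
    {p : ℕ → V}, PathState G p r W → ∃ (G' : SimpleGraph V) (p' : ℕ → V) (r' : ℕ),
      LocallyEquivalent G G' ∧ PathState G' p' r' W ∧ ∀ i, 2 ≤ i → i + 2 ≤ r' →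
        TightAt G' (W ∪ p' '' Set.Iic r') {p' 0, p' 1} {p' (r' - 1), p' r'} (p' i) := by
  induction r with
  | zero => intro G p h; have := h.three_le; omega
  | succ r ih =>
    intro G p h
    by_cases hall : ∀ i, 2 ≤ i → i + 2 ≤ r + 1 →
        TightAt G (W ∪ p '' Set.Iic (r + 1)) {p 0, p 1} {p r, p (r + 1)} (p i)
    · exact ⟨G, p, r + 1, LocallyEquivalent.refl G, h, hall⟩
    push Not at hall
    obtain ⟨i, hi, hir, ht⟩ := hall
    obtain ⟨G', p', r', hG, h', ht'⟩ := ih (h.contract hi hir ht)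
    exact ⟨G', p', r', (LocallyEquivalent.localComplement G (p i)).trans hG, h', ht'⟩

theorem rk_pair_le [Finite V] (M : V → V → ZMod 2) (a b : V) (C : Set V) : rk M {a, b} C ≤ 2 := by
  have h1 := rk_insert_left_le M {b} C a
  have h2 := rk_insert_left_le M ∅ C b
  have h3 : rk M ∅ C ≤ 0 := rk_le_of_factor (fun _ _ => 0) (fun _ _ => 0) (by simp)
  rw [show (insert b ∅ : Set V) = {b} by simp] at h2
  omega

/-- The first edge of the path together with the first vertex `z` of the order will be one end of
the chain. The pair `{p 0, p 1}` and the whole triple have large rank by hypothesis. For the pairs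
with `z`, either `z` is on the path and its successor exhibits a nonsingular minor, or `z` comes
from `W`, in which case `p 0` has no neighbour outside the triple. -/
theorem robust_head [Finite V] {G : SimpleGraph V} {p : ℕ → V} {r : ℕ} {U : Set V} {z : V}
    (hp : IsPath G p r) (hr : 3 ≤ r) (hpU : ∀ i ≤ r, p i ∈ U) (hzU : z ∈ U)
    (hA : ¬ rk (adjF G) {p 0, p 1} (U \ {p 0, p 1}) ≤ 1)
    (hzA : ¬ rk (adjF G) (insert z {p 0, p 1}) (U \ insert z {p 0, p 1}) ≤ 1)
    (hz : (∃ j, 2 ≤ j ∧ j + 1 ≤ r ∧ z = p j) ∨ (z ≠ p 0 ∧ z ≠ p 1 ∧ z ≠ p 2 ∧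
      rk (adjF G) {p 0, p 1} (U \ insert z {p 0, p 1}) ≤ 1)) :
    Robust G U (insert z {p 0, p 1}) := by
  intro S hS hS2 hrk
  have a01 : adjF G (p 0) (p 1) = 1 := adjF_eq_one.2 ((hp.2 0 (by omega) 1 (by omega)).2 (by omega))
  have hne01 := (hp.ne_iff (i := 0) (j := 1) (by omega) (by omega)).2 (by omega)
  have hz01 : z ≠ p 0 ∧ z ≠ p 1 := by
    rcases hz with ⟨j, h1, h2, rfl⟩ | h
    · exact ⟨(hp.ne_iff (by omega) (by omega)).2 (by omega),
        (hp.ne_iff (by omega) (by omega)).2 (by omega)⟩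
    · exact ⟨h.1, h.2.1⟩
  obtain ⟨s, hs, t, ht, hst⟩ := hS2
  by_cases h0 : p 0 ∈ S
  · by_cases h1 : p 1 ∈ S
    · by_cases hzS : z ∈ S
      · have : S = insert z {p 0, p 1} := subset_antisymm hS (by
          rintro x (rfl | rfl | rfl) <;> assumption)
        exact hzA (this ▸ hrk)
      · have : S = {p 0, p 1} := subset_antisymm (fun x hx => (hS hx).resolve_left
          fun e => hzS (e ▸ hx)) (by rintro x (rfl | rfl) <;> assumption)
        exact hA (this ▸ hrk)
    · have hzS : z ∈ S := by
        rcases hS hs with rfl | rfl | rfl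
        · exact hs
        · rcases hS ht with rfl | rfl | rfl
          · exact ht
          · exact absurd rfl hst
          · exact absurd ht h1
        · exact absurd hs h1
      rcases hz with ⟨j, hj2, hjr, rfl⟩ | ⟨-, -, hz2, hzr⟩
      · have hj1 : p (j + 1) ∈ U \ S := ⟨hpU _ hjr, fun hm => by
          rcases hS hm with e | e | e
          · exact absurd (hp.1 _ (by omega) _ (by omega) e) (by omega)
          · exact absurd (hp.1 _ (by omega) _ (by omega) e) (by omega)
          · exact absurd (hp.1 _ (by omega) _ (by omega) e) (by omega)⟩
        have hm := minor_eq_of_rk_le_one hrk h0 hzS ⟨hpU 1 (by omega), h1⟩ hj1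
        rw [a01, adjF_eq_one.2 ((hp.2 j (by omega) (j + 1) (by omega)).2 (by omega)),
          adjF_eq_zero.2 (mt (hp.2 0 (by omega) (j + 1) (by omega)).1 (by omega))] at hm
        simp at hm
      · have hp2 : p 2 ∈ U \ insert z {p 0, p 1} := ⟨hpU 2 (by omega), fun hm => by
          rcases hm with e | e | e
          · exact hz2 e.symm
          · exact absurd (hp.1 _ (by omega) _ (by omega) e) (by omega)
          · exact absurd (hp.1 _ (by omega) _ (by omega) e) (by omega)⟩
        -- The rows of `p 0` and `p 1` have rank at most one here, and the column of `p 2` is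
        -- nonzero only in the row of `p 1`.
        have hzero : ∀ y ∈ U \ insert z {p 0, p 1}, adjF G (p 0) y = 0 := by
          intro y hy
          have hm := minor_eq_of_rk_le_one hzr (x := p 0) (x' := p 1) (by simp) (by simp) hy hp2
          rw [adjF_eq_one.2 ((hp.2 1 (by omega) 2 (by omega)).2 (by omega)),
            adjF_eq_zero.2 (mt (hp.2 0 (by omega) 2 (by omega)).1 (by omega))] at hm
          simpa using hm
        have hex : ∃ y ∈ U \ insert z {p 0, p 1}, adjF G z y ≠ 0 := by
          by_contra! hc
          classical
          refine hzA (rk_le_one_iff.2 ⟨fun x => if x = p 1 then 1 else 0, adjF G (p 1), ?_⟩)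
          rintro x (rfl | rfl | rfl) y hy
          · simp [hz01.2, hc y hy]
          · simp [hne01, hzero y hy]
          · simp
        obtain ⟨y, hy, hzy⟩ := hex
        have hyS : y ∈ U \ S := ⟨hy.1, fun hm => hy.2 (hS hm)⟩
        have hm := minor_eq_of_rk_le_one hrk h0 hzS ⟨hpU 1 (by omega), h1⟩ hyS
        rw [a01, hzero y hy, zero_mul, one_mul] at hm
        exact hzy hm
  · have hzS : z ∈ S := by
      rcases hS hs with rfl | rfl | rfl
      · exact hs
      · exact absurd hs h0
      · rcases hS ht with rfl | rfl | rfl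
        · exact ht
        · exact absurd ht h0
        · exact absurd rfl hst
    have h1 : p 1 ∈ S := by
      rcases hS hs with rfl | rfl | rfl
      · rcases hS ht with rfl | rfl | rfl
        · exact absurd rfl hst
        · exact absurd ht h0
        · exact ht
      · exact absurd hs h0
      · exact hs
    rcases hz with ⟨j, hj2, hjr, rfl⟩ | ⟨-, -, hz2, hzr⟩
    · have hj1 : p (j + 1) ∈ U \ S := ⟨hpU _ hjr, fun hm => by
        rcases hS hm with e | e | e
        · exact absurd (hp.1 _ (by omega) _ (by omega) e) (by omega)
        · exact absurd (hp.1 _ (by omega) _ (by omega) e) (by omega)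
        · exact absurd (hp.1 _ (by omega) _ (by omega) e) (by omega)⟩
      have hm := minor_eq_of_rk_le_one hrk h1 hzS ⟨hpU 0 (by omega), h0⟩ hj1
      rw [adjF_comm, a01, adjF_eq_one.2 ((hp.2 j (by omega) (j + 1) (by omega)).2 (by omega)),
        adjF_eq_zero.2 (mt (hp.2 1 (by omega) (j + 1) (by omega)).1 (by omega))] at hm
      simp at hm
    · have hp2 : p 2 ∈ U \ insert z {p 0, p 1} := ⟨hpU 2 (by omega), fun hm => by
        rcases hm with e | e | e
        · exact hz2 e.symm
        · exact absurd (hp.1 _ (by omega) _ (by omega) e) (by omega)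
        · exact absurd (hp.1 _ (by omega) _ (by omega) e) (by omega)⟩
      have hzero : ∀ y ∈ U \ insert z {p 0, p 1}, adjF G (p 0) y = 0 := by
        intro y hy
        have hm := minor_eq_of_rk_le_one hzr (x := p 0) (x' := p 1) (by simp) (by simp) hy hp2
        rw [adjF_eq_one.2 ((hp.2 1 (by omega) 2 (by omega)).2 (by omega)),
          adjF_eq_zero.2 (mt (hp.2 0 (by omega) 2 (by omega)).1 (by omega))] at hm
        simpa using hm
      obtain ⟨f, g, hfg⟩ := rk_le_one_iff.1 hrk
      classical
      refine hzA (rk_le_one_iff.2 ⟨fun x => if x = p 0 then 0 else f x, g, ?_⟩)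
      have hsub : ∀ y ∈ U \ insert z {p 0, p 1}, y ∈ U \ S :=
        fun y hy => ⟨hy.1, fun hm => hy.2 (hS hm)⟩
      rintro x (rfl | rfl | rfl) y hy
      · simp [hz01.1, hfg _ hzS y (hsub y hy)]
      · simp [hzero y hy]
      · simp [hne01.symm, hfg _ h1 y (hsub y hy)]

end

/-! ### Thirty consecutive vertices contain three with independent rows -/

section

variable {V : Type*}

/-- The columns of `p (a - 1)` and `p (c + 1)` isolate the outer two rows; then the column of `p (b
+ 1)` isolates the middle one. -/
theorem not_rk_path_triple [Finite V] {G : SimpleGraph V} {p : ℕ → V} {r a b c : ℕ} {U : Set V}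
    (hp : IsPath G p r) (hpU : ∀ i ≤ r, p i ∈ U) (ha : 1 ≤ a) (hab : a + 2 ≤ b) (hbc : b + 2 ≤ c)
    (hc : c + 1 ≤ r) : ¬ rk (adjF G) {p a, p b, p c} (U \ {p a, p b, p c}) ≤ 2 := by
  have hmem : ∀ i ≤ r, i ≠ a → i ≠ b → i ≠ c → p i ∈ U \ {p a, p b, p c} := by
    intro i hi h1 h2 h3
    refine ⟨hpU i hi, ?_⟩
    have e1 := (hp.ne_iff hi (j := a) (by omega)).2 h1
    have e2 := (hp.ne_iff hi (j := b) (by omega)).2 h2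
    have e3 := (hp.ne_iff hi (j := c) (by omega)).2 h3
    simp [e1, e2, e3]
  have one : ∀ i j, i ≤ r → j ≤ r → (j = i + 1 ∨ i = j + 1) → adjF G (p i) (p j) = 1 :=
    fun i j hi hj h => adjF_eq_one.2 ((hp.2 i hi j hj).2 h)
  have zero : ∀ i j, i ≤ r → j ≤ r → ¬ (j = i + 1 ∨ i = j + 1) → adjF G (p i) (p j) = 0 :=
    fun i j hi hj h => adjF_eq_zero.2 (mt (hp.2 i hi j hj).1 h)
  apply not_rk_le_two
  intro x y z h
  have h1 := h _ (hmem (a - 1) (by omega) (by omega) (by omega) (by omega))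
  rw [one a (a - 1) (by omega) (by omega) (by omega), zero b (a - 1) (by omega) (by omega)
    (by omega), zero c (a - 1) (by omega) (by omega) (by omega)] at h1
  have h2 := h _ (hmem (c + 1) (by omega) (by omega) (by omega) (by omega))
  rw [one c (c + 1) (by omega) (by omega) (by omega), zero b (c + 1) (by omega) (by omega)
    (by omega), zero a (c + 1) (by omega) (by omega) (by omega)] at h2
  have h3 := h _ (hmem (b + 1) (by omega) (by omega) (by omega) (by omega))
  rw [one b (b + 1) (by omega) (by omega) (by omega), zero a (b + 1) (by omega) (by omega)
    (by omega)] at h3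
  simp at h1 h2
  subst h1 h2
  simp at h3
  exact ⟨rfl, h3, rfl⟩

theorem exists_spread_of_card {s : Finset ℕ} (h : s.card = 5) :
    ∃ a ∈ s, ∃ b ∈ s, ∃ c ∈ s, a + 2 ≤ b ∧ b + 2 ≤ c := by
  let f := s.orderEmbOfFin h
  have hs : ∀ i j : Fin 5, i < j → f i < f j := fun i j hij => f.strictMono hij
  have h1 := hs 0 1 (by decide)
  have h2 := hs 1 2 (by decide)
  have h3 := hs 2 3 (by decide)
  have h4 := hs 3 4 (by decide)
  exact ⟨f 0, s.orderEmbOfFin_mem h 0, f 2, s.orderEmbOfFin_mem h 2, f 4,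
    s.orderEmbOfFin_mem h 4, by omega, by omega⟩

/-- Six consecutive deletion-essential vertices carry three vertices with independent rows. -/
theorem not_rk_run_triple [Finite V] {G : SimpleGraph V} {U A B : Set V} {u v : V} {w : ℕ → V}
    {X Y : ℕ → Set V} (hL : Linked G U A B) (huv : G.Adj u v)
    (hX : ∀ s ≤ 5, X (s + 1) = insert (w s) (X s))
    (hY : ∀ s ≤ 5, Y s = insert (w s) (Y (s + 1)))
    (hP : ∀ s ≤ 6, Part U (X s) (Y s)) (hA : A ⊆ X 0) (hB : B ⊆ Y 6) (hu : u ∈ X 0)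
    (hv : v ∈ Y 6) (hr : ∀ s ≤ 5, rk (adjF G) (X s) (Y (s + 1)) ≤ 1) :
    ¬ rk (adjF G) {w 0, w 2, w 4} (U \ {w 0, w 2, w 4}) ≤ 2 := by
  have huv1 : adjF G u v = 1 := adjF_eq_one.2 huv
  have hXm : ∀ t ≤ 6, ∀ s ≤ t, X s ⊆ X t := by
    intro t ht s hst
    induction t, hst using Nat.le_induction with
    | base => exact subset_rfl
    | succ t hst ih =>
      rw [hX t (by omega)]
      exact (ih (by omega)).trans (Set.subset_insert _ _)
  have hYm : ∀ t ≤ 6, ∀ s ≤ t, Y t ⊆ Y s := by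
    intro t ht s hst
    induction t, hst using Nat.le_induction with
    | base => exact subset_rfl
    | succ t hst ih =>
      have := ih (by omega)
      rw [hY t (by omega)] at this
      exact (Set.subset_insert _ _).trans this
  have hwX : ∀ s t, s < t → t ≤ 6 → w s ∈ X t := fun s t hst ht =>
    hXm t ht (s + 1) hst (by rw [hX s (by omega)]; exact Set.mem_insert _ _)
  have hwY : ∀ s t, t ≤ s → s ≤ 5 → w s ∈ Y t := fun s t hst hs =>
    hYm s (by omega) t hst (by rw [hY s hs]; exact Set.mem_insert _ _)
  have hu' : ∀ s ≤ 6, u ∈ X s := fun s hs => hXm s hs 0 (by omega) hu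
  have hv' : ∀ s ≤ 6, v ∈ Y s := fun s hs => hYm 6 le_rfl s hs hv
  -- Across rank-one blocks the edge `u v` normalises the factorisation: the entry of `x, y` is the
  -- product of the entries of `x, v` and `u, y`.
  have far : ∀ s t, s + 2 ≤ t → t ≤ 5 →
      adjF G (w s) (w t) = adjF G (w s) v * adjF G u (w t) := by
    intro s t hst ht
    have := minor_eq_of_rk_le_one (hr (s + 1) (by omega)) (hwX s (s + 1) (by omega) (by omega))
      (hu' (s + 1) (by omega)) (hwY t (s + 1 + 1) (by omega) ht) (hv' (s + 1 + 1) (by omega))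
    rwa [huv1, mul_one] at this
  -- Equality here would extend the factorisation to the whole partition `(X (s + 1), Y (s + 1))`,
  -- which has rank at least two.
  have near : ∀ s, s ≤ 4 →
      adjF G (w s) (w (s + 1)) ≠ adjF G (w s) v * adjF G u (w (s + 1)) := by
    intro s hs he
    refine hL (X (s + 1)) (Y (s + 1)) (hA.trans (hXm _ (by omega) 0 (by omega)))
      (hB.trans (hYm 6 le_rfl _ (by omega))) (hP _ (by omega)) ?_
    refine rk_le_one_iff.2 ⟨fun x => adjF G x v, fun y => adjF G u y, ?_⟩
    intro x hx y hy
    rw [hX s (by omega)] at hx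
    rcases hx with rfl | hx
    · rw [hY (s + 1) (by omega)] at hy
      rcases hy with rfl | hy
      · exact he
      · have := minor_eq_of_rk_le_one (hr (s + 1) (by omega))
          (hwX s (s + 1) (by omega) (by omega)) (hu' (s + 1) (by omega)) hy
          (hv' (s + 1 + 1) (by omega))
        rwa [huv1, mul_one] at this
    · have := minor_eq_of_rk_le_one (hr s (by omega)) hx (hu' s (by omega)) hy
        (hv' (s + 1) (by omega))
      rwa [huv1, mul_one] at this
  have near' : ∀ s, s ≤ 4 →
      adjF G (w s) (w (s + 1)) = adjF G (w s) v * adjF G u (w (s + 1)) + 1 := by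
    intro s hs
    have key : ∀ a b : ZMod 2, a ≠ b → a = b + 1 := by decide
    exact key _ _ (near s hs)
  have hne : ∀ s t, s < t → t ≤ 5 → w s ≠ w t := fun s t hst ht e =>
    (hP t (by omega)).disj _ (hwX s t hst (by omega)) (e ▸ hwY t t le_rfl ht)
  have hvw : ∀ s ≤ 5, w s ≠ v := fun s hs e =>
    (hP 6 le_rfl).disj _ (hwX s 6 (by omega) le_rfl) (e ▸ hv)
  have hwU : ∀ s ≤ 5, w s ∈ U := fun s hs =>
    ((hP s (by omega)).mem_iff _).2 (Or.inr (hwY s s le_rfl hs))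
  have hmem : ∀ s ≤ 5, s ≠ 0 → s ≠ 2 → s ≠ 4 → w s ∈ U \ {w 0, w 2, w 4} := by
    intro s hs h0 h2 h4
    have n : ∀ t ≤ 5, s ≠ t → w s ≠ w t := fun t ht hst =>
      (Nat.lt_or_gt_of_ne hst).elim (fun h => hne s t h ht) fun h => (hne t s h hs).symm
    refine ⟨hwU s hs, ?_⟩
    simp [n 0 (by omega) h0, n 2 (by omega) h2, n 4 (by omega) h4]
  have hvmem : v ∈ U \ {w 0, w 2, w 4} := by
    refine ⟨((hP 6 le_rfl).mem_iff _).2 (Or.inr hv), ?_⟩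
    simp [(hvw 0 (by omega)).symm, (hvw 2 (by omega)).symm, (hvw 4 (by omega)).symm]
  apply not_rk_le_two
  intro x y z h
  -- Subtracting multiples of the column of `v` cancels all product terms; the columns of `w 5`, `w
  -- 3`, `w 1` then leave one coefficient at a time.
  have hv0 := h v hvmem
  have h5 := h _ (hmem 5 le_rfl (by omega) (by omega) (by omega))
  rw [far 0 5 (by omega) le_rfl, far 2 5 (by omega) le_rfl, near' 4 le_rfl] at h5
  have hz : z = 0 := by linear_combination h5 - adjF G u (w 5) * hv0
  subst hz
  have h3 := h _ (hmem 3 (by omega) (by omega) (by omega) (by omega))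
  rw [far 0 3 (by omega) (by omega), near' 2 (by omega)] at h3
  have hy : y = 0 := by linear_combination h3 - adjF G u (w 3) * hv0
  subst hy
  have h1 := h _ (hmem 1 (by omega) (by omega) (by omega) (by omega))
  rw [near' 0 (by omega)] at h1
  have hx : x = 0 := by linear_combination h1 - adjF G u (w 1) * hv0
  exact ⟨hx, rfl, rfl⟩

theorem PathState.window [Finite V] {G : SimpleGraph V} {p : ℕ → V} {r : ℕ} {W : Set V}
    (h : PathState G p r W) {z : ℕ → V} {N j : ℕ}
    (hinj : ∀ i < N, ∀ k < N, z i = z k → i = k)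
    (hmem : ∀ i < N, z i ∈ W ∪ p '' Set.Iic r ∧ z i ∉ ({p 0, p 1} : Set V) ∧
      z i ∉ ({p (r - 1), p r} : Set V))
    (htight : ∀ i ≤ N, TightSet G (W ∪ p '' Set.Iic r) {p 0, p 1} {p (r - 1), p r}
      ({p 0, p 1} ∪ z '' Set.Iio i)) (hj : j + 30 ≤ N) :
    ∃ a b c, j ≤ a ∧ a < j + 30 ∧ j ≤ b ∧ b < j + 30 ∧ j ≤ c ∧ c < j + 30 ∧ a ≠ b ∧ a ≠ c ∧
      b ≠ c ∧ ¬ rk (adjF G) {z a, z b, z c} ((W ∪ p '' Set.Iic r) \ {z a, z b, z c}) ≤ 2 := by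
  classical
  set U := W ∪ p '' Set.Iic r with hU
  set A : Set V := {p 0, p 1} with hA
  set B : Set V := {p (r - 1), p r} with hB
  have h3 := h.three_le
  have hpU : ∀ i ≤ r, p i ∈ U := fun i hi => Or.inr ⟨i, hi, rfl⟩
  -- Thirty is five blocks of six. Either some block lies in `W` and the run argument applies, or
  -- each block contributes a path vertex, and of five path vertices the first, third and fifth
  -- along the path are pairwise non-consecutive.
  by_cases hrun : ∃ b < 5, ∀ t < 6, z (j + 6 * b + t) ∈ W
  · obtain ⟨b, hb, hw⟩ := hrun
    set q := j + 6 * b with hq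
    have hPX : ∀ s ≤ 6, Part U (A ∪ z '' Set.Iio (q + s)) (U \ (A ∪ z '' Set.Iio (q + s))) :=
      fun s hs => Part.diff (htight (q + s) (by omega)).sub
    have hXs : ∀ s ≤ 5, A ∪ z '' Set.Iio (q + (s + 1)) =
        insert (z (q + s)) (A ∪ z '' Set.Iio (q + s)) := by
      intro s hs
      have e : (Set.Iio (q + (s + 1)) : Set ℕ) = insert (q + s) (Set.Iio (q + s)) := by
        ext; simp only [Set.mem_Iio, Set.mem_insert_iff]; omega
      rw [e, Set.image_insert_eq, Set.union_insert]
    have hzX : ∀ s t, t ≤ s → s ≤ 5 → z (q + s) ∉ A ∪ z '' Set.Iio (q + t) := by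
      rintro s t hts hs (hm | ⟨i, hi, he⟩)
      · exact (hmem (q + s) (by omega)).2.1 hm
      · simp only [Set.mem_Iio] at hi
        have := hinj i (by omega) (q + s) (by omega) he
        omega
    have hYs : ∀ s ≤ 5, U \ (A ∪ z '' Set.Iio (q + s)) =
        insert (z (q + s)) (U \ (A ∪ z '' Set.Iio (q + (s + 1)))) := by
      intro s hs
      rw [hXs s hs]
      ext x
      by_cases hx : x = z (q + s)
      · subst hx
        have h1 := hzX s s le_rfl hs
        have h2 := (hmem (q + s) (by omega)).1
        exact ⟨fun _ => Or.inl rfl, fun _ => ⟨h2, h1⟩⟩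
      · simp [hx]
    have hr : ∀ s ≤ 5, rk (adjF G) (A ∪ z '' Set.Iio (q + s))
        (U \ (A ∪ z '' Set.Iio (q + (s + 1)))) ≤ 1 := by
      intro s hs
      have hzs := hmem (q + s) (by omega)
      refine rk_le_one_of_not_linked h.linked hzs.1 (h.essential _ (hw s (by omega)))
        (htight (q + s) (by omega)).left ?_ ?_ ?_ ?_
      · intro x hx
        refine ⟨?_, (htight (q + (s + 1)) (by omega)).right x hx⟩
        rcases hx with rfl | rfl
        · exact hpU _ (by omega)
        · exact hpU _ (by omega)
      · have hP := hPX s (by omega)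
        rw [hYs s hs] at hP
        have hn := hzX s s le_rfl hs
        have hn2 : z (q + s) ∉ U \ (A ∪ z '' Set.Iio (q + (s + 1))) := by
          rw [hXs s hs]; simp
        refine ⟨fun x hx hx' => hP.disj x hx (Or.inr hx'), fun x => ?_⟩
        have := hP.mem_iff x
        by_cases hx : x = z (q + s)
        · subst hx; simp only [Set.mem_sdiff, Set.mem_singleton_iff, not_true_eq_false, and_false,
            false_iff]
          exact fun h => h.elim hn hn2
        · rw [Set.mem_insert_iff, or_iff_right hx] at this
          rw [← this]
          exact ⟨fun h => h.1, fun h => ⟨h, hx⟩⟩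
      · rw [← hYs s hs]
        exact (htight (q + s) (by omega)).le
      · rw [← hXs s hs]
        exact (htight (q + (s + 1)) (by omega)).le
    have hend : p r ∉ A ∪ z '' Set.Iio (q + 0) :=
      (htight (q + 0) (by omega)).right _ (by simp [hB])
    have hex : ∃ i, p i ∉ A ∪ z '' Set.Iio (q + 0) := ⟨r, hend⟩
    -- The edge `u v` is where the path first leaves the initial segment. Its far end is a path
    -- vertex, hence is not one of the six vertices of the run.
    set i := Nat.find hex with hi
    have hi1 : p i ∉ A ∪ z '' Set.Iio (q + 0) := Nat.find_spec hex
    have hir : i ≤ r := Nat.find_min' hex hend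
    have hi0 : 0 < i := by
      rcases Nat.eq_zero_or_pos i with e | e
      · rw [e] at hi1
        exact absurd (Or.inl (by simp [hA])) hi1
      · exact e
    have hi2 : p (i - 1) ∈ A ∪ z '' Set.Iio (q + 0) := by
      have := Nat.find_min hex (m := i - 1) (by omega)
      exact not_not.1 this
    have hadj : G.Adj (p (i - 1)) (p i) := (h.path.2 _ (by omega) _ hir).2 (by omega)
    have hpi6 : p i ∈ U \ (A ∪ z '' Set.Iio (q + 6)) := by
      refine ⟨hpU i hir, ?_⟩
      rintro (hm | ⟨k, hk, he⟩)
      · exact hi1 (Or.inl hm)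
      · simp only [Set.mem_Iio] at hk
        rcases Nat.lt_or_ge k q with hkq | hkq
        · exact hi1 (Or.inr ⟨k, by simpa using hkq, he⟩)
        · have := hw (k - q) (by omega)
          rw [show q + (k - q) = k by omega, he] at this
          exact h.notMem i hir this
    have := not_rk_run_triple (w := fun s => z (q + s))
      (X := fun s => A ∪ z '' Set.Iio (q + s)) (Y := fun s => U \ (A ∪ z '' Set.Iio (q + s)))
      h.linked hadj hXs hYs hPX (htight (q + 0) (by omega)).left
      (fun x hx => ⟨by
        rcases hx with rfl | rfl
        · exact hpU _ (by omega)
        · exact hpU _ (by omega), (htight (q + 6) (by omega)).right x hx⟩) hi2 hpi6 hr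
    exact ⟨q + 0, q + 2, q + 4, by omega, by omega, by omega, by omega, by omega, by omega,
      by omega, by omega, by omega, this⟩
  · push Not at hrun
    have hsel : ∀ b : Fin 5, ∃ t, j + 6 * b ≤ t ∧ t < j + 6 * b + 6 ∧
        ∃ i, 2 ≤ i ∧ i + 2 ≤ r ∧ p i = z t := by
      intro b
      obtain ⟨t, ht, hn⟩ := hrun b b.2
      have hb := b.2
      refine ⟨j + 6 * b + t, by omega, by omega, ?_⟩
      obtain ⟨hm, hnA, hnB⟩ := hmem (j + 6 * b + t) (by omega)
      rcases hm with hm | ⟨i, hi, he⟩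
      · exact absurd hm hn
      · rw [← he] at hnA hnB
        simp only [Set.mem_Iic] at hi
        have c0 : i ≠ 0 := by rintro rfl; exact hnA (by simp [hA])
        have c1 : i ≠ 1 := by rintro rfl; exact hnA (by simp [hA])
        have c2 : i ≠ r - 1 := by rintro rfl; exact hnB (by simp [hB])
        have c3 : i ≠ r := by rintro rfl; exact hnB (by simp [hB])
        exact ⟨i, by omega, by omega, he⟩
    choose t ht1 ht2 i hi1 hi2 hi3 using hsel
    have hiinj : Function.Injective i := by
      intro b b' e
      have hb := b.2
      have hb' := b'.2
      have := hinj (t b) (by have := ht2 b; omega) (t b') (by have := ht2 b'; omega)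
        (by rw [← hi3, ← hi3, e])
      have h1 := ht1 b
      have h2 := ht2 b
      have h1' := ht1 b'
      have h2' := ht2 b'
      ext
      omega
    have hcard : (Finset.univ.image i).card = 5 := by
      rw [Finset.card_image_of_injective _ hiinj]; simp
    obtain ⟨a, ha, b, hb, c, hc, hab, hbc⟩ := exists_spread_of_card hcard
    simp only [Finset.mem_image, Finset.mem_univ, true_and] at ha hb hc
    obtain ⟨a, rfl⟩ := ha
    obtain ⟨b, rfl⟩ := hb
    obtain ⟨c, rfl⟩ := hc
    have hne : ∀ x y : Fin 5, i x + 2 ≤ i y → t x ≠ t y := by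
      intro x y hxy e
      have h1 : p (i x) = p (i y) := by rw [hi3, hi3, e]
      have := h.path.1 _ (by have := hi2 x; omega) _ (by have := hi2 y; omega) h1
      omega
    have := not_rk_path_triple h.path hpU (by have := hi1 a; omega) hab hbc
      (by have := hi2 c; omega)
    rw [hi3, hi3, hi3] at this
    have ha := a.2
    have hb := b.2
    have hc := c.2
    have := ht1 a
    have := ht2 a
    have := ht1 b
    have := ht2 b
    have := ht1 c
    have := ht2 c
    exact ⟨t a, t b, t c, by omega, by omega, by omega, by omega, by omega, by omega,
      hne a b hab, hne a c (by omega), hne b c hbc, by assumption⟩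

end

/-! ### Chains: linear orders of cut-rank two -/

section

variable {V : Type*}

/-- A linear order `z 0, …, z (N - 1)` of the vertices between `A` and `B` whose initial segments
all have cut-rank two, and in which any thirty consecutive vertices include three with independent
rows. -/
structure Chain (G : SimpleGraph V) (U A B : Set V) (z : ℕ → V) (N : ℕ) : Prop where
  inj : ∀ i < N, ∀ j < N, z i = z j → i = j
  notMem : ∀ i < N, z i ∉ A ∧ z i ∉ B
  disj : ∀ x ∈ A, x ∉ B
  mem_iff : ∀ x, x ∈ U ↔ x ∈ A ∨ (∃ i < N, z i = x) ∨ x ∈ B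
  tight : ∀ j ≤ N, rk (adjF G) (A ∪ z '' Set.Iio j) (U \ (A ∪ z '' Set.Iio j)) ≤ 2
  robust_left : Robust G U A
  robust_right : Robust G U B
  large_left : ∀ S : Set V, (A ∩ S).Nontrivial ∨ (A \ S).Nontrivial
  large_right : ∀ S : Set V, (B ∩ S).Nontrivial ∨ (B \ S).Nontrivial
  linked : ¬ rk (adjF G) A B ≤ 1
  window : ∀ j, j + 30 ≤ N → ∃ a b c, j ≤ a ∧ a < j + 30 ∧ j ≤ b ∧ b < j + 30 ∧ j ≤ c ∧
    c < j + 30 ∧ a ≠ b ∧ a ≠ c ∧ b ≠ c ∧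
    ¬ rk (adjF G) {z a, z b, z c} (U \ {z a, z b, z c}) ≤ 2

theorem rk_foldl_localComplement [Finite V] {U X Y : Set V} (hP : Part U X Y) (l : List V) :
    ∀ G : SimpleGraph V, (∀ v ∈ l, v ∈ U) →
      rk (adjF (l.foldl localComplement G)) X Y = rk (adjF G) X Y := by
  induction l with
  | nil => intro G _; rfl
  | cons v l ih =>
    intro G hl
    rw [List.foldl_cons, ih _ fun w hw => hl w (List.mem_cons_of_mem _ hw),
      rk_localComplement G hP.disjoint ((hP.mem_iff v).1 (hl v List.mem_cons_self))]

theorem Robust.foldl [Finite V] {G : SimpleGraph V} {U A : Set V} (h : Robust G U A) (hA : A ⊆ U)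
    {l : List V} (hl : ∀ v ∈ l, v ∈ U) : Robust (l.foldl VertexMinor.localComplement G) U A := by
  intro S hS hS2
  rw [rk_foldl_localComplement (Part.diff (hS.trans hA)) l G hl]
  exact h S hS hS2

theorem nontrivial_inter_or_sdiff {a b c : V} (hab : a ≠ b) (hac : a ≠ c) (hbc : b ≠ c)
    (S : Set V) : (({a, b, c} : Set V) ∩ S).Nontrivial ∨ (({a, b, c} : Set V) \ S).Nontrivial := by
  by_cases ha : a ∈ S <;> by_cases hb : b ∈ S <;> by_cases hc : c ∈ S
  · exact Or.inl ⟨a, ⟨by simp, ha⟩, b, ⟨by simp, hb⟩, hab⟩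
  · exact Or.inl ⟨a, ⟨by simp, ha⟩, b, ⟨by simp, hb⟩, hab⟩
  · exact Or.inl ⟨a, ⟨by simp, ha⟩, c, ⟨by simp, hc⟩, hac⟩
  · exact Or.inr ⟨b, ⟨by simp, hb⟩, c, ⟨by simp, hc⟩, hbc⟩
  · exact Or.inl ⟨b, ⟨by simp, hb⟩, c, ⟨by simp, hc⟩, hbc⟩
  · exact Or.inr ⟨a, ⟨by simp, ha⟩, c, ⟨by simp, hc⟩, hac⟩
  · exact Or.inr ⟨a, ⟨by simp, ha⟩, b, ⟨by simp, hb⟩, hab⟩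
  · exact Or.inr ⟨a, ⟨by simp, ha⟩, b, ⟨by simp, hb⟩, hab⟩

theorem PathState.reverse [Finite V] {G : SimpleGraph V} {p : ℕ → V} {r : ℕ} {W : Set V}
    (h : PathState G p r W) : PathState G (fun i => p (r - i)) r W := by
  have h3 := h.three_le
  have e : (fun i => p (r - i)) '' Set.Iic r = p '' Set.Iic r := by
    ext x
    simp only [Set.mem_image, Set.mem_Iic]
    constructor
    · rintro ⟨i, hi, rfl⟩; exact ⟨r - i, by omega, rfl⟩
    · rintro ⟨i, hi, rfl⟩; exact ⟨r - i, by omega, by congr 1; omega⟩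
  have e1 : ({p (r - 0), p (r - 1)} : Set V) = {p (r - 1), p r} := by
    rw [Nat.sub_zero, Set.pair_comm]
  have e2 : ({p (r - (r - 1)), p (r - r)} : Set V) = {p 0, p 1} := by
    rw [Nat.sub_self, show r - (r - 1) = 1 by omega, Set.pair_comm]
  refine ⟨h.path.reverse, h3, fun i hi => h.notMem _ (by omega), ?_, ?_⟩
  · rw [e, e1, e2]
    exact h.linked.symm
  · intro w hw
    rw [e, e1, e2]
    exact fun hl => h.essential w hw hl.symm

theorem PathState.robust_insert [Finite V] {G : SimpleGraph V} {p : ℕ → V} {r : ℕ} {W : Set V}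
    (h : PathState G p r W) {z : V} (hz : z ∈ W ∪ p '' Set.Iic r) (hzA : z ∉ ({p 0, p 1} : Set V))
    (hzB : z ∉ ({p (r - 1), p r} : Set V))
    (ht : rk (adjF G) (insert z {p 0, p 1}) ((W ∪ p '' Set.Iic r) \ insert z {p 0, p 1}) ≤ 2) :
    Robust G (W ∪ p '' Set.Iic r) (insert z {p 0, p 1}) := by
  have h3 := h.three_le
  have hAB : ∀ x ∈ ({p (r - 1), p r} : Set V), x ∉ ({p 0, p 1} : Set V) := by
    have n := fun i j (hi : i ≤ r) (hj : j ≤ r) => (h.path.ne_iff hi hj).2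
    rintro x (rfl | rfl)
    · simp [n (r - 1) 0 (by omega) (by omega) (by omega), n (r - 1) 1 (by omega) (by omega)
        (by omega)]
    · simp [n r 0 (by omega) (by omega) (by omega), n r 1 (by omega) (by omega) (by omega)]
  have hAU : ({p 0, p 1} : Set V) ⊆ W ∪ p '' Set.Iic r := by
    rintro x (rfl | rfl) <;> exact h.mem (by omega)
  have hBU : ({p (r - 1), p r} : Set V) ⊆ W ∪ p '' Set.Iic r := by
    rintro x (rfl | rfl) <;> exact h.mem (by omega)
  have hzAU : insert z {p 0, p 1} ⊆ W ∪ p '' Set.Iic r := Set.insert_subset hz hAU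
  have hBz : ∀ x ∈ ({p (r - 1), p r} : Set V), x ∉ (insert z {p 0, p 1} : Set V) := by
    rintro x hx (rfl | hx')
    · exact hzB hx
    · exact hAB x hx hx'
  refine robust_head h.path h3 (fun i hi => h.mem hi) hz
    (h.linked _ _ subset_rfl (fun x hx => ⟨hBU hx, hAB x hx⟩) (Part.diff hAU))
    (h.linked _ _ (Set.subset_insert _ _) (fun x hx => ⟨hBU hx, hBz x hx⟩) (Part.diff hzAU)) ?_
  rcases hz with hz | ⟨i, hi, rfl⟩
  · refine Or.inr ⟨fun e => h.notMem 0 (by omega) (e ▸ hz), fun e => h.notMem 1 (by omega) (e ▸ hz),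
      fun e => h.notMem 2 (by omega) (e ▸ hz), ?_⟩
    have hP : Part ((W ∪ p '' Set.Iic r) \ {z}) {p 0, p 1}
        ((W ∪ p '' Set.Iic r) \ insert z {p 0, p 1}) := by
      refine ⟨fun x hx hx' => hx'.2 (Or.inr hx), fun x => ?_⟩
      have := @hAU x
      by_cases hxz : x = z
      · subst hxz; simpa using hzA
      · simp only [Set.mem_sdiff, Set.mem_singleton_iff, Set.mem_insert_iff] at this ⊢
        tauto
    refine rk_le_one_of_not_linked h.linked (Or.inl hz) (h.essential z hz) subset_rfl
      (fun x hx => ⟨hBU hx, hBz x hx⟩) hP ?_ ht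
    exact rk_pair_le _ _ _ _
  · simp only [Set.mem_Iic] at hi
    refine Or.inl ⟨i, ?_, ?_, rfl⟩
    · by_contra hc
      exact hzA (by rcases (by omega : i = 0 ∨ i = 1) with rfl | rfl <;> simp)
    · by_contra hc
      exact hzB (by rw [show i = r by omega]; simp)

/-- The first and last vertices of the tight order are absorbed into `A` and `B`. The ends then have
three vertices, so that any set or its complement meets each of them in at least two. Linking
finally makes `A` and `B` see each other with rank two; it uses only vertices of `U`, so no cut-rank
of a partition of `U` changes. -/
theorem exists_chain_of_tight [Finite V] {G : SimpleGraph V} {U A B : Set V} {k : ℕ} (v₀ : V)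
    (hlink : Linked G U A B) (hAB : ∀ x ∈ A, x ∉ B) (hAU : A ⊆ U) (hBU : B ⊆ U)
    (hA2 : rk (adjF G) A (U \ A) ≤ 2) (hB2 : rk (adjF G) (U \ B) B ≤ 2)
    (hztight : ∀ z ∈ U, z ∉ A → z ∉ B → TightAt G U A B z)
    (hlarge : ∀ x ∉ A, ∀ S : Set V, (insert x A ∩ S).Nontrivial ∨ (insert x A \ S).Nontrivial)
    (hlarge' : ∀ x ∉ B, ∀ S : Set V, (insert x B ∩ S).Nontrivial ∨ (insert x B \ S).Nontrivial)
    (hrobA : ∀ z ∈ U, z ∉ A → z ∉ B → rk (adjF G) (insert z A) (U \ insert z A) ≤ 2 →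
      Robust G U (insert z A))
    (hrobB : ∀ z ∈ U, z ∉ B → z ∉ A → rk (adjF G) (insert z B) (U \ insert z B) ≤ 2 →
      Robust G U (insert z B))
    (hwin : ∀ (z : ℕ → V) (N j : ℕ), (∀ i < N, ∀ k < N, z i = z k → i = k) →
      (∀ i < N, z i ∈ U ∧ z i ∉ A ∧ z i ∉ B) →
      (∀ i ≤ N, TightSet G U A B (A ∪ z '' Set.Iio i)) → j + 30 ≤ N →
      ∃ a b c, j ≤ a ∧ a < j + 30 ∧ j ≤ b ∧ b < j + 30 ∧ j ≤ c ∧ c < j + 30 ∧ a ≠ b ∧ a ≠ c ∧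
        b ≠ c ∧ ¬ rk (adjF G) {z a, z b, z c} (U \ {z a, z b, z c}) ≤ 2)
    (hk : ((U \ A) \ B).ncard = k + 2) :
    ∃ (H : SimpleGraph V) (A' B' : Set V) (z : ℕ → V), LocallyEquivalent G H ∧
      Chain H U A' B' z k := by
  obtain ⟨z, hinj, hmem, htight⟩ := exists_tight_enumeration hlink hAB hAU hBU hA2 hB2 hztight
    v₀ (k + 2) hk.ge
  have hsurj : ∀ x ∈ U, x ∉ A → x ∉ B → ∃ i < k + 2, z i = x := by
    have : z '' Set.Iio (k + 2) = (U \ A) \ B := by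
      refine Set.eq_of_subset_of_ncard_le ?_ ?_ (Set.toFinite _)
      · rintro _ ⟨i, hi, rfl⟩
        have := hmem i hi
        exact ⟨⟨this.1, this.2.1⟩, this.2.2⟩
      · have hI : Set.InjOn z (Set.Iio (k + 2)) := fun i hi j hj hij => hinj i hi j hj hij
        rw [hI.ncard_image, hk, Set.ncard_eq_toFinset_card', Set.toFinset_Iio, Nat.card_Iio]
    intro x hx hxA hxB
    have hx' : x ∈ z '' Set.Iio (k + 2) := this ▸ ⟨⟨hx, hxA⟩, hxB⟩
    exact hx'
  have hzU := fun i hi => (hmem i hi).1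
  have hzA := fun i hi => (hmem i hi).2.1
  have hzB := fun i hi => (hmem i hi).2.2
  have hz0 : A ∪ z '' Set.Iio 1 = insert (z 0) A := by
    have : Set.Iio 1 = ({0} : Set ℕ) := by ext; simp
    rw [this, Set.image_singleton, Set.union_singleton]
  have hsplit : ∀ j, A ∪ z '' Set.Iio (j + 1) =
      insert (z 0) A ∪ (fun i => z (i + 1)) '' Set.Iio j := by
    intro j
    ext x
    simp only [Set.mem_union, Set.mem_image, Set.mem_Iio, Set.mem_insert_iff]
    constructor
    · rintro (hx | ⟨i, hi, rfl⟩)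
      · exact Or.inl (Or.inr hx)
      · cases i with
        | zero => exact Or.inl (Or.inl rfl)
        | succ i => exact Or.inr ⟨i, by omega, rfl⟩
    · rintro ((rfl | hx) | ⟨i, hi, rfl⟩)
      · exact Or.inr ⟨0, by omega, rfl⟩
      · exact Or.inl hx
      · exact Or.inr ⟨i + 1, by omega, rfl⟩
  have hlast : U \ (A ∪ z '' Set.Iio (k + 1)) = insert (z (k + 1)) B := by
    ext x
    constructor
    · rintro ⟨hx, hn⟩
      by_cases hxB : x ∈ B
      · exact Or.inr hxB
      · obtain ⟨i, hi, rfl⟩ := hsurj x hx (fun hA => hn (Or.inl hA)) hxB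
        rcases Nat.lt_or_ge i (k + 1) with h1 | h1
        · exact absurd (Or.inr ⟨i, h1, rfl⟩) hn
        · exact Or.inl (by congr 1; omega)
    · rintro (rfl | hx)
      · refine ⟨hzU _ (by omega), ?_⟩
        rintro (hA | ⟨i, hi, hii⟩)
        · exact hzA _ (by omega) hA
        · simp only [Set.mem_Iio] at hi
          have := hinj i (by omega) (k + 1) (by omega) hii
          omega
      · exact ⟨hBU hx, (htight (k + 1) (by omega)).right x hx⟩
  have hRA : Robust G U (insert (z 0) A) := by
    refine hrobA _ (hzU _ (by omega)) (hzA _ (by omega)) (hzB _ (by omega)) ?_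
    have := (htight 1 (by omega)).le
    rwa [hz0] at this
  have hRB : Robust G U (insert (z (k + 1)) B) := by
    refine hrobB _ (hzU _ (by omega)) (hzB _ (by omega)) (hzA _ (by omega)) ?_
    have hP := Part.diff (htight (k + 1) (by omega)).sub
    have := (htight (k + 1) (by omega)).le
    rw [hlast] at this hP
    rw [hP.symm.diff_eq]
    exact rk_le_comm (adjF_comm G) this
  have hAU' : insert (z 0) A ⊆ U := Set.insert_subset (hzU _ (by omega)) hAU
  have hBU' : insert (z (k + 1)) B ⊆ U := Set.insert_subset (hzU _ (by omega)) hBU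
  have hdisj : ∀ x ∈ insert (z 0) A, x ∉ insert (z (k + 1)) B := by
    rintro x (rfl | hx) (hx' | hx')
    · have := hinj 0 (by omega) (k + 1) (by omega) hx'
      omega
    · exact hzB 0 (by omega) hx'
    · exact hzA (k + 1) (by omega) (hx' ▸ hx)
    · exact hAB x hx hx'
  have hUeq : insert (z 0) A ∪ (U \ insert (z 0) A) \ insert (z (k + 1)) B ∪
      insert (z (k + 1)) B = U := by
    ext x
    constructor
    · rintro ((hx | hx) | hx)
      exacts [hAU' hx, hx.1.1, hBU' hx]
    · intro hx
      by_cases h1 : x ∈ insert (z 0) A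
      · exact Or.inl (Or.inl h1)
      by_cases h2 : x ∈ insert (z (k + 1)) B
      · exact Or.inr h2
      · exact Or.inl (Or.inr ⟨⟨hx, h1⟩, h2⟩)
  -- The vertices at which complementations take place are not deleted: only the rank between the
  -- two ends matters, and the order remains intact.
  obtain ⟨l, hl, hlr⟩ := exists_linking _ G ((U \ insert (z 0) A) \ insert (z (k + 1)) B) rfl
    (by rw [hUeq]; exact hlink.mono (Set.subset_insert _ _) (Set.subset_insert _ _)) hdisj
    (fun x hx => ⟨hx.1.2, hx.2⟩)
  have hlU : ∀ v ∈ l, v ∈ U := fun v hv => (hl v hv).1.1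
  refine ⟨l.foldl localComplement G, _, _, fun i => z (i + 1), ⟨l, rfl⟩,
    ⟨?_, ?_, hdisj, ?_, ?_, hRA.foldl hAU' hlU, hRB.foldl hBU' hlU,
      hlarge _ (hzA _ (by omega)), hlarge' _ (hzB _ (by omega)), hlr, ?_⟩⟩
  · intro i hi j hj hij
    have := hinj _ (by omega) _ (by omega) hij
    omega
  · intro i hi
    constructor
    · rintro (e | hA)
      · have := hinj _ (by omega) _ (by omega) e
        omega
      · exact hzA _ (by omega) hA
    · rintro (e | hB)
      · have := hinj _ (by omega) _ (by omega) e
        omega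
      · exact hzB _ (by omega) hB
  · intro x
    constructor
    · intro hx
      by_cases hxA : x ∈ A
      · exact Or.inl (Or.inr hxA)
      by_cases hxB : x ∈ B
      · exact Or.inr (Or.inr (Or.inr hxB))
      obtain ⟨i, hi, rfl⟩ := hsurj x hx hxA hxB
      rcases Nat.eq_zero_or_pos i with rfl | hi0
      · exact Or.inl (Or.inl rfl)
      rcases Nat.lt_or_ge i (k + 1) with h1 | h1
      · exact Or.inr (Or.inl ⟨i - 1, by omega, by congr 1; omega⟩)
      · exact Or.inr (Or.inr (Or.inl (by congr 1; omega)))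
    · rintro (hx | ⟨i, hi, rfl⟩ | hx)
      · exact hAU' hx
      · exact hzU _ (by omega)
      · exact hBU' hx
  · intro j hj
    have ht := htight (j + 1) (by omega)
    rw [hsplit] at ht
    rw [rk_foldl_localComplement (Part.diff ht.sub) l G hlU]
    exact ht.le
  · intro j hj
    obtain ⟨a, b, c, h1, h2, h3, h4, h5, h6, h7, h8, h9, h10⟩ := hwin z (k + 2) (j + 1) hinj hmem
      (fun i hi => htight i hi) (by omega)
    refine ⟨a - 1, b - 1, c - 1, by omega, by omega, by omega, by omega, by omega, by omega,
      by omega, by omega, by omega, ?_⟩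
    rw [show a - 1 + 1 = a by omega, show b - 1 + 1 = b by omega, show c - 1 + 1 = c by omega]
    rw [rk_foldl_localComplement (Part.diff ?_) l G hlU]
    · exact h10
    · rintro x (rfl | rfl | rfl) <;> exact hzU _ (by omega)

theorem PathState.exists_chain [Finite V] {G : SimpleGraph V} {p : ℕ → V} {r : ℕ} {W : Set V}
    (h : PathState G p r W) (hW : 2 ≤ W.ncard)
    (hall : ∀ i, 2 ≤ i → i + 2 ≤ r →
      TightAt G (W ∪ p '' Set.Iic r) {p 0, p 1} {p (r - 1), p r} (p i)) :
    ∃ (H : SimpleGraph V) (U A B : Set V) (z : ℕ → V) (N : ℕ), LocallyEquivalent G H ∧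
      Chain H U A B z N ∧ W.ncard ≤ N + 2 := by
  have h3 := h.three_le
  have hlink := h.linked
  have hAU : ({p 0, p 1} : Set V) ⊆ W ∪ p '' Set.Iic r := by
    rintro x (rfl | rfl) <;> exact h.mem (by omega)
  have hBU : ({p (r - 1), p r} : Set V) ⊆ W ∪ p '' Set.Iic r := by
    rintro x (rfl | rfl) <;> exact h.mem (by omega)
  have n := fun i j (hi : i ≤ r) (hj : j ≤ r) => (h.path.ne_iff hi hj).2
  have hAB : ∀ x ∈ ({p 0, p 1} : Set V), x ∉ ({p (r - 1), p r} : Set V) := by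
    rintro x (rfl | rfl)
    · simp [n 0 (r - 1) (by omega) (by omega) (by omega), n 0 r (by omega) (by omega) (by omega)]
    · simp [n 1 (r - 1) (by omega) (by omega) (by omega), n 1 r (by omega) (by omega) (by omega)]
  have hAW : ∀ x ∈ W, x ∉ ({p 0, p 1} : Set V) := by
    rintro x hx (rfl | rfl)
    exacts [h.notMem 0 (by omega) hx, h.notMem 1 (by omega) hx]
  have hBW : ∀ x ∈ W, x ∉ ({p (r - 1), p r} : Set V) := by
    rintro x hx (rfl | rfl)
    exacts [h.notMem (r - 1) (by omega) hx, h.notMem r (by omega) hx]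
  have hztight : ∀ z ∈ W ∪ p '' Set.Iic r, z ∉ ({p 0, p 1} : Set V) →
      z ∉ ({p (r - 1), p r} : Set V) →
      TightAt G (W ∪ p '' Set.Iic r) {p 0, p 1} {p (r - 1), p r} z := by
    rintro z (hz | ⟨i, hi, rfl⟩) hzA hzB
    · exact tightAt_of_not_linked (Or.inl hz) hzB (h.essential z hz)
    · simp only [Set.mem_Iic] at hi
      refine hall i ?_ ?_
      · by_contra hc
        exact hzA (by rcases (by omega : i = 0 ∨ i = 1) with rfl | rfl <;> simp)
      · by_contra hc
        exact hzB (by rcases (by omega : i = r - 1 ∨ i = r) with rfl | rfl <;> simp)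
  have hwin := fun z N j => h.window (z := z) (N := N) (j := j)
  have hrobA := fun z => h.robust_insert (z := z)
  have hrobB := fun z => h.reverse.robust_insert (z := z)
  have e : (fun i => p (r - i)) '' Set.Iic r = p '' Set.Iic r := by
    ext x
    simp only [Set.mem_image, Set.mem_Iic]
    constructor
    · rintro ⟨i, hi, rfl⟩; exact ⟨r - i, by omega, rfl⟩
    · rintro ⟨i, hi, rfl⟩; exact ⟨r - i, by omega, by congr 1; omega⟩
  have e1 : ({p (r - 0), p (r - 1)} : Set V) = {p (r - 1), p r} := by
    rw [Nat.sub_zero, Set.pair_comm]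
  have e2 : ({p (r - (r - 1)), p (r - r)} : Set V) = {p 0, p 1} := by
    rw [Nat.sub_self, show r - (r - 1) = 1 by omega, Set.pair_comm]
  rw [e, e1, e2] at hrobB
  have hA01 := n 0 1 (by omega) (by omega) (by omega)
  have hB01 := n (r - 1) r (by omega) (by omega) (by omega)
  have hWU : W ⊆ W ∪ p '' Set.Iic r := Set.subset_union_left
  have hB2 : rk (adjF G) ((W ∪ p '' Set.Iic r) \ {p (r - 1), p r}) {p (r - 1), p r} ≤ 2 :=
    rk_le_comm (adjF_comm G) (rk_pair_le _ _ _ _)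
  have hA2 : rk (adjF G) {p 0, p 1} ((W ∪ p '' Set.Iic r) \ {p 0, p 1}) ≤ 2 := rk_pair_le _ _ _ _
  generalize W ∪ p '' Set.Iic r = U at *
  have hlarge : ∀ x ∉ ({p 0, p 1} : Set V), ∀ S : Set V,
      ((insert x {p 0, p 1} : Set V) ∩ S).Nontrivial ∨
      ((insert x {p 0, p 1} : Set V) \ S).Nontrivial := by
    intro x hx
    simp only [Set.mem_insert_iff, Set.mem_singleton_iff, not_or] at hx
    exact nontrivial_inter_or_sdiff hx.1 hx.2 hA01
  have hlarge' : ∀ x ∉ ({p (r - 1), p r} : Set V), ∀ S : Set V,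
      ((insert x {p (r - 1), p r} : Set V) ∩ S).Nontrivial ∨
      ((insert x {p (r - 1), p r} : Set V) \ S).Nontrivial := by
    intro x hx
    simp only [Set.mem_insert_iff, Set.mem_singleton_iff, not_or] at hx
    exact nontrivial_inter_or_sdiff hx.1 hx.2 hB01
  generalize ({p 0, p 1} : Set V) = A at *
  generalize ({p (r - 1), p r} : Set V) = B at *
  obtain ⟨k, hk⟩ : ∃ k, ((U \ A) \ B).ncard = k + 2 := by
    have : W.ncard ≤ ((U \ A) \ B).ncard := Set.ncard_le_ncard
      (fun x hx => ⟨⟨hWU hx, hAW x hx⟩, hBW x hx⟩) (Set.toFinite _)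
    exact ⟨((U \ A) \ B).ncard - 2, by omega⟩
  have hWk : W.ncard ≤ k + 2 := hk ▸ Set.ncard_le_ncard
      (fun x hx => ⟨⟨hWU hx, hAW x hx⟩, hBW x hx⟩) (Set.toFinite _)
  obtain ⟨H, A', B', z, hH, hC⟩ := exists_chain_of_tight (p 0) hlink hAB hAU hBU hA2 hB2 hztight
    hlarge hlarge' hrobA hrobB hwin hk
  exact ⟨H, U, A', B', z, k, hH, hC, hWk⟩

end

/-! ### Pivots turn half graphs into paths -/

section

variable {V : Type*}

/-- The pivot on the edge `u v`. -/
theorem adjF_pivot {G : SimpleGraph V} {u v : V} (huv : adjF G u v = 1) :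
    adjF ([u, v, u].foldl localComplement G) u v = 1 ∧
    (∀ x, x ≠ u → x ≠ v → adjF ([u, v, u].foldl localComplement G) u x = adjF G v x ∧
      adjF ([u, v, u].foldl localComplement G) v x = adjF G u x) ∧
    ∀ x y, x ≠ y → x ≠ u → x ≠ v → y ≠ u → y ≠ v →
      adjF ([u, v, u].foldl localComplement G) x y =
        adjF G x y + adjF G u x * adjF G v y + adjF G v x * adjF G u y := by
  have hne : u ≠ v := by rintro rfl; rw [adjF_self] at huv; exact absurd huv (by decide)
  have hvu : adjF G v u = 1 := by rw [adjF_comm, huv]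
  have two : (2 : ZMod 2) = 0 := by decide
  simp only [List.foldl_cons, List.foldl_nil]
  refine ⟨?_, fun x hxu hxv => ⟨?_, ?_⟩, fun x y hxy hxu hxv hyu hyv => ?_⟩
  · simp only [adjF_localComplement _ _ hne, adjF_localComplement _ _ hne.symm, adjF_self, huv]
    simp
  · simp only [adjF_localComplement _ _ hne.symm, adjF_self, huv,
      adjF_localComplement _ _ hxu.symm, adjF_localComplement _ _ hxv.symm, hvu]
    linear_combination adjF G u x * two
  · simp only [adjF_localComplement _ _ hne, adjF_localComplement _ _ hne.symm, adjF_self, huv,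
      adjF_localComplement _ _ hxu.symm, adjF_localComplement _ _ hxv.symm, hvu]
    linear_combination (adjF G u x + adjF G v x) * two
  · simp only [adjF_localComplement _ _ hne.symm, adjF_self, huv,
      adjF_localComplement _ _ hxu.symm, adjF_localComplement _ _ hxv.symm, hvu,
      adjF_localComplement _ _ hyu.symm, adjF_localComplement _ _ hyv.symm,
      adjF_localComplement _ _ hxy]
    linear_combination (3 * adjF G u x * adjF G u y + adjF G u x * adjF G v y +
      adjF G v x * adjF G v y + adjF G v x * adjF G u y) * two

/-- The sequence `s 0, t 0, s 1, t 1, …`. -/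
def interleave (s t : ℕ → V) (i : ℕ) : V := if i % 2 = 0 then s (i / 2) else t (i / 2)

theorem interleave_zero (s t : ℕ → V) : interleave s t 0 = s 0 := rfl

theorem interleave_one (s t : ℕ → V) : interleave s t 1 = t 0 := rfl

theorem interleave_add_two (s t : ℕ → V) (i : ℕ) :
    interleave s t (i + 2) = interleave (fun i => s (i + 1)) (fun i => t (i + 1)) i := by
  simp [interleave]

theorem interleave_two_mul (s t : ℕ → V) (i : ℕ) : interleave s t (2 * i) = s i := by
  simp [interleave]

theorem interleave_two_mul_add_one (s t : ℕ → V) (i : ℕ) :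
    interleave s t (2 * i + 1) = t i := by
  simp [interleave, show (2 * i + 1) / 2 = i by omega, show (2 * i + 1) % 2 = 1 by omega]

/-- The vertices `s i`, `t j` (`i, j < k`) induce a half graph, each vertex `e` of `E` is adjacent
to all or none of the `s i` according to `es e`, and similarly for the `t i`. -/
structure HalfGraph (G : SimpleGraph V) (s t : ℕ → V) (k : ℕ) (E : Set V) (es et : V → ZMod 2) :
    Prop where
  s_inj : ∀ i < k, ∀ j < k, s i = s j → i = j
  t_inj : ∀ i < k, ∀ j < k, t i = t j → i = j
  s_ne_t : ∀ i < k, ∀ j < k, s i ≠ t j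
  s_notMem : ∀ i < k, s i ∉ E
  t_notMem : ∀ i < k, t i ∉ E
  ss : ∀ i < k, ∀ j < k, adjF G (s i) (s j) = 0
  tt : ∀ i < k, ∀ j < k, adjF G (t i) (t j) = 0
  st : ∀ i < k, ∀ j < k, adjF G (s i) (t j) = if i ≤ j then 1 else 0
  es : ∀ e ∈ E, ∀ i < k, adjF G (s i) e = es e
  et : ∀ e ∈ E, ∀ i < k, adjF G (t i) e = et e

/-- The pivot exchanges the neighbourhoods of `s 0` and `t 0`. Afterwards `s 0` sees none of the
later vertices and `t 0` sees precisely the later `t i`, so both behave uniformly and can join `E`.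
A vertex of `E` keeps its adjacency to the `s i`, while that to the `t i` cancels. -/
theorem HalfGraph.pivot {G : SimpleGraph V} {s t : ℕ → V} {k : ℕ} {E : Set V} {es et : V → ZMod 2}
    (h : HalfGraph G s t (k + 1) E es et) :
    HalfGraph ([s 0, t 0, s 0].foldl localComplement G) (fun i => s (i + 1)) (fun i => t (i + 1)) k
      (insert (s 0) (insert (t 0) E)) (by
        classical exact fun x => if x = s 0 ∨ x = t 0 then 0 else es x)
      (by classical exact fun x => if x = t 0 then 1 else 0) := by
  classical
  have huv : adjF G (s 0) (t 0) = 1 := by rw [h.st 0 (by omega) 0 (by omega)]; simp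
  obtain ⟨-, h2, h3⟩ := adjF_pivot huv
  have n1 : ∀ i < k, s (i + 1) ≠ s 0 := fun i hi e => by
    have := h.s_inj _ (by omega) _ (by omega) e; omega
  have n2 : ∀ i < k, t (i + 1) ≠ t 0 := fun i hi e => by
    have := h.t_inj _ (by omega) _ (by omega) e; omega
  have n3 : ∀ i < k, s (i + 1) ≠ t 0 := fun i hi => h.s_ne_t _ (by omega) _ (by omega)
  have n4 : ∀ i < k, t (i + 1) ≠ s 0 := fun i hi => (h.s_ne_t _ (by omega) _ (by omega)).symm
  have n5 : s 0 ≠ t 0 := h.s_ne_t _ (by omega) _ (by omega)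
  have n6 : ∀ e ∈ E, e ≠ s 0 := fun e he e' => h.s_notMem 0 (by omega) (e' ▸ he)
  have n7 : ∀ e ∈ E, e ≠ t 0 := fun e he e' => h.t_notMem 0 (by omega) (e' ▸ he)
  have ss0 : ∀ i < k, adjF G (s 0) (s (i + 1)) = 0 := fun i hi => h.ss _ (by omega) _ (by omega)
  have tt0 : ∀ i < k, adjF G (t 0) (t (i + 1)) = 0 := fun i hi => h.tt _ (by omega) _ (by omega)
  have st0 : ∀ i < k, adjF G (s 0) (t (i + 1)) = 1 := fun i hi => by
    rw [h.st _ (by omega) _ (by omega)]; simp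
  have ts0 : ∀ i < k, adjF G (t 0) (s (i + 1)) = 0 := fun i hi => by
    rw [adjF_comm, h.st _ (by omega) _ (by omega)]; simp
  refine ⟨fun i hi j hj e => ?_, fun i hi j hj e => ?_,
    fun i hi j hj => h.s_ne_t _ (by omega) _ (by omega), ?_, ?_, ?_, ?_, ?_, ?_, ?_⟩
  · have := h.s_inj _ (by omega) _ (by omega) e; omega
  · have := h.t_inj _ (by omega) _ (by omega) e; omega
  · rintro i hi (e | e | e)
    exacts [n1 i hi e, n3 i hi e, h.s_notMem _ (by omega) e]
  · rintro i hi (e | e | e)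
    exacts [n4 i hi e, n2 i hi e, h.t_notMem _ (by omega) e]
  · intro i hi j hj
    by_cases hij : i = j
    · subst hij; exact adjF_self _ _
    · have hne : s (i + 1) ≠ s (j + 1) := fun e => by
        have := h.s_inj _ (by omega) _ (by omega) e; omega
      rw [h3 _ _ hne (n1 i hi) (n3 i hi) (n1 j hj) (n3 j hj), h.ss _ (by omega) _ (by omega),
        ss0 i hi, ts0 i hi]
      simp
  · intro i hi j hj
    by_cases hij : i = j
    · subst hij; exact adjF_self _ _
    · have hne : t (i + 1) ≠ t (j + 1) := fun e => by
        have := h.t_inj _ (by omega) _ (by omega) e; omega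
      rw [h3 _ _ hne (n4 i hi) (n2 i hi) (n4 j hj) (n2 j hj), h.tt _ (by omega) _ (by omega),
        tt0 i hi, tt0 j hj]
      simp
  · intro i hi j hj
    rw [h3 _ _ (h.s_ne_t _ (by omega) _ (by omega)) (n1 i hi) (n3 i hi) (n4 j hj) (n2 j hj),
      h.st _ (by omega) _ (by omega), tt0 j hj, ts0 i hi]
    simp
  · rintro e (rfl | rfl | he) i hi
    · rw [adjF_comm, (h2 _ (n1 i hi) (n3 i hi)).1, ts0 i hi]; simp
    · rw [adjF_comm, (h2 _ (n1 i hi) (n3 i hi)).2, ss0 i hi]; simp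
    · have hne : s (i + 1) ≠ e := fun e' => h.s_notMem _ (by omega) (e' ▸ he)
      rw [h3 _ _ hne (n1 i hi) (n3 i hi) (n6 e he) (n7 e he), h.es e he _ (by omega), ss0 i hi,
        ts0 i hi]
      simp [n6 e he, n7 e he]
  · rintro e (rfl | rfl | he) i hi
    · rw [adjF_comm, (h2 _ (n4 i hi) (n2 i hi)).1, tt0 i hi]; simp [n5]
    · rw [adjF_comm, (h2 _ (n4 i hi) (n2 i hi)).2, st0 i hi]; simp
    · have hne : t (i + 1) ≠ e := fun e' => h.t_notMem _ (by omega) (e' ▸ he)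
      rw [h3 _ _ hne (n4 i hi) (n2 i hi) (n6 e he) (n7 e he), h.et e he _ (by omega), st0 i hi,
        tt0 i hi, h.et e he _ (by omega)]
      simp [n7 e he, CharTwo.add_self_eq_zero]

/-- Pivoting on `s 0 t 0, s 1 t 1, …` turns a half graph into a path. -/
theorem HalfGraph.exists_path (k : ℕ) : ∀ {G : SimpleGraph V} {s t : ℕ → V} {E : Set V}
    {es et : V → ZMod 2}, HalfGraph G s t (k + 1) E es et →
    ∃ l : List V, (∀ v ∈ l, ∃ i < k + 1, v = s i ∨ v = t i) ∧
      (∀ i ≤ 2 * k + 1, ∀ j ≤ 2 * k + 1,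
        adjF (l.foldl localComplement G) (interleave s t i) (interleave s t j) =
          if j = i + 1 ∨ i = j + 1 then 1 else 0) ∧
      (∀ e ∈ E, ∀ i ≤ 2 * k + 1, adjF (l.foldl localComplement G) e (interleave s t i) =
        if i = 0 then et e else if i = 2 * k + 1 then es e else 0) ∧
      ∀ e ∈ E, ∀ e' ∈ E, e ≠ e' → adjF (l.foldl localComplement G) e e' =
        adjF G e e' + es e * et e' + et e * es e' := by
  classical
  induction k with
  | zero =>
    intro G s t E es et h
    have huv : adjF G (s 0) (t 0) = 1 := by rw [h.st 0 (by omega) 0 (by omega)]; simp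
    obtain ⟨h1, h2, h3⟩ := adjF_pivot huv
    have n6 : ∀ e ∈ E, e ≠ s 0 := fun e he e' => h.s_notMem 0 (by omega) (e' ▸ he)
    have n7 : ∀ e ∈ E, e ≠ t 0 := fun e he e' => h.t_notMem 0 (by omega) (e' ▸ he)
    refine ⟨[s 0, t 0, s 0], ?_, ?_, ?_, ?_⟩
    · intro v hv
      refine ⟨0, by omega, ?_⟩
      simp only [List.mem_cons, List.not_mem_nil, or_false] at hv
      tauto
    · intro i hi j hj
      rcases (by omega : i = 0 ∨ i = 1) with rfl | rfl <;>
      rcases (by omega : j = 0 ∨ j = 1) with rfl | rfl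
      · rw [adjF_self]; simp
      · rw [interleave_zero, interleave_one, h1]; simp
      · rw [interleave_zero, interleave_one, adjF_comm, h1]; simp
      · rw [adjF_self]; simp
    · intro e he i hi
      rcases (by omega : i = 0 ∨ i = 1) with rfl | rfl
      · rw [interleave_zero, adjF_comm, (h2 e (n6 e he) (n7 e he)).1, h.et e he 0 (by omega)]; simp
      · rw [interleave_one, adjF_comm, (h2 e (n6 e he) (n7 e he)).2, h.es e he 0 (by omega)]; simp
    · intro e he e' he' hne
      rw [h3 e e' hne (n6 e he) (n7 e he) (n6 e' he') (n7 e' he'), h.es e he _ (by omega),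
        h.et e he _ (by omega), h.es e' he' _ (by omega), h.et e' he' _ (by omega)]
  | succ k ih =>
    intro G s t E es et h
    have huv : adjF G (s 0) (t 0) = 1 := by rw [h.st 0 (by omega) 0 (by omega)]; simp
    obtain ⟨h1, h2, h3⟩ := adjF_pivot huv
    have n5 : s 0 ≠ t 0 := h.s_ne_t _ (by omega) _ (by omega)
    have n6 : ∀ e ∈ E, e ≠ s 0 := fun e he e' => h.s_notMem 0 (by omega) (e' ▸ he)
    have n7 : ∀ e ∈ E, e ≠ t 0 := fun e he e' => h.t_notMem 0 (by omega) (e' ▸ he)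
    -- Of the new exterior vertices, `t 0` attaches exactly to the first vertex of the shorter path
    -- and `s 0` to neither end, so `s 0, t 0` extends that path. Old exterior vertices now have `et
    -- = 0`, hence later pivots leave the edges among them alone.
    obtain ⟨l, hl, hp, he, hee⟩ := ih h.pivot
    have hs0 : s 0 ∈ insert (s 0) (insert (t 0) E) := Or.inl rfl
    have ht0 : t 0 ∈ insert (s 0) (insert (t 0) E) := Or.inr (Or.inl rfl)
    have hE : ∀ e ∈ E, e ∈ insert (s 0) (insert (t 0) E) := fun e he => Or.inr (Or.inr he)
    have c0 := he _ hs0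
    have c1 := he _ ht0
    have c01 := hee _ hs0 _ ht0 n5
    rw [h1] at c01
    have hce : ∀ e ∈ E, ∀ i ≤ 2 * k + 1, _ := fun e h' => he e (hE e h')
    have hce0 : ∀ e ∈ E, _ := fun e h' => hee e (hE e h') _ hs0 (n6 e h')
    have hce1 : ∀ e ∈ E, _ := fun e h' => hee e (hE e h') _ ht0 (n7 e h')
    have hcee : ∀ e ∈ E, ∀ e' ∈ E, _ := fun e h' e' h'' => hee e (hE e h') e' (hE e' h'')
    simp only [← List.foldl_append] at hp c0 c1 c01 hce hce0 hce1 hcee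
    refine ⟨[s 0, t 0, s 0] ++ l, ?_, ?_, ?_, ?_⟩
    · intro v hv
      rcases List.mem_append.1 hv with hv | hv
      · refine ⟨0, by omega, ?_⟩
        simp only [List.mem_cons, List.not_mem_nil, or_false] at hv
        tauto
      · obtain ⟨i, hi, hv⟩ := hl v hv
        exact ⟨i + 1, by omega, hv⟩
    · generalize ([s 0, t 0, s 0] ++ l).foldl localComplement G = H at *
      have key : ∀ i ≤ 2 * (k + 1) + 1, ∀ j ≤ 2 * (k + 1) + 1, i < j →
          adjF H (interleave s t i) (interleave s t j) = if j = i + 1 then 1 else 0 := by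
        intro i hi j hj hij
        match i, j with
        | 0, 1 => rw [interleave_zero, interleave_one, c01]; simp [n5]
        | 0, j + 2 =>
          rw [interleave_zero, interleave_add_two, c0 j (by omega)]
          simp [n5]
        | 1, j + 2 =>
          rw [interleave_one, interleave_add_two, c1 j (by omega)]
          simp
        | i + 2, j + 2 =>
          rw [interleave_add_two, interleave_add_two, hp i (by omega) j (by omega)]
          refine if_congr ?_ rfl rfl
          omega
      intro i hi j hj
      rcases Nat.lt_trichotomy i j with hij | rfl | hij
      · rw [key i hi j hj hij]; exact if_congr (by omega) rfl rfl
      · rw [adjF_self, if_neg (by omega)]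
      · rw [adjF_comm, key j hj i hi hij]; exact if_congr (by omega) rfl rfl
    · intro e h' i hi
      match i with
      | 0 =>
        rw [interleave_zero, hce0 e h', adjF_comm, (h2 e (n6 e h') (n7 e h')).1,
          h.et e h' 0 (by omega)]
        simp [n5, n7 e h']
      | 1 =>
        rw [interleave_one, hce1 e h', adjF_comm, (h2 e (n6 e h') (n7 e h')).2,
          h.es e h' 0 (by omega)]
        simp [n6 e h', n7 e h', CharTwo.add_self_eq_zero]
      | i + 2 =>
        rw [interleave_add_two, hce e h' i (by omega)]
        simp [n6 e h', n7 e h']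
        simp only [mul_add, mul_one]
        split_ifs <;> first | rfl | omega
    · intro e h' e' h'' hne
      rw [hcee e h' e' h'' hne, h3 e e' hne (n6 e h') (n7 e h') (n6 e' h'') (n7 e' h''),
        h.es e h' _ (by omega), h.et e h' _ (by omega), h.es e' h'' _ (by omega),
        h.et e' h'' _ (by omega)]
      simp [n7 e h', n7 e' h'']

end

/-! ### The bilinear form and alternating configurations -/

section

variable {V : Type*}

/-- The standard bilinear form on the plane over the field with two elements. -/
def dot (p q : ZMod 2 × ZMod 2) : ZMod 2 := p.1 * q.1 + p.2 * q.2

theorem dot_comm (p q : ZMod 2 × ZMod 2) : dot p q = dot q p := by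
  unfold dot; ring

theorem dot_add (p q q' : ZMod 2 × ZMod 2) : dot p (q + q') = dot p q + dot p q' := by
  simp only [dot, Prod.fst_add, Prod.snd_add]; ring

theorem add_dot (p p' q : ZMod 2 × ZMod 2) : dot (p + p') q = dot p q + dot p' q := by
  simp only [dot, Prod.fst_add, Prod.snd_add]; ring

theorem dot_smul (c : ZMod 2) (p q : ZMod 2 × ZMod 2) : dot p (c • q) = c * dot p q := by
  simp only [dot, Prod.smul_fst, Prod.smul_snd, smul_eq_mul]; ring

theorem smul_dot (c : ZMod 2) (p q : ZMod 2 × ZMod 2) : dot (c • p) q = c * dot p q := by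
  simp only [dot, Prod.smul_fst, Prod.smul_snd, smul_eq_mul]; ring

theorem rk_le_two_of_dot [Finite V] {M : V → V → ZMod 2} {R C : Set V}
    {γ : V → ZMod 2 × ZMod 2} (h : ∀ y ∈ C, ∃ d, ∀ x ∈ R, M x y = dot (γ x) d) :
    rk M R C ≤ 2 := by
  choose! d hd using h
  exact rk_le_two_iff.2 ⟨fun x => (γ x).1, fun y => (d y).1, fun x => (γ x).2, fun y => (d y).2,
    fun x hx y hy => hd y hy x hx⟩

/-- The vectors of the plane orthogonal to a nonzero `c` form a line, which over `𝔽₂` has a single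
nonzero element. -/
theorem rk_le_one_of_dot [Finite V] {M : V → V → ZMod 2} {R C : Set V}
    {γ : V → ZMod 2 × ZMod 2} {c : ZMod 2 × ZMod 2} (hc : c ≠ 0) (hγ : ∀ x ∈ R, dot (γ x) c = 0)
    (h : ∀ y ∈ C, ∃ d, ∀ x ∈ R, M x y = dot (γ x) d) : rk M R C ≤ 1 := by
  choose! d hd using h
  have key : ∀ c : ZMod 2 × ZMod 2, c ≠ 0 → ∃ w, ∀ v, dot v c = 0 → v = 0 ∨ v = w := by decide
  obtain ⟨w, hw⟩ := key c hc
  classical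
  refine rk_le_one_iff.2 ⟨fun x => if γ x = 0 then 0 else 1, fun y => dot w (d y), ?_⟩
  intro x hx y hy
  rw [hd y hy x hx]
  rcases hw _ (hγ x hx) with h0 | h0
  · simp [h0, dot]
  · by_cases h1 : w = 0
    · simp [h0, h1, dot]
    · simp [h0, h1]

/-- The values of `γ` on `A` span the plane. -/
def Spans (γ : V → ZMod 2 × ZMod 2) (A : Set V) : Prop :=
  ∀ c, (∀ a ∈ A, dot (γ a) c = 0) → c = 0

theorem not_rk_le_one_of_spans [Finite V] {M : V → V → ZMod 2} {A B : Set V}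
    {α β : V → ZMod 2 × ZMod 2} (hA : Spans α A) (hB : Spans β B)
    (h : ∀ a ∈ A, ∀ b ∈ B, M a b = dot (α a) (β b)) : ¬ rk M A B ≤ 1 := by
  intro hr
  obtain ⟨f, g, hfg⟩ := rk_le_one_iff.1 hr
  have key : ∀ p : ZMod 2 × ZMod 2, ∃ c, c ≠ 0 ∧ dot p c = 0 := by decide
  have hg : ∀ b ∈ B, β b ≠ 0 → g b = 1 := by
    intro b hb hne
    by_contra hg1
    refine hne (hA _ fun a ha => ?_)
    rw [← h a ha b hb, hfg a ha b hb, (zmod_two_cases _).resolve_right hg1, mul_zero]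
  by_cases hex : ∃ b ∈ B, β b ≠ 0
  · obtain ⟨b, hb, hne⟩ := hex
    obtain ⟨c, hc, hbc⟩ := key (β b)
    refine hc (hB c fun b' hb' => ?_)
    by_cases hne' : β b' = 0
    · simp [hne', dot]
    · have : β b + β b' = 0 := hA _ fun a ha => by
        rw [dot_add, ← h a ha b hb, ← h a ha b' hb', hfg a ha b hb, hfg a ha b' hb', hg b hb hne,
          hg b' hb' hne', CharTwo.add_self_eq_zero]
      rw [← CharTwo.add_eq_zero.1 this, hbc]
  · push Not at hex
    refine (by decide : ((1, 0) : ZMod 2 × ZMod 2) ≠ 0) (hB _ fun b hb => ?_)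
    simp [hex b hb, dot]

/-- The union of `A`, `B` and the first `k` vertices of the sequences `s` and `t`. -/
def altSet (A B : Set V) (s t : ℕ → V) (k : ℕ) : Set V :=
  A ∪ B ∪ s '' Set.Iio k ∪ t '' Set.Iio k

theorem left_subset_altSet (A B : Set V) (s t : ℕ → V) (k : ℕ) : A ⊆ altSet A B s t k :=
  fun _ hx => Or.inl (Or.inl (Or.inl hx))

theorem right_subset_altSet (A B : Set V) (s t : ℕ → V) (k : ℕ) : B ⊆ altSet A B s t k :=
  fun _ hx => Or.inl (Or.inl (Or.inr hx))

/-- `s 0, t 0, s 1, t 1, …, s (k - 1), t (k - 1)` are ordered from `A` to `B`, and the adjacency of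
two vertices, one of them before the other, is given by the bilinear form `dot`, where all vertices
`s i` have the same coordinates `σ`, `σ'`, and all vertices `t i` have the same coordinates
`τ`, `τ'`. -/
structure Alternating (G : SimpleGraph V) (A B : Set V) (α β : V → ZMod 2 × ZMod 2)
    (σ σ' τ τ' : ZMod 2 × ZMod 2) (s t : ℕ → V) (k : ℕ) : Prop where
  s_inj : ∀ i < k, ∀ j < k, s i = s j → i = j
  t_inj : ∀ i < k, ∀ j < k, t i = t j → i = j
  s_ne_t : ∀ i < k, ∀ j < k, s i ≠ t j
  s_notMem : ∀ i < k, s i ∉ A ∪ B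
  t_notMem : ∀ i < k, t i ∉ A ∪ B
  disj : ∀ x ∈ A, x ∉ B
  ss : ∀ i < k, ∀ j < k, i ≠ j → adjF G (s i) (s j) = dot σ σ'
  tt : ∀ i < k, ∀ j < k, i ≠ j → adjF G (t i) (t j) = dot τ τ'
  st : ∀ i < k, ∀ j < k, adjF G (s i) (t j) = if i ≤ j then dot σ τ' else dot τ σ'
  ab : ∀ a ∈ A, ∀ b ∈ B, adjF G a b = dot (α a) (β b)
  a_s : ∀ a ∈ A, ∀ i < k, adjF G a (s i) = dot (α a) σ'
  a_t : ∀ a ∈ A, ∀ i < k, adjF G a (t i) = dot (α a) τ'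
  sb : ∀ b ∈ B, ∀ i < k, adjF G (s i) b = dot σ (β b)
  tb : ∀ b ∈ B, ∀ i < k, adjF G (t i) b = dot τ (β b)
  st_one : dot σ τ' = 1
  ts_zero : dot τ σ' = 0
  spans_left : Spans α A
  spans_right : Spans β B
  robust_left : Robust G (altSet A B s t k) A
  robust_right : Robust G (altSet A B s t k) B
  large_left : ∀ S : Set V, (A ∩ S).Nontrivial ∨ (A \ S).Nontrivial
  large_right : ∀ S : Set V, (B ∩ S).Nontrivial ∨ (B \ S).Nontrivial

section

variable {G : SimpleGraph V} {A B : Set V} {α β : V → ZMod 2 × ZMod 2}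
  {σ σ' τ τ' : ZMod 2 × ZMod 2} {s t : ℕ → V} {k : ℕ}

theorem altSet_reverse (A B : Set V) (s t : ℕ → V) (k : ℕ) :
    altSet B A (fun i => t (k - 1 - i)) (fun i => s (k - 1 - i)) k = altSet A B s t k := by
  have e : ∀ f : ℕ → V, (fun i => f (k - 1 - i)) '' Set.Iio k = f '' Set.Iio k := by
    intro f
    ext x
    simp only [Set.mem_image, Set.mem_Iio]
    constructor
    · rintro ⟨i, hi, rfl⟩; exact ⟨k - 1 - i, by omega, rfl⟩
    · rintro ⟨i, hi, rfl⟩; exact ⟨k - 1 - i, by omega, by congr 1; omega⟩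
  unfold altSet
  rw [e, e, Set.union_comm B A, Set.union_right_comm]

/-- Reading the order backwards exchanges the roles of the ends, of `s` and `t`, and of the primed
and unprimed coordinates. -/
theorem Alternating.reverse (h : Alternating G A B α β σ σ' τ τ' s t k) :
    Alternating G B A β α τ' τ σ' σ (fun i => t (k - 1 - i)) (fun i => s (k - 1 - i)) k where
  s_inj i hi j hj e := by have := h.t_inj _ (by omega) _ (by omega) e; omega
  t_inj i hi j hj e := by have := h.s_inj _ (by omega) _ (by omega) e; omega
  s_ne_t i hi j hj := (h.s_ne_t _ (by omega) _ (by omega)).symm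
  s_notMem i hi := by rw [Set.union_comm]; exact h.t_notMem _ (by omega)
  t_notMem i hi := by rw [Set.union_comm]; exact h.s_notMem _ (by omega)
  disj x hx hx' := h.disj x hx' hx
  ss i hi j hj hij := by rw [h.tt _ (by omega) _ (by omega) (by omega), dot_comm]
  tt i hi j hj hij := by rw [h.ss _ (by omega) _ (by omega) (by omega), dot_comm]
  st i hi j hj := by
    rw [adjF_comm, h.st _ (by omega) _ (by omega), dot_comm σ, dot_comm τ]
    exact if_congr (by omega) rfl rfl
  ab a ha b hb := by rw [adjF_comm, h.ab b hb a ha, dot_comm]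
  a_s a ha i hi := by rw [adjF_comm, h.tb a ha _ (by omega), dot_comm]
  a_t a ha i hi := by rw [adjF_comm, h.sb a ha _ (by omega), dot_comm]
  sb a ha i hi := by rw [adjF_comm, h.a_t a ha _ (by omega), dot_comm]
  tb a ha i hi := by rw [adjF_comm, h.a_s a ha _ (by omega), dot_comm]
  st_one := by rw [dot_comm]; exact h.st_one
  ts_zero := by rw [dot_comm]; exact h.ts_zero
  spans_left := h.spans_right
  spans_right := h.spans_left
  robust_left := by rw [altSet_reverse]; exact h.robust_right
  robust_right := by rw [altSet_reverse]; exact h.robust_left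
  large_left := h.large_right
  large_right := h.large_left

theorem Alternating.rk_left [Finite V] (h : Alternating G A B α β σ σ' τ τ' s t k) :
    rk (adjF G) A (altSet A B s t k \ A) ≤ 2 := by
  refine rk_le_two_of_dot (γ := α) ?_
  rintro y ⟨((hy | hy) | ⟨i, hi, rfl⟩) | ⟨i, hi, rfl⟩, hyA⟩
  · exact absurd hy hyA
  · exact ⟨β y, fun a ha => h.ab a ha y hy⟩
  · exact ⟨σ', fun a ha => h.a_s a ha i hi⟩
  · exact ⟨τ', fun a ha => h.a_t a ha i hi⟩

/-- In the case `σ σ' = 0`, `τ τ' = 0` the configuration yields a cycle. -/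
theorem Alternating.hasCyc_of_zero_zero [Finite V] {n : ℕ}
    (h : Alternating G A B α β σ σ' τ τ' s t (k + 1)) (hn : 3 ≤ n) (hnk : n ≤ 2 * k + 3)
    (hσ : dot σ σ' = 0) (hτ : dot τ τ' = 0) : HasCyc G n := by
  classical
  let es : V → ZMod 2 := fun x => if x ∈ A then dot (α x) σ' else dot σ (β x)
  let et : V → ZMod 2 := fun x => if x ∈ A then dot (α x) τ' else dot τ (β x)
  have esA : ∀ a ∈ A, es a = dot (α a) σ' := fun a ha => if_pos ha
  have etA : ∀ a ∈ A, et a = dot (α a) τ' := fun a ha => if_pos ha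
  have esB : ∀ b ∈ B, es b = dot σ (β b) := fun b hb => if_neg fun ha => h.disj b ha hb
  have etB : ∀ b ∈ B, et b = dot τ (β b) := fun b hb => if_neg fun ha => h.disj b ha hb
  have hH : HalfGraph G s t (k + 1) (A ∪ B) es et := by
    refine ⟨h.s_inj, h.t_inj, h.s_ne_t, h.s_notMem, h.t_notMem, ?_, ?_, ?_, ?_, ?_⟩
    · intro i hi j hj
      by_cases hij : i = j
      · rw [hij, adjF_self]
      · rw [h.ss i hi j hj hij, hσ]
    · intro i hi j hj
      by_cases hij : i = j
      · rw [hij, adjF_self]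
      · rw [h.tt i hi j hj hij, hτ]
    · intro i hi j hj
      rw [h.st i hi j hj, h.st_one, h.ts_zero]
    · rintro e (he | he) i hi
      · rw [esA e he, adjF_comm, h.a_s e he i hi]
      · rw [esB e he, h.sb e he i hi]
    · rintro e (he | he) i hi
      · rw [etA e he, adjF_comm, h.a_t e he i hi]
      · rw [etB e he, h.tb e he i hi]
  obtain ⟨l, hl, hp, he, hee⟩ := hH.exists_path
  have hlU : ∀ v ∈ l, v ∈ altSet A B s t (k + 1) := by
    intro v hv
    obtain ⟨i, hi, rfl | rfl⟩ := hl v hv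
    · exact Or.inl (Or.inr ⟨i, hi, rfl⟩)
    · exact Or.inr ⟨i, hi, rfl⟩
  have hRA := h.robust_left.foldl (left_subset_altSet _ _ _ _ _) hlU
  have hRB := h.robust_right.foldl (right_subset_altSet _ _ _ _ _) hlU
  have hloc : LocallyEquivalent G (l.foldl localComplement G) := ⟨l, rfl⟩
  generalize l.foldl localComplement G = H at *
  refine HasCyc.of_locallyEquivalent hloc ?_
  have hq : ∀ i ≤ 2 * k + 1, interleave s t i ∉ A ∪ B := by
    intro i hi
    unfold interleave
    split_ifs
    · exact h.s_notMem _ (by omega)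
    · exact h.t_notMem _ (by omega)
  have hpath : IsPath H (interleave s t) (2 * k + 1) := by
    refine ⟨fun i hi j hj e => ?_, fun i hi j hj => ?_⟩
    · unfold interleave at e
      split_ifs at e
      · have := h.s_inj _ (by omega) _ (by omega) e; omega
      · exact absurd e (h.s_ne_t _ (by omega) _ (by omega))
      · exact absurd e.symm (h.s_ne_t _ (by omega) _ (by omega))
      · have := h.t_inj _ (by omega) _ (by omega) e; omega
    · rw [← adjF_eq_one, hp i hi j hj]
      split_ifs with hij <;> simp [hij]
  have hsplit : ∀ y ∈ altSet A B s t (k + 1), y ∉ A → y ∉ B →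
      ∃ i ≤ 2 * k + 1, interleave s t i = y := by
    rintro y (((hy | hy) | ⟨i, hi, rfl⟩) | ⟨i, hi, rfl⟩) hA hB
    · exact absurd hy hA
    · exact absurd hy hB
    · simp only [Set.mem_Iio] at hi
      exact ⟨2 * i, by omega, interleave_two_mul s t i⟩
    · simp only [Set.mem_Iio] at hi
      exact ⟨2 * i + 1, by omega, interleave_two_mul_add_one s t i⟩
  -- The pivoted path is closed by a detour through the two ends. If there is none, the set `K`
  -- contradicts robustness of `A` or `B`, as follows.
  rcases hasCyc_or_separated (N := A ∪ B) hn (by omega : 1 ≤ 2 * k + 1) (by omega) hpath hq (by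
    intro i hi hi' y hy
    rw [← adjF_eq_zero, adjF_comm, he y hy i (by omega), if_neg (by omega),
      if_neg (by omega)]) with hc | ⟨K, hKN, hK0, hKc, hKr⟩
  · exact hc
  exfalso
  -- the vertices outside `K` are orthogonal to `τ`, those in `K` to `σ`
  have out : ∀ x ∈ A ∪ B, x ∉ K → et x = 0 := by
    intro x hx hxK
    have := mt (hK0 x hx) hxK
    rw [← adjF_eq_zero, adjF_comm, he x hx 0 (by omega), if_pos rfl] at this
    exact this
  have inn : ∀ x ∈ K, es x = 0 := by
    intro x hx
    have := hKr x hx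
    rw [← adjF_eq_zero, he x (hKN hx) _ le_rfl, if_neg (by omega), if_pos rfl] at this
    exact this
  have sep : ∀ x ∈ K, ∀ y ∈ A ∪ B, y ∉ K → adjF H x y = 0 := fun x hx y hy hyK =>
    adjF_eq_zero.2 fun hadj => hyK (hKc x hx y hy hadj)
  have hAq : ∀ i ≤ 2 * k + 1, ∃ d, ∀ x ∈ A, adjF H x (interleave s t i) = dot (α x) d := by
    intro i hi
    by_cases h0 : i = 0
    · exact ⟨τ', fun x hx => by rw [he x (Or.inl hx) i hi, if_pos h0, etA x hx]⟩
    by_cases h1 : i = 2 * k + 1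
    · exact ⟨σ', fun x hx => by rw [he x (Or.inl hx) i hi, if_neg h0, if_pos h1, esA x hx]⟩
    · exact ⟨0, fun x hx => by rw [he x (Or.inl hx) i hi, if_neg h0, if_neg h1]; simp [dot]⟩
  have hBq : ∀ i ≤ 2 * k + 1, ∃ d, ∀ x ∈ B, adjF H x (interleave s t i) = dot (β x) d := by
    intro i hi
    by_cases h0 : i = 0
    · exact ⟨τ, fun x hx => by rw [he x (Or.inr hx) i hi, if_pos h0, etB x hx, dot_comm]⟩
    by_cases h1 : i = 2 * k + 1
    · exact ⟨σ, fun x hx => by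
        rw [he x (Or.inr hx) i hi, if_neg h0, if_pos h1, esB x hx, dot_comm]⟩
    · exact ⟨0, fun x hx => by rw [he x (Or.inr hx) i hi, if_neg h0, if_neg h1]; simp [dot]⟩
  have hab : ∀ a ∈ A, ∀ b ∈ B, adjF H a b =
      dot (α a) (β b + dot τ (β b) • σ' + dot σ (β b) • τ') := by
    intro a ha b hb
    rw [hee a (Or.inl ha) b (Or.inr hb) fun e => h.disj a ha (e ▸ hb), h.ab a ha b hb, esA a ha,
      etA a ha, esB b hb, etB b hb, dot_add, dot_add, dot_smul, dot_smul]
    ring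
  have hba : ∀ a ∈ A, ∀ b ∈ B, adjF H b a =
      dot (β b) (α a + dot (α a) σ' • τ + dot (α a) τ' • σ) := by
    intro a ha b hb
    rw [adjF_comm, hab a ha b hb]
    rw [dot_comm (β b)]
    simp only [dot_add, dot_smul, add_dot, smul_dot]
    ring
  have rowsA : ∀ S ⊆ A, (∀ x ∈ S, ∀ y ∈ A, y ∉ S → adjF H x y = 0) →
      ∀ y ∈ altSet A B s t (k + 1) \ S, ∃ d, ∀ x ∈ S, adjF H x y = dot (α x) d := by
    intro S hS hSA y hy
    by_cases hyA : y ∈ A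
    · exact ⟨0, fun x hx => by rw [hSA x hx y hyA hy.2]; simp [dot]⟩
    by_cases hyB : y ∈ B
    · exact ⟨_, fun x hx => hab x (hS hx) y hyB⟩
    obtain ⟨i, hi, rfl⟩ := hsplit y hy.1 hyA hyB
    obtain ⟨d, hd⟩ := hAq i hi
    exact ⟨d, fun x hx => hd x (hS hx)⟩
  have rowsB : ∀ S ⊆ B, (∀ x ∈ S, ∀ y ∈ B, y ∉ S → adjF H x y = 0) →
      ∀ y ∈ altSet A B s t (k + 1) \ S, ∃ d, ∀ x ∈ S, adjF H x y = dot (β x) d := by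
    intro S hS hSA y hy
    by_cases hyB : y ∈ B
    · exact ⟨0, fun x hx => by rw [hSA x hx y hyB hy.2]; simp [dot]⟩
    by_cases hyA : y ∈ A
    · exact ⟨_, fun x hx => hba y hyA x (hS hx)⟩
    obtain ⟨i, hi, rfl⟩ := hsplit y hy.1 hyA hyB
    obtain ⟨d, hd⟩ := hBq i hi
    exact ⟨d, fun x hx => hd x (hS hx)⟩
  have sepA : ∀ x ∈ A ∩ K, ∀ y ∈ A, y ∉ A ∩ K → adjF H x y = 0 := fun x hx y hy hyK =>
    sep x hx.2 y (Or.inl hy) fun hK => hyK ⟨hy, hK⟩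
  have sepA' : ∀ x ∈ A \ K, ∀ y ∈ A, y ∉ A \ K → adjF H x y = 0 := fun x hx y hy hyK => by
    rw [adjF_comm]
    exact sep y (by by_contra hc; exact hyK ⟨hy, hc⟩) x (Or.inl hx.1) hx.2
  have sepB : ∀ x ∈ B ∩ K, ∀ y ∈ B, y ∉ B ∩ K → adjF H x y = 0 := fun x hx y hy hyK =>
    sep x hx.2 y (Or.inr hy) fun hK => hyK ⟨hy, hK⟩
  have sepB' : ∀ x ∈ B \ K, ∀ y ∈ B, y ∉ B \ K → adjF H x y = 0 := fun x hx y hy hyK => by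
    rw [adjF_comm]
    exact sep y (by by_contra hc; exact hyK ⟨hy, hc⟩) x (Or.inr hx.1) hx.2
  have nz : ∀ p q : ZMod 2 × ZMod 2, dot p q = 1 → p ≠ 0 ∧ q ≠ 0 := by decide
  obtain ⟨hσ0, hτ0⟩ := nz _ _ h.st_one
  -- On `A \ K` all values of `α` are orthogonal to `τ'`, so two vertices there would give a set of
  -- rank at most one. Robustness of `A ∩ K` then makes `α` span on it, which forces `σ' = 0`. The
  -- same reasoning for `B` shows that `β` spans on `B \ K`.
  have hS : (A ∩ K).Nontrivial := (h.large_left K).resolve_right fun hnt =>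
    hRA _ Set.sdiff_subset hnt (rk_le_one_of_dot hτ0 (fun x hx => by
      rw [← etA x hx.1, out x (Or.inl hx.1) hx.2]) (rowsA _ Set.sdiff_subset sepA'))
  have hSspan : Spans α (A ∩ K) := fun c hc => by
    by_contra hc0
    exact hRA _ Set.inter_subset_left hS (rk_le_one_of_dot hc0 hc
      (rowsA _ Set.inter_subset_left sepA))
  have hσ' : σ' = 0 := hSspan _ fun a ha => by rw [← esA a ha.1, inn a ha.2]
  have hT : (B \ K).Nontrivial := (h.large_right K).resolve_left fun hnt =>
    hRB _ Set.inter_subset_left hnt (rk_le_one_of_dot hσ0 (fun x hx => by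
      rw [dot_comm, ← esB x hx.1, inn x hx.2]) (rowsB _ Set.inter_subset_left sepB))
  have hTspan : Spans β (B \ K) := fun c hc => by
    by_contra hc0
    exact hRB _ Set.sdiff_subset hT (rk_le_one_of_dot hc0 hc
      (rowsB _ Set.sdiff_subset sepB'))
  have key : ∀ p : ZMod 2 × ZMod 2, ∃ c, c ≠ 0 ∧ dot p c = 0 := by decide
  -- As there are no edges between `A ∩ K` and `B \ K`, the values of `β` on `B \ K` are multiples
  -- of `τ'`, and these do not span the plane.
  obtain ⟨c, hc0, hc⟩ := key τ'
  refine hc0 (hTspan c fun b hb => ?_)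
  have hz := hSspan _ fun a ha => by
    rw [← hab a ha.1 b hb.1]
    exact sep a ha.2 b (Or.inr hb.1) hb.2
  rw [hσ', smul_zero, add_zero] at hz
  have := congrArg (fun v => dot v c) hz
  simp only [add_dot, smul_dot, hc, mul_zero, add_zero] at this
  rw [this]
  simp [dot]

end

end

/-! ### Cycles from alternating configurations -/

section

variable {V : Type*}

variable {G : SimpleGraph V} {A B : Set V} {α β : V → ZMod 2 × ZMod 2}
  {σ σ' τ τ' : ZMod 2 × ZMod 2} {s t : ℕ → V} {k : ℕ}

/-- If `σ σ' = 0` and `τ τ' = 1`, then contracting `s 0` gives a configuration with both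
products zero. -/
theorem Alternating.contract [Finite V] (h : Alternating G A B α β σ σ' τ τ' s t (k + 1))
    (hσ : dot σ σ' = 0) :
    Alternating (localComplement G (s 0)) A B α (fun b => β b + dot σ (β b) • σ') σ σ' (τ + σ)
      (τ' + σ') (fun i => s (i + 1)) (fun i => t (i + 1)) k := by
  have hsub : altSet A B (fun i => s (i + 1)) (fun i => t (i + 1)) k ⊆
      altSet A B s t (k + 1) := by
    rintro x ((hx | ⟨i, hi, rfl⟩) | ⟨i, hi, rfl⟩)
    · exact Or.inl (Or.inl hx)
    · exact Or.inl (Or.inr ⟨i + 1, Nat.succ_lt_succ hi, rfl⟩)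
    · exact Or.inr ⟨i + 1, Nat.succ_lt_succ hi, rfl⟩
  have hs0 : s 0 ∈ altSet A B s t (k + 1) := Or.inl (Or.inr ⟨0, Nat.succ_pos k, rfl⟩)
  have h01 := h.st_one
  have h10 := h.ts_zero
  have ss0 : ∀ i < k, adjF G (s 0) (s (i + 1)) = 0 := fun i hi => by
    rw [h.ss _ (by omega) _ (by omega) (by omega), hσ]
  have st0 : ∀ i < k, adjF G (s 0) (t (i + 1)) = 1 := fun i hi => by
    rw [h.st _ (by omega) _ (by omega), h01, if_pos (by omega)]
  have sinj : ∀ i < k, ∀ j < k, i ≠ j → s (i + 1) ≠ s (j + 1) := fun i hi j hj hij e => by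
    have := h.s_inj _ (by omega) _ (by omega) e; omega
  have tinj : ∀ i < k, ∀ j < k, i ≠ j → t (i + 1) ≠ t (j + 1) := fun i hi j hj hij e => by
    have := h.t_inj _ (by omega) _ (by omega) e; omega
  have nA : ∀ a ∈ A, ∀ i < k + 1, a ≠ s i ∧ a ≠ t i := fun a ha i hi =>
    ⟨fun e => h.s_notMem i hi (e ▸ Or.inl ha), fun e => h.t_notMem i hi (e ▸ Or.inl ha)⟩
  have nB : ∀ a ∈ B, ∀ i < k + 1, s i ≠ a ∧ t i ≠ a := fun a ha i hi =>
    ⟨fun e => h.s_notMem i hi (e ▸ Or.inr ha), fun e => h.t_notMem i hi (e ▸ Or.inr ha)⟩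
  have ab : ∀ a ∈ A, ∀ b ∈ B, adjF (localComplement G (s 0)) a b =
      dot (α a) (β b + dot σ (β b) • σ') := fun a ha b hb => by
    have hne : a ≠ b := fun e => h.disj a ha (e ▸ hb)
    rw [adjF_localComplement _ _ hne, h.ab a ha b hb, adjF_comm _ _ a,
      h.a_s a ha 0 (by omega), h.sb b hb 0 (by omega), dot_add, dot_smul]
    ring
  -- Because `dot σ σ' = 0`, the change of `β` is an involution of the plane, so spanning is
  -- preserved.
  have hspan : Spans (fun b => β b + dot σ (β b) • σ') B := by
    intro c hc
    have hz : c + dot σ' c • σ = 0 := h.spans_right _ fun b hb => by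
      have := hc b hb
      simp only [add_dot, smul_dot] at this
      rw [dot_add, dot_smul, dot_comm (β b) σ, mul_comm]
      exact this
    have h0 := congrArg (dot σ') hz
    rw [dot_add, dot_smul, dot_comm σ' σ, hσ, mul_zero, add_zero] at h0
    rw [h0] at hz
    simpa [dot] using hz
  have hr := not_rk_le_one_of_spans h.spans_left hspan ab
  refine ⟨?_, ?_, fun i hi j hj => h.s_ne_t _ (by omega) _ (by omega),
    fun i hi => h.s_notMem _ (by omega), fun i hi => h.t_notMem _ (by omega), h.disj,
    ?_, ?_, ?_, ab, ?_, ?_, ?_, ?_, ?_, ?_, h.spans_left, hspan, ?_, ?_, h.large_left,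
    h.large_right⟩
  · intro i hi j hj e
    by_contra hij
    exact sinj i hi j hj hij e
  · intro i hi j hj e
    by_contra hij
    exact tinj i hi j hj hij e
  · intro i hi j hj hij
    rw [adjF_localComplement _ _ (sinj i hi j hj hij), ss0 i hi, zero_mul, add_zero,
      h.ss _ (by omega) _ (by omega) (by omega)]
  · intro i hi j hj hij
    rw [adjF_localComplement _ _ (tinj i hi j hj hij), st0 i hi, st0 j hj,
      h.tt _ (by omega) _ (by omega) (by omega), dot_add, add_dot, add_dot, h01, h10, hσ]
    ring
  · intro i hi j hj
    rw [adjF_localComplement _ _ (h.s_ne_t _ (by omega) _ (by omega)), ss0 i hi, zero_mul, add_zero,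
      h.st _ (by omega) _ (by omega), dot_add, add_dot, hσ, add_zero, add_zero]
    exact if_congr (by omega) rfl rfl
  · intro a ha i hi
    rw [adjF_localComplement _ _ (nA a ha (i + 1) (by omega)).1, ss0 i hi, mul_zero, add_zero,
      h.a_s a ha _ (by omega)]
  · intro a ha i hi
    rw [adjF_localComplement _ _ (nA a ha (i + 1) (by omega)).2, st0 i hi, adjF_comm _ _ a,
      h.a_s a ha _ (by omega), h.a_t a ha _ (by omega), dot_add, mul_one]
  · intro b hb i hi
    rw [adjF_localComplement _ _ (nB b hb (i + 1) (by omega)).1, ss0 i hi, zero_mul,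
      h.sb b hb _ (by omega), dot_add, dot_smul, hσ, mul_zero]
  · intro b hb i hi
    rw [adjF_localComplement _ _ (nB b hb (i + 1) (by omega)).2, st0 i hi, h.sb b hb _ (by omega),
      h.tb b hb _ (by omega), dot_add, dot_smul, add_dot, add_dot, h10, hσ]
    ring
  · rw [dot_add, h01, hσ, add_zero]
  · rw [add_dot, h10, hσ, add_zero]
  · refine (h.robust_left.localComplement (left_subset_altSet _ _ _ _ _) hs0).subset hsub
      (left_subset_altSet _ _ _ _ _) ?_ fun hle => hr ((rk_mono _ subset_rfl fun b hb => ?_).trans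
        hle)
    · have hP := Part.diff (left_subset_altSet A B s t (k + 1))
      rw [rk_localComplement G hP.disjoint ((hP.mem_iff _).1 hs0)]
      exact h.rk_left
    · exact ⟨right_subset_altSet _ _ _ _ _ hb, fun ha => h.disj b ha hb⟩
  · refine (h.robust_right.localComplement (right_subset_altSet _ _ _ _ _) hs0).subset hsub
      (right_subset_altSet _ _ _ _ _) ?_ fun hle => hr (rk_le_comm (adjF_comm _)
        ((rk_mono _ subset_rfl fun a ha => ?_).trans hle))
    · have hP := Part.diff (right_subset_altSet A B s t (k + 1))
      rw [rk_localComplement G hP.disjoint ((hP.mem_iff _).1 hs0), ← altSet_reverse]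
      exact h.reverse.rk_left
    · exact ⟨left_subset_altSet _ _ _ _ _ ha, h.disj a ha⟩

/-- In the case `σ σ' = 1`, `τ τ' = 1` the configuration yields a cycle. -/
theorem Alternating.hasCyc_of_one_one {n : ℕ}
    (h : Alternating G A B α β σ σ' τ τ' s t (k + 2)) (hn : 3 ≤ n) (hnk : n ≤ 2 * k + 3)
    (hσ : dot σ σ' = 1) (hτ : dot τ τ' = 1) : HasCyc G n := by
  have ss0 : ∀ i < k + 1, adjF G (s 0) (s (i + 1)) = 1 := fun i hi => by
    rw [h.ss _ (by omega) _ (by omega) (by omega), hσ]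
  have st0 : ∀ i < k + 1, adjF G (s 0) (t i) = 1 := fun i hi => by
    rw [h.st _ (by omega) _ (by omega), h.st_one, if_pos (by omega)]
  have ns : ∀ i < k + 1, s 0 ≠ s (i + 1) := fun i hi e => by
    have := h.s_inj _ (by omega) _ (by omega) e; omega
  have nt : ∀ i < k + 1, s 0 ≠ t i := fun i hi => h.s_ne_t _ (by omega) _ (by omega)
  -- `s 0` sees all vertices involved, so complementing makes both cliques independent and reverses
  -- the half graph: `t i` is now adjacent to `s (j + 1)` exactly when `i ≤ j`.
  have hH : HalfGraph (localComplement G (s 0)) t (fun i => s (i + 1)) (k + 1) {s 0} (fun _ => 1)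
      fun _ => 1 := by
    refine ⟨fun i hi j hj e => h.t_inj _ (by omega) _ (by omega) e, fun i hi j hj e => ?_,
      fun i hi j hj e => h.s_ne_t _ (by omega) _ (by omega) e.symm, fun i hi => (nt i hi).symm,
      fun i hi => (ns i hi).symm, ?_, ?_, ?_, ?_, ?_⟩
    · have := h.s_inj _ (by omega) _ (by omega) e; omega
    · intro i hi j hj
      by_cases hij : i = j
      · rw [hij, adjF_self]
      · rw [adjF_localComplement _ _ fun e => hij (h.t_inj _ (by omega) _ (by omega) e), st0 i hi,
          st0 j hj, h.tt _ (by omega) _ (by omega) hij, hτ]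
        decide
    · intro i hi j hj
      by_cases hij : i = j
      · rw [hij, adjF_self]
      · rw [adjF_localComplement _ _ fun e => hij (by
          have := h.s_inj _ (by omega) _ (by omega) e; omega), ss0 i hi, ss0 j hj,
          h.ss _ (by omega) _ (by omega) (by omega), hσ]
        decide
    · intro i hi j hj
      rw [adjF_localComplement _ _ fun e => h.s_ne_t _ (by omega) _ (by omega) e.symm, st0 i hi,
        ss0 j hj, adjF_comm, h.st _ (by omega) _ (by omega), h.st_one, h.ts_zero]
      by_cases hij : i ≤ j
      · rw [if_pos hij, if_neg (by omega)]; decide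
      · rw [if_neg hij, if_pos (by omega)]; decide
    · rintro _ rfl i hi
      rw [adjF_localComplement _ _ (nt i hi).symm, adjF_self, mul_zero, add_zero, adjF_comm,
        st0 i hi]
    · rintro _ rfl i hi
      rw [adjF_localComplement _ _ (ns i hi).symm, adjF_self, mul_zero, add_zero, adjF_comm,
        ss0 i hi]
  obtain ⟨l, hl, hp, he, -⟩ := hH.exists_path
  have hloc : LocallyEquivalent G (l.foldl localComplement (localComplement G (s 0))) :=
    ⟨s 0 :: l, rfl⟩
  generalize l.foldl localComplement (localComplement G (s 0)) = H at *
  have hinj : ∀ i ≤ 2 * k + 1, ∀ j ≤ 2 * k + 1,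
      interleave t (fun i => s (i + 1)) i = interleave t (fun i => s (i + 1)) j → i = j := by
    intro i hi j hj e
    unfold interleave at e
    split_ifs at e
    · have := h.t_inj _ (by omega) _ (by omega) e; omega
    · exact absurd e.symm (h.s_ne_t _ (by omega) _ (by omega))
    · exact absurd e (h.s_ne_t _ (by omega) _ (by omega))
    · have := h.s_inj _ (by omega) _ (by omega) e; omega
  have hne : ∀ i ≤ 2 * k + 1, s 0 ≠ interleave t (fun i => s (i + 1)) i := by
    intro i hi
    unfold interleave
    split_ifs
    · exact nt _ (by omega)
    · exact ns _ (by omega)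
  have he' := he (s 0) rfl
  generalize interleave t (fun i => s (i + 1)) = q at *
  -- After the pivots `s 0` sees just the two ends of a path on `2 * k + 2` vertices, giving a cycle
  -- of length `2 * k + 3`.
  refine HasCyc.mono hn hnk ⟨H, fun i => if i ≤ 2 * k + 1 then q i else s 0, hloc, ?_, ?_⟩
  · intro i hi j hj e
    simp only at e
    split_ifs at e with h1 h2 h2
    · exact hinj i h1 j h2 e
    · exact absurd e.symm (hne i h1)
    · exact absurd e (hne j h2)
    · omega
  · intro i hi j hj
    simp only
    split_ifs with h1 h2 h2
    · rw [← adjF_eq_one, hp i h1 j h2]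
      split_ifs with hij
      · exact iff_of_true rfl (by omega)
      · exact iff_of_false (by decide) (by omega)
    · rw [← adjF_eq_one, adjF_comm, he' i h1]
      split_ifs with h3 h4
      · exact iff_of_true rfl (by omega)
      · exact iff_of_true rfl (by omega)
      · exact iff_of_false (by decide) (by omega)
    · rw [← adjF_eq_one, he' j h2]
      split_ifs with h3 h4
      · exact iff_of_true rfl (by omega)
      · exact iff_of_true rfl (by omega)
      · exact iff_of_false (by decide) (by omega)
    · exact iff_of_false (by simp) (by omega)

/-- The two products say whether the `s i` and the `t i` form cliques. One clique on the `t` side is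
removed by contracting `s 0`, one on the `s` side by reversing first, and two cliques are treated
directly. -/
theorem Alternating.hasCyc [Finite V] {n : ℕ}
    (h : Alternating G A B α β σ σ' τ τ' s t (k + 2)) (hn : 3 ≤ n) (hnk : n ≤ 2 * k + 3) :
    HasCyc G n := by
  have key : ∀ {G : SimpleGraph V} {A B : Set V} {α β : V → ZMod 2 × ZMod 2}
      {σ σ' τ τ' : ZMod 2 × ZMod 2} {s t : ℕ → V}, Alternating G A B α β σ σ' τ τ' s t (k + 2) →
      dot σ σ' = 0 → dot τ τ' = 1 → HasCyc G n := by
    intro G A B α β σ σ' τ τ' s t h h1 h2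
    refine HasCyc.of_locallyEquivalent (LocallyEquivalent.localComplement G (s 0))
      ((h.contract h1).hasCyc_of_zero_zero hn hnk h1 ?_)
    rw [dot_add, add_dot, add_dot, h1, h2, h.st_one, h.ts_zero]
    decide
  rcases zmod_two_cases (dot σ σ') with h1 | h1 <;> rcases zmod_two_cases (dot τ τ') with h2 | h2
  · exact h.hasCyc_of_zero_zero hn (by omega) h1 h2
  · exact key h h1 h2
  · exact key h.reverse (by rw [dot_comm, h2]) (by rw [dot_comm, h1])
  · exact h.hasCyc_of_one_one hn hnk h1 h2

end

/-! ### Coordinates on a chain and the pigeonhole argument -/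

section

variable {V : Type*}

/-- Fix a nonsingular `2 × 2` block inside `A × B`. Then `α x` is the row of `x` in its columns, and
`β y` is its inverse applied to the column of `y` in its rows. Any block of rank two containing it
is determined by these, so one choice of coordinates serves all partitions. -/
theorem exists_coordinates [Finite V] {G : SimpleGraph V} {A B : Set V}
    (h : ¬ rk (adjF G) A B ≤ 1) :
    ∃ α β : V → ZMod 2 × ZMod 2, Spans α A ∧ Spans β B ∧ ∀ X Y, A ⊆ X → B ⊆ Y →
      rk (adjF G) X Y ≤ 2 → ∀ x ∈ X, ∀ y ∈ Y, adjF G x y = dot (α x) (β y) := by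
  obtain ⟨a, ha, a', ha', b, hb, b', hb', hne⟩ := exists_minor_of_one_lt_rk h
  have sub1 : ∀ p q : ZMod 2, p ≠ q → p - q = 1 := by decide
  have hdet := sub1 _ _ hne
  refine ⟨fun x => (adjF G x b, adjF G x b'),
    fun y => (adjF G a' b' * adjF G a y - adjF G a b' * adjF G a' y,
      adjF G a b * adjF G a' y - adjF G a' b * adjF G a y), ?_, ?_, ?_⟩
  · intro c hc
    have h1 := hc a ha
    have h2 := hc a' ha'
    simp only [dot] at h1 h2
    ext
    · simp only [Prod.fst_zero]
      linear_combination adjF G a' b' * h1 - adjF G a b' * h2 - c.1 * hdet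
    · simp only [Prod.snd_zero]
      linear_combination adjF G a b * h2 - adjF G a' b * h1 - c.2 * hdet
  · intro c hc
    have h1 := hc b hb
    have h2 := hc b' hb'
    simp only [dot] at h1 h2
    ext
    · simp only [Prod.fst_zero]
      linear_combination h1 - c.1 * hdet
    · simp only [Prod.snd_zero]
      linear_combination h2 - c.2 * hdet
  · intro X Y hA hB hr x hx y hy
    obtain ⟨f, g, f', g', hfg⟩ := rk_le_two_iff.1 hr
    have e := fun u hu v hv => hfg u hu v hv
    simp only [dot]
    rw [hfg a (hA ha) b (hB hb), hfg a (hA ha) b' (hB hb'), hfg a' (hA ha') b (hB hb),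
      hfg a' (hA ha') b' (hB hb')] at hdet
    rw [hfg a (hA ha) b (hB hb), hfg a (hA ha) b' (hB hb'), hfg a' (hA ha') b (hB hb),
      hfg a' (hA ha') b' (hB hb'), hfg x hx b (hB hb), hfg x hx b' (hB hb'), hfg x hx y hy,
      hfg a (hA ha) y hy, hfg a' (hA ha') y hy]
    linear_combination -(f x * g y + f' x * g' y) * hdet

section

variable {G : SimpleGraph V} {U A B : Set V} {z : ℕ → V} {N : ℕ}

/-- Coordinates for the adjacencies of a chain. -/
structure Chain.Coord (G : SimpleGraph V) (A B : Set V) (z : ℕ → V) (N : ℕ)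
    (α β : V → ZMod 2 × ZMod 2) : Prop where
  spans_left : Spans α A
  spans_right : Spans β B
  ab : ∀ a ∈ A, ∀ b ∈ B, adjF G a b = dot (α a) (β b)
  az : ∀ a ∈ A, ∀ i < N, adjF G a (z i) = dot (α a) (β (z i))
  zz : ∀ i j, i < j → j < N → adjF G (z i) (z j) = dot (α (z i)) (β (z j))
  zb : ∀ b ∈ B, ∀ i < N, adjF G (z i) b = dot (α (z i)) (β b)

theorem Chain.exists_coord [Finite V] (h : Chain G U A B z N) :
    ∃ α β, Chain.Coord G A B z N α β := by
  obtain ⟨α, β, hα, hβ, hX⟩ := exists_coordinates h.linked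
  have hY : ∀ j ≤ N, ∀ x ∈ A ∪ z '' Set.Iio j, ∀ y ∈ U \ (A ∪ z '' Set.Iio j),
      adjF G x y = dot (α x) (β y) := by
    intro j hj
    refine hX _ _ (fun a ha => Or.inl ha) (fun b hb => ⟨(h.mem_iff b).2 (Or.inr (Or.inr hb)), ?_⟩)
      (h.tight j hj)
    rintro (ha | ⟨i, hi, rfl⟩)
    · exact h.disj b ha hb
    · exact (h.notMem i (lt_of_lt_of_le hi hj)).2 hb
  have hz : ∀ j < N, z j ∈ U \ (A ∪ z '' Set.Iio j) := by
    refine fun j hj => ⟨(h.mem_iff _).2 (Or.inr (Or.inl ⟨j, hj, rfl⟩)), ?_⟩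
    rintro (ha | ⟨i, hi, e⟩)
    · exact (h.notMem j hj).1 ha
    · simp only [Set.mem_Iio] at hi
      have := h.inj i (by omega) j hj e
      omega
  have hb : ∀ b ∈ B, b ∈ U \ (A ∪ z '' Set.Iio N) := by
    refine fun b hb => ⟨(h.mem_iff b).2 (Or.inr (Or.inr hb)), ?_⟩
    rintro (ha | ⟨i, hi, rfl⟩)
    · exact h.disj b ha hb
    · exact (h.notMem i hi).2 hb
  exact ⟨α, β, hα, hβ, fun a ha b hb' => hY N le_rfl a (Or.inl ha) b (hb b hb'),
    fun a ha i hi => hY i hi.le a (Or.inl ha) _ (hz i hi),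
    fun i j hij hj => hY j hj.le _ (Or.inr ⟨i, hij, rfl⟩) _ (hz j hj),
    fun b hb' i hi => hY N le_rfl _ (Or.inr ⟨i, hi, rfl⟩) b (hb b hb')⟩

set_option synthInstance.maxHeartbeats 400000 in
set_option synthInstance.maxSize 1000 in
/-- Three pairwise orthogonal vectors of the symplectic space of dimension four are dependent. -/
theorem exists_dependence_of_orthogonal : ∀ p p' q q' : ZMod 2 × ZMod 2, dot p q' = dot q p' →
    ∀ r r' : ZMod 2 × ZMod 2, dot p r' = dot r p' → dot q r' = dot r q' →
    ∃ x y w : ZMod 2, ¬ (x = 0 ∧ y = 0 ∧ w = 0) ∧ x • p + y • q + w • r = 0 ∧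
      x • p' + y • q' + w • r' = 0 := by
  decide +kernel

/-- If all pairs of the window commuted, the vectors `(α, β)` would be pairwise orthogonal for the
symplectic form on `𝔽₂⁴`, and any three of them dependent. The dependence passes to rows of the
adjacency matrix, against the window property. -/
theorem Chain.exists_noncommuting [Finite V] (h : Chain G U A B z N)
    {α β : V → ZMod 2 × ZMod 2} (hc : Chain.Coord G A B z N α β) {j : ℕ} (hj : j + 30 ≤ N) :
    ∃ i k, j ≤ i ∧ i < k ∧ k < j + 30 ∧
      dot (α (z i)) (β (z k)) ≠ dot (α (z k)) (β (z i)) := by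
  by_contra! hcom
  have com : ∀ i k, j ≤ i → i < j + 30 → j ≤ k → k < j + 30 →
      dot (α (z i)) (β (z k)) = dot (α (z k)) (β (z i)) := by
    intro i k h1 h2 h3 h4
    rcases Nat.lt_trichotomy i k with hik | rfl | hik
    · exact hcom i k h1 hik h4
    · rfl
    · exact (hcom k i h3 hik h2).symm
  -- Each column is linear in `α` or in `β`, according to whether `v` comes after or before; inside
  -- the window commutation makes the order irrelevant.
  have row : ∀ v ∈ U, (∃ d, ∀ i, j ≤ i → i < j + 30 → z i ≠ v → adjF G (z i) v = dot d (β (z i))) ∨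
      ∃ d, ∀ i, j ≤ i → i < j + 30 → z i ≠ v → adjF G (z i) v = dot (α (z i)) d := by
    intro v hv
    rcases (h.mem_iff v).1 hv with hv | ⟨m, hm, rfl⟩ | hv
    · exact Or.inl ⟨α v, fun i h1 h2 _ => by rw [adjF_comm, hc.az v hv i (by omega)]⟩
    · rcases Nat.lt_or_ge m j with hmj | hmj
      · exact Or.inl ⟨α (z m), fun i h1 h2 _ => by
          rw [adjF_comm, hc.zz m i (by omega) (by omega)]⟩
      · refine Or.inr ⟨β (z m), fun i h1 h2 hne => ?_⟩
        rcases Nat.lt_trichotomy i m with him | rfl | him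
        · exact hc.zz i m him hm
        · exact absurd rfl hne
        · rw [adjF_comm, hc.zz m i him (by omega)]
          exact com m i hmj (by omega) h1 h2
    · exact Or.inr ⟨β v, fun i h1 h2 _ => hc.zb v hv i (by omega)⟩
  obtain ⟨a, b, c, ha, ha', hb, hb', hc1, hc2, hab, hac, hbc, hrk⟩ := h.window j hj
  obtain ⟨x, y, w, hne, h1, h2⟩ := exists_dependence_of_orthogonal _ _ _ _
    (com a b ha ha' hb hb') _ _ (com a c ha ha' hc1 hc2) (com b c hb hb' hc1 hc2)
  refine hrk (rk_le_two_of_dependent (fun e => hab (h.inj _ (by omega) _ (by omega) e))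
    (fun e => hac (h.inj _ (by omega) _ (by omega) e))
    (fun e => hbc (h.inj _ (by omega) _ (by omega) e)) hne ?_)
  rintro v ⟨hvU, hv⟩
  simp only [Set.mem_insert_iff, Set.mem_singleton_iff, not_or] at hv
  rcases row v hvU with ⟨d, hd⟩ | ⟨d, hd⟩
  · rw [hd a ha ha' (Ne.symm hv.1), hd b hb hb' (Ne.symm hv.2.1), hd c hc1 hc2 (Ne.symm hv.2.2)]
    have := congrArg (dot d) h2
    simp only [dot_add, dot_smul] at this
    rw [this]
    simp [dot]
  · rw [hd a ha ha' (Ne.symm hv.1), hd b hb hb' (Ne.symm hv.2.1), hd c hc1 hc2 (Ne.symm hv.2.2)]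
    have := congrArg (fun v => dot v d) h1
    simp only [add_dot, smul_dot] at this
    rw [this]
    simp [dot]

theorem Chain.alternating [Finite V] (h : Chain G U A B z N) {α β : V → ZMod 2 × ZMod 2}
    (hc : Chain.Coord G A B z N α β) {σ σ' τ τ' : ZMod 2 × ZMod 2} {u v : ℕ → ℕ} {k : ℕ}
    (huv : ∀ i < k, u i < v i ∧ v i < N) (hvu : ∀ i < k, ∀ j < k, i < j → v i < u j)
    (hu : ∀ i < k, α (z (u i)) = σ ∧ β (z (u i)) = σ')
    (hv : ∀ i < k, α (z (v i)) = τ ∧ β (z (v i)) = τ') (h1 : dot σ τ' = 1) (h0 : dot τ σ' = 0) :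
    Alternating G A B α β σ σ' τ τ' (fun i => z (u i)) (fun i => z (v i)) k := by
  have hsub : altSet A B (fun i => z (u i)) (fun i => z (v i)) k ⊆ U := by
    rintro x (((hx | hx) | ⟨i, hi, rfl⟩) | ⟨i, hi, rfl⟩)
    · exact (h.mem_iff x).2 (Or.inl hx)
    · exact (h.mem_iff x).2 (Or.inr (Or.inr hx))
    · have := huv i hi
      exact (h.mem_iff _).2 (Or.inr (Or.inl ⟨_, by omega, rfl⟩))
    · have := huv i hi
      exact (h.mem_iff _).2 (Or.inr (Or.inl ⟨_, by omega, rfl⟩))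
  have hnot : ∀ i < N, z i ∉ A ∪ B := fun i hi hm => hm.elim (h.notMem i hi).1 (h.notMem i hi).2
  refine ⟨?_, ?_, ?_, fun i hi => hnot _ (by have := huv i hi; omega),
    fun i hi => hnot _ (huv i hi).2, h.disj, ?_, ?_, ?_, hc.ab, ?_, ?_, ?_, ?_, h1, h0,
    hc.spans_left, hc.spans_right, ?_, ?_, h.large_left, h.large_right⟩
  · intro i hi j hj e
    have h1 := huv i hi
    have h2 := huv j hj
    have := h.inj _ (by omega) _ (by omega) e
    rcases Nat.lt_trichotomy i j with hij | hij | hij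
    · have := hvu i hi j hj hij; omega
    · exact hij
    · have := hvu j hj i hi hij; omega
  · intro i hi j hj e
    have h1 := huv i hi
    have h2 := huv j hj
    have := h.inj _ (by omega) _ (by omega) e
    rcases Nat.lt_trichotomy i j with hij | hij | hij
    · have := hvu i hi j hj hij; omega
    · exact hij
    · have := hvu j hj i hi hij; omega
  · intro i hi j hj e
    have h1 := huv i hi
    have h2 := huv j hj
    have := h.inj _ (by omega) _ (by omega) e
    rcases Nat.lt_trichotomy i j with hij | rfl | hij
    · have := hvu i hi j hj hij; omega
    · omega
    · have := hvu j hj i hi hij; omega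
  · intro i hi j hj hij
    have h1 := huv i hi
    have h2 := huv j hj
    rcases Nat.lt_or_gt_of_ne hij with hij | hij
    · have := hvu i hi j hj hij
      rw [hc.zz _ _ (by omega) (by omega), (hu i hi).1, (hu j hj).2]
    · have := hvu j hj i hi hij
      rw [adjF_comm, hc.zz _ _ (by omega) (by omega), (hu j hj).1, (hu i hi).2]
  · intro i hi j hj hij
    have h1 := huv i hi
    have h2 := huv j hj
    rcases Nat.lt_or_gt_of_ne hij with hij | hij
    · have := hvu i hi j hj hij
      rw [hc.zz _ _ (by omega) (by omega), (hv i hi).1, (hv j hj).2]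
    · have := hvu j hj i hi hij
      rw [adjF_comm, hc.zz _ _ (by omega) (by omega), (hv j hj).1, (hv i hi).2]
  · intro i hi j hj
    have h1 := huv i hi
    have h2 := huv j hj
    split_ifs with hij
    · have : u i < v j := by
        rcases hij.lt_or_eq with hij | rfl
        · have := hvu i hi j hj hij; omega
        · exact h1.1
      rw [hc.zz _ _ this (by omega), (hu i hi).1, (hv j hj).2]
    · have := hvu j hj i hi (by omega)
      rw [adjF_comm, hc.zz _ _ this (by omega), (hv j hj).1, (hu i hi).2]
  · intro a ha i hi
    rw [hc.az a ha _ (by have := huv i hi; omega), (hu i hi).2]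
  · intro a ha i hi
    rw [hc.az a ha _ (by have := huv i hi; omega), (hv i hi).2]
  · intro a ha i hi
    rw [hc.zb a ha _ (by have := huv i hi; omega), (hu i hi).1]
  · intro a ha i hi
    rw [hc.zb a ha _ (by have := huv i hi; omega), (hv i hi).1]
  · refine h.robust_left.subset hsub (left_subset_altSet _ _ _ _ _) ?_ fun hle =>
      h.linked ((rk_mono _ subset_rfl fun b hb => ?_).trans hle)
    · have := h.tight 0 (Nat.zero_le _)
      simpa using this
    · exact ⟨right_subset_altSet _ _ _ _ _ hb, fun ha => h.disj b ha hb⟩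
  · refine h.robust_right.subset hsub (right_subset_altSet _ _ _ _ _) ?_ fun hle =>
      h.linked (rk_le_comm (adjF_comm _) ((rk_mono _ subset_rfl fun a ha => ?_).trans hle))
    · have e : U \ (A ∪ z '' Set.Iio N) = B := by
        ext x
        constructor
        · rintro ⟨hx, hn⟩
          rcases (h.mem_iff x).1 hx with hx | ⟨i, hi, rfl⟩ | hx
          · exact absurd (Or.inl hx) hn
          · exact absurd (Or.inr ⟨i, hi, rfl⟩) hn
          · exact hx
        · refine fun hb => ⟨(h.mem_iff x).2 (Or.inr (Or.inr hb)), ?_⟩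
          rintro (ha | ⟨i, hi, rfl⟩)
          · exact h.disj x ha hb
          · exact (h.notMem i hi).2 hb
      have e' : A ∪ z '' Set.Iio N ⊆ U := by
        rintro x (hx | ⟨i, hi, rfl⟩)
        · exact (h.mem_iff x).2 (Or.inl hx)
        · exact (h.mem_iff _).2 (Or.inr (Or.inl ⟨i, hi, rfl⟩))
      have := h.tight N le_rfl
      rw [e] at this
      have hP := Part.diff e'
      rw [e] at hP
      rw [hP.symm.diff_eq]
      exact rk_le_comm (adjF_comm _) this
    · exact ⟨left_subset_altSet _ _ _ _ _ ha, h.disj a ha⟩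

theorem Chain.hasCyc [Finite V] (h : Chain G U A B z N) {n : ℕ} (hn : 3 ≤ n)
    (hN : 30 * (256 * (n / 2 + 1) + 1) ≤ N) : HasCyc G n := by
  obtain ⟨α, β, hc⟩ := h.exists_coord
  -- The type of a pair consists of four vectors of a plane with four elements, so there are `4 ^ 4
  -- = 256` types, and some type occurs in `n / 2 + 2` windows.
  set M := 256 * (n / 2 + 1) + 1 with hM
  have hex : ∀ m : Fin M, ∃ i k, 30 * (m : ℕ) ≤ i ∧ i < k ∧ k < 30 * (m : ℕ) + 30 ∧
      dot (α (z i)) (β (z k)) ≠ dot (α (z k)) (β (z i)) := fun m =>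
    h.exists_noncommuting hc (by have := m.2; omega)
  choose i k hi hik hk hne using hex
  obtain ⟨⟨⟨σ, σ'⟩, τ, τ'⟩, -, hcard⟩ := Finset.exists_lt_card_fiber_of_mul_lt_card_of_maps_to
    (s := Finset.univ) (t := Finset.univ) (n := n / 2 + 1)
    (f := fun m => ((α (z (i m)), β (z (i m))), (α (z (k m)), β (z (k m)))))
    (fun _ _ => Finset.mem_univ _) (by
      simp only [Finset.card_univ, Fintype.card_prod, ZMod.card, Fintype.card_fin]
      omega)
  obtain ⟨S, hS, hSc⟩ := Finset.exists_subset_card_eq hcard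
  have hlet : ∀ m ∈ S, (α (z (i m)) = σ ∧ β (z (i m)) = σ') ∧
      (α (z (k m)) = τ ∧ β (z (k m)) = τ') := by
    intro m hm
    have := (Finset.mem_filter.1 (hS hm)).2
    simpa only [Prod.mk.injEq] using this
  let e := S.orderEmbOfFin hSc
  -- The default value outside the range is never used.
  let e' : ℕ → Fin M := fun j => if hj : j < n / 2 + 1 + 1 then e ⟨j, hj⟩ else ⟨0, by omega⟩
  have he' : ∀ j < n / 2 + 2, e' j ∈ S := by
    intro j hj
    simp only [e', dif_pos (show j < n / 2 + 1 + 1 by omega)]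
    exact S.orderEmbOfFin_mem hSc _
  have hmono : ∀ j l, j < l → l < n / 2 + 2 → (e' j : ℕ) < e' l := by
    intro j l hjl hl
    simp only [e', dif_pos (show j < n / 2 + 1 + 1 by omega),
      dif_pos (show l < n / 2 + 1 + 1 by omega)]
    exact e.strictMono (Fin.mk_lt_mk.2 hjl)
  have hlt : ∀ m, k m < N := fun m => by have := hk m; have := m.2; omega
  have hlt' : ∀ j l, j < l → l < n / 2 + 2 → k (e' j) < i (e' l) := by
    intro j l hjl hl
    have h1 := hmono j l hjl hl
    have h2 := hk (e' j)
    have h3 := hi (e' l)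
    omega
  have hl := fun j hj => hlet (e' j) (he' j hj)
  have hne0 : dot σ τ' ≠ dot τ σ' := by
    have := hne (e' 0)
    rw [(hl 0 (by omega)).1.1, (hl 0 (by omega)).1.2, (hl 0 (by omega)).2.1,
      (hl 0 (by omega)).2.2] at this
    exact this
  obtain ⟨l, hl2⟩ : ∃ l, n / 2 = l + 1 := ⟨n / 2 - 1, by omega⟩
  rcases zmod_two_cases (dot σ τ') with h0 | h1
  · have h1 : dot τ σ' = 1 := (zmod_two_cases _).resolve_left fun h => hne0 (h0.trans h.symm)
    -- Here the form is one in the wrong order, so the second vertex of each pair is matched with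
    -- the first vertex of the next pair. This consumes the one additional window.
    refine (h.alternating hc (σ := τ) (σ' := τ') (τ := σ) (τ' := σ') (u := fun j => k (e' j))
      (v := fun j => i (e' (j + 1))) (k := l + 2) ?_ ?_ ?_ ?_ h1 h0).hasCyc hn (by omega)
    · exact fun j hj => ⟨hlt' _ _ (by omega) (by omega), (hik _).trans (hlt _)⟩
    · intro j hj j' hj' hjj
      have := hik (e' (j + 1))
      rcases (show j + 1 ≤ j' by omega).lt_or_eq with h2 | h2
      · have h3 := hlt' (j + 1) j' h2 (by omega)
        have h4 := hik (e' j')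
        omega
      · subst h2; exact this
    · exact fun j hj => (hl j (by omega)).2
    · exact fun j hj => (hl (j + 1) (by omega)).1
  · have h0 : dot τ σ' = 0 := (zmod_two_cases _).resolve_right fun h => hne0 (h1.trans h.symm)
    refine (h.alternating hc (u := fun j => i (e' j))
      (v := fun j => k (e' j)) (k := l + 2) ?_ ?_ ?_ ?_ h1 h0).hasCyc hn (by omega)
    · exact fun j hj => ⟨hik _, hlt _⟩
    · exact fun j hj j' hj' hjj => hlt' _ _ hjj (by omega)
    · exact fun j hj => (hl j (by omega)).1
    · exact fun j hj => (hl j (by omega)).2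

end

end

/-! ### Counting along the path and conclusion -/

section

variable {V : Type*}

theorem PathState.hasCyc [Finite V] {G : SimpleGraph V} {p : ℕ → V} {r n : ℕ} {W : Set V}
    (h : PathState G p r W) (hn : 3 ≤ n) (hW : 30 * (256 * (n / 2 + 1) + 1) + 2 ≤ W.ncard) :
    HasCyc G n := by
  obtain ⟨G₁, p₁, r₁, hG₁, h₁, ht⟩ := PathState.exists_all_tight r h
  obtain ⟨G₂, U, A, B, z, N, hG₂, hC, hN⟩ := h₁.exists_chain ((Nat.le_add_left _ _).trans hW) ht
  have key : ∀ C w N : ℕ, C + 2 ≤ w → w ≤ N + 2 → C ≤ N := by omega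
  exact HasCyc.of_locallyEquivalent (hG₁.trans hG₂) (hC.hasCyc hn (key _ _ _ hW hN))

theorem IsPrime.linked [Finite V] {G : SimpleGraph V} (hG : IsPrime G) {A B : Set V}
    (hA : A.Nontrivial) (hB : B.Nontrivial) : Linked G Set.univ A B := by
  intro X Y hX hY hP hr
  obtain ⟨f, g, hfg⟩ := rk_le_one_iff.1 hr
  refine hG X Y ⟨hP.disjoint, Set.eq_univ_of_forall fun x => (hP.mem_iff x).1 trivial,
    hA.mono hX, hB.mono hY, {x ∈ X | f x = 1}, fun x hx => hx.1, {y ∈ Y | g y = 1},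
    fun y hy => hy.1, fun x hx y hy => ?_⟩
  rw [← adjF_eq_one, hfg x hx y hy]
  have key : ∀ u v : ZMod 2, u * v = 1 ↔ u = 1 ∧ v = 1 := by decide
  rw [key]
  exact ⟨fun h => ⟨⟨hx, h.1⟩, hy, h.2⟩, fun h => ⟨h.1.2, h.2.2⟩⟩

/-- `W` is a minimal set of off-path vertices that keeps the ends linked; all of them together do,
by primality. -/
theorem exists_pathState [Finite V] {G : SimpleGraph V} (hG : IsPrime G) {p : ℕ → V} {r : ℕ}
    (hp : IsPath G p r) (hr : 3 ≤ r) : ∃ W, PathState G p r W := by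
  have hA : ({p 0, p 1} : Set V).Nontrivial :=
    Set.nontrivial_pair ((hp.ne_iff (by omega) (by omega)).2 (by omega))
  have hB : ({p (r - 1), p r} : Set V).Nontrivial :=
    Set.nontrivial_pair ((hp.ne_iff (by omega) (by omega)).2 (by omega))
  obtain ⟨W, ⟨hW, hL⟩, hmin⟩ := exists_minimal_of_wellFoundedLT
    (fun W : Set V => (∀ i ≤ r, p i ∉ W) ∧
      Linked G (W ∪ p '' Set.Iic r) {p 0, p 1} {p (r - 1), p r})
    ⟨(p '' Set.Iic r)ᶜ, fun i hi hm => hm ⟨i, hi, rfl⟩, by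
      rw [Set.compl_union_self]; exact hG.linked hA hB⟩
  refine ⟨W, hp, hr, hW, hL, fun w hw hL' => ?_⟩
  have e : (W ∪ p '' Set.Iic r) \ {w} = (W \ {w}) ∪ p '' Set.Iic r := by
    ext x
    by_cases hx : x = w
    · subst hx
      have : x ∉ p '' Set.Iic r := by
        rintro ⟨i, hi, rfl⟩
        exact hW i hi hw
      simp only [Set.mem_sdiff, Set.mem_union, Set.mem_singleton_iff, not_true_eq_false,
        and_false, false_or, false_iff]
      exact this
    · simp [hx]
  rw [e] at hL'
  exact (hmin ⟨fun i hi hm => hW i hi hm.1, hL'⟩ Set.sdiff_subset hw).2 rfl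

/-- Without the cycle, every stretch of the path has an inner vertex with a neighbour outside the
path. -/
theorem PathState.exists_adj [Finite V] {G : SimpleGraph V} {p : ℕ → V} {r n a : ℕ} {W : Set V}
    (h : PathState G p r W) (hn : 3 ≤ n) (hc : ¬ HasCyc G n) (ha : 1 ≤ a) (har : a + n ≤ r + 1) :
    ∃ i, a < i ∧ i < a + (n - 2) ∧ ∃ w ∈ W, G.Adj w (p i) := by
  classical
  by_contra! hno
  obtain ⟨b, hb⟩ : ∃ b, b = a + (n - 2) := ⟨_, rfl⟩
  rw [← hb] at hno
  have hbr : b + 1 ≤ r := by omega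
  have hinj := h.path.1
  have hadj := h.path.2
  have hN : ∀ j ≤ r, (j < a ∨ b < j) → p j ∈ (W ∪ p '' Set.Iic r) \ p '' Set.Icc a b := by
    intro j hj hjab
    refine ⟨h.mem hj, ?_⟩
    rintro ⟨i, hi, e⟩
    simp only [Set.mem_Icc] at hi
    have := hinj i (by omega) j hj e
    omega
  have hint : ∀ i, a < i → i < b → ∀ y ∈ (W ∪ p '' Set.Iic r) \ p '' Set.Icc a b,
      ¬ G.Adj (p i) y := by
    rintro i hi hib y ⟨hy | ⟨j, hj, rfl⟩, hy'⟩ hadj'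
    · exact hno i hi hib y hy hadj'.symm
    · simp only [Set.mem_Iic] at hj
      have := (hadj i (by omega) j hj).1 hadj'
      exact hy' ⟨j, by simp only [Set.mem_Icc]; omega, rfl⟩
  -- The detour may use everything except the stretch itself, including the rest of the path.
  rcases hasCyc_or_separated (p := fun i => p (a + i)) (r := n - 2)
    (N := (W ∪ p '' Set.Iic r) \ p '' Set.Icc a b) hn (by omega) (by omega)
    ⟨fun i hi j hj e => by have := hinj _ (by omega) _ (by omega) e; omega,
      fun i hi j hj => by rw [hadj _ (by omega) _ (by omega)]; omega⟩
    (fun i hi hm => hm.2 ⟨a + i, by simp only [Set.mem_Icc]; omega, rfl⟩)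
    (fun i hi hi' y hy => hint _ (by omega) (by omega) y hy) with hcyc | ⟨K, hKN, hK0, hKc, hKr⟩
  · exact hc hcyc
  simp only [add_zero, ← hb] at hK0 hKr
  have hlow : ∀ j, j < a → p (a - 1 - j) ∈ K := by
    intro j
    induction j with
    | zero =>
      intro hj
      exact hK0 _ (hN _ (by omega) (by omega)) ((hadj _ (by omega) _ (by omega)).2 (by omega))
    | succ j ih =>
      intro hj
      exact hKc _ (ih (by omega)) _ (hN _ (by omega) (by omega))
        ((hadj _ (by omega) _ (by omega)).2 (by omega))
  have hhigh : ∀ j, b + 1 + j ≤ r → p (b + 1 + j) ∉ K := by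
    intro j
    induction j with
    | zero =>
      intro hj hm
      exact hKr _ hm ((hadj _ (by omega) _ (by omega)).2 (by omega))
    | succ j ih =>
      intro hj hm
      exact ih (by omega) (hKc _ hm _ (hN _ (by omega) (by omega))
        ((hadj _ (by omega) _ (by omega)).2 (by omega)))
  have hKlow : ∀ j < a, p j ∈ K := fun j hj => by
    have := hlow (a - 1 - j) (by omega)
    rwa [show a - 1 - (a - 1 - j) = j by omega] at this
  have hKhigh : ∀ j ≤ r, b < j → p j ∉ K := fun j hj hbj => by
    have := hhigh (j - b - 1) (by omega)
    rwa [show b + 1 + (j - b - 1) = j by omega] at this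
  have hXU : K ∪ p '' Set.Ico a b ⊆ W ∪ p '' Set.Iic r := by
    rintro x (hx | ⟨i, hi, rfl⟩)
    · exact (hKN hx).1
    · simp only [Set.mem_Ico] at hi
      exact h.mem (by omega)
  have hend : ∀ j ≤ r, b ≤ j → p j ∉ K ∪ p '' Set.Ico a b := by
    rintro j hj hbj (hm | ⟨i, hi, e⟩)
    · rcases hbj.lt_or_eq with hlt | rfl
      · exact hKhigh j hj hlt hm
      · exact (hKN hm).2 ⟨b, by simp only [Set.mem_Icc]; omega, rfl⟩
    · simp only [Set.mem_Ico] at hi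
      have := hinj i (by omega) j hj e
      omega
  refine h.linked (K ∪ p '' Set.Ico a b) _ ?_ ?_ (Part.diff hXU) ?_
  · rintro x (rfl | rfl)
    · exact Or.inl (hKlow 0 (by omega))
    · rcases ha.lt_or_eq with h1 | rfl
      · exact Or.inl (hKlow 1 h1)
      · exact Or.inr ⟨1, by simp only [Set.mem_Ico]; omega, rfl⟩
  · rintro x (rfl | rfl)
    · exact ⟨h.mem (by omega), hend _ (by omega) (by omega)⟩
    · exact ⟨h.mem (by omega), hend _ (by omega) (by omega)⟩
  -- Between `K ∪ {p a, …, p (b - 1)}` and the rest the only edge is the one joining `p (b - 1)` to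
  -- `p b`.
  · refine rk_le_one_iff.2 ⟨fun x => if x = p (b - 1) then 1 else 0,
      fun y => if y = p b then 1 else 0, ?_⟩
    rintro x hx y ⟨hyU, hyX⟩
    have hyK : y ∉ K := fun hm => hyX (Or.inl hm)
    by_cases hyb : y = p b
    · subst hyb
      beta_reduce
      rw [if_pos rfl, mul_one]
      rcases hx with hx | ⟨i, hi, rfl⟩
      · have hne : x ≠ p (b - 1) := by
          rintro rfl
          exact (hKN hx).2 ⟨b - 1, by simp only [Set.mem_Icc]; omega, rfl⟩
        rw [if_neg hne]
        exact adjF_eq_zero.2 (hKr x hx)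
      · simp only [Set.mem_Ico] at hi
        split_ifs with e
        · have := hinj i (by omega) _ (by omega) e
          exact adjF_eq_one.2 ((hadj _ (by omega) _ (by omega)).2 (by omega))
        · have : i ≠ b - 1 := fun e' => e (by rw [e'])
          exact adjF_eq_zero.2 fun hh => by
            have := (hadj _ (by omega) _ (by omega)).1 hh
            omega
    · beta_reduce
      rw [if_neg hyb, mul_zero]
      have hyN : y ∈ (W ∪ p '' Set.Iic r) \ p '' Set.Icc a b := by
        refine ⟨hyU, ?_⟩
        rintro ⟨i, hi, rfl⟩
        simp only [Set.mem_Icc] at hi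
        rcases hi.2.lt_or_eq with h1 | rfl
        · exact hyX (Or.inr ⟨i, by simp only [Set.mem_Ico]; omega, rfl⟩)
        · exact hyb rfl
      rw [adjF_eq_zero]
      intro hh
      rcases hx with hx | ⟨i, hi, rfl⟩
      · exact hyK (hKc x hx y hyN hh)
      · simp only [Set.mem_Ico] at hi
        rcases hi.1.lt_or_eq with h1 | rfl
        · exact hint i h1 hi.2 y hyN hh
        · exact hyK (hK0 y hyN hh)

theorem PathState.card_bound [Finite V] {G : SimpleGraph V} {p : ℕ → V} {r n m t : ℕ} {W : Set V}
    (h : PathState G p r W) (hn : 3 ≤ n) (hc : ¬ HasCyc G n) (ht : n ≤ 3 + 2 * t)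
    (hm : m * (n - 3) + 3 ≤ r) : m ≤ (1 + 3 * t) * W.ncard := by
  classical
  -- Stretches have `n - 3` inner vertices and start `n - 3` apart, so the selected vertices `i j`
  -- are distinct.
  have hex : ∀ j : Fin m, ∃ i, 1 + j * (n - 3) < i ∧ i < 1 + j * (n - 3) + (n - 2) ∧
      ∃ w ∈ W, G.Adj w (p i) := by
    intro j
    refine h.exists_adj hn hc (by omega) ?_
    have : (j + 1 : ℕ) * (n - 3) ≤ m * (n - 3) := Nat.mul_le_mul_right _ j.2
    rw [Nat.add_mul, one_mul] at this
    omega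
  choose i hi1 hi2 w hwW hadj using hex
  have hlt : ∀ j l : Fin m, j < l → i j < i l := by
    intro j l hjl
    have : (j + 1 : ℕ) * (n - 3) ≤ l * (n - 3) := Nat.mul_le_mul_right _ hjl
    rw [Nat.add_mul, one_mul] at this
    have h1 := hi2 j
    have h2 := hi1 l
    omega
  have hiinj : Function.Injective i := by
    intro j l e
    rcases lt_trichotomy j l with hjl | hjl | hjl
    · have := hlt _ _ hjl; omega
    · exact hjl
    · have := hlt _ _ hjl; omega
  have hir : ∀ j, i j ≤ r := by
    intro j
    have : (j + 1 : ℕ) * (n - 3) ≤ m * (n - 3) := Nat.mul_le_mul_right _ j.2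
    rw [Nat.add_mul, one_mul] at this
    have := hi2 j
    omega
  -- A vertex of `W` chosen for `2 + 3 * t` stretches would be the hub of a fan that yields the
  -- cycle.
  have hfib := Finset.card_le_mul_card_image (f := w) (Finset.univ : Finset (Fin m)) (1 + 3 * t) (by
    intro v hv
    obtain ⟨j₀, -, rfl⟩ := Finset.mem_image.1 hv
    by_contra! hlt'
    refine hc (hasCyc_of_fan hn ht r G p (w j₀) h.path
      (fun i hi e => h.notMem i hi (e ▸ hwW j₀)) ?_)
    refine le_trans (b := (Finset.univ.filter fun j => w j = w j₀).card) (by omega)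
      (Finset.card_le_card_of_injOn i ?_ hiinj.injOn)
    intro j hj
    simp only [Finset.coe_filter, Finset.mem_univ, true_and, Set.mem_ofPred_eq] at hj
    simp only [Finset.coe_filter, Finset.mem_range, Set.mem_ofPred_eq]
    exact ⟨by have := hir j; omega, hj ▸ hadj j⟩)
  rw [Finset.card_univ, Fintype.card_fin] at hfib
  refine hfib.trans (Nat.mul_le_mul_left _ ?_)
  rw [← Set.ncard_coe_finset]
  refine Set.ncard_le_ncard ?_ (Set.toFinite _)
  intro v hv
  obtain ⟨j, -, rfl⟩ := Finset.mem_image.1 (Finset.mem_coe.1 hv)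
  exact hwW j

/-- Without the cycle, `W` is bounded linearly in `n`, hence so is the number of fan edges per
vertex times `W` quadratically, and the path length cubically. The constants are such that `27 * n ^
7 ≤ 4 * r` suffices from `n = 4` on. -/
theorem hasCyc_of_isPath [Finite V] {G : SimpleGraph V} (hG : IsPrime G) {n r : ℕ} (hn : 3 ≤ n)
    {p : ℕ → V} (hp : IsPath G p r) (hr : 27 * n ^ 7 ≤ 4 * r) : HasCyc G n := by
  have h3 : 3 ≤ r := by
    have : 3 ^ 7 ≤ n ^ 7 := Nat.pow_le_pow_left hn 7
    omega
  obtain ⟨W, h⟩ := exists_pathState hG hp h3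
  by_contra hc
  rcases hn.lt_or_eq with hn4 | rfl
  · have hW : W.ncard ≤ 30 * (256 * (n / 2 + 1) + 1) + 1 := by
      have key : ∀ C w : ℕ, ¬ w ≤ C + 1 → C + 2 ≤ w := by omega
      by_contra hW
      exact hc (h.hasCyc hn (key _ _ hW))
    obtain ⟨d, rfl⟩ : ∃ d, n = d + 4 := ⟨n - 4, by omega⟩
    -- The least `t` with `n ≤ 3 + 2 * t`.
    set t := (d + 4 - 2) / 2 with ht
    have hb := h.card_bound (m := (1 + 3 * t) * W.ncard + 1) (t := t) hn hc (by omega) ?_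
    · omega
    have e : d + 4 - 3 = d + 1 := by omega
    rw [e]
    have h1 : 2 * (1 + 3 * t) ≤ 3 * d + 8 := by omega
    have h2 : W.ncard ≤ 3840 * d + 23071 := by
      have := Nat.mul_div_le (d + 4) 2
      linarith
    have h4 := Nat.mul_le_mul h1 h2
    have h5 := Nat.mul_le_mul_right (d + 1) h4
    have e7 : (d + 4) ^ 7 = d ^ 7 + 28 * d ^ 6 + 336 * d ^ 5 + 2240 * d ^ 4 + 8960 * d ^ 3 +
      21504 * d ^ 2 + 28672 * d + 16384 := by ring
    rw [e7] at hr
    have e8 : (3 * d + 8) * (3840 * d + 23071) * (d + 1) = 11520 * d ^ 3 + 111453 * d ^ 2 +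
      284501 * d + 184568 := by ring
    rw [e8] at h5
    have e9 : 2 * (1 + 3 * t) * W.ncard * (d + 1) = 2 * ((1 + 3 * t) * W.ncard * (d + 1)) := by ring
    rw [e9] at h5
    rw [Nat.add_mul, one_mul]
    -- After expansion in `d = n - 4` the inequality holds coefficient by coefficient, so the powers
    -- of `d` may be treated as independent natural numbers.
    generalize (1 + 3 * t) * W.ncard * (d + 1) = Q at *
    generalize d ^ 7 = d7 at *
    generalize d ^ 6 = d6 at *
    generalize d ^ 5 = d5 at *
    generalize d ^ 4 = d4 at *
    generalize d ^ 3 = d3 at *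
    generalize d ^ 2 = d2 at *
    omega
  -- For `n = 3` a stretch is a single edge and has no inner vertex at all.
  · obtain ⟨i, hi1, hi2, -⟩ := h.exists_adj le_rfl hc (a := 1) le_rfl (by omega)
    omega

theorem HasInducedPath.exists_isPath {G : SimpleGraph V} {r : ℕ} (h : HasInducedPath G r) :
    ∃ p, IsPath G p r := by
  obtain ⟨f⟩ := h
  have hf : ∀ i (hi : i ≤ r), (fun i : ℕ => f (Fin.ofNat (r + 1) i)) i =
      f ⟨i, Nat.lt_succ_of_le hi⟩ := by
    intro i hi
    refine congrArg f (Fin.ext ?_)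
    simp [Fin.ofNat, Nat.mod_eq_of_lt (Nat.lt_succ_of_le hi)]
  refine ⟨fun i => f (Fin.ofNat (r + 1) i), fun i hi j hj e => ?_, fun i hi j hj => ?_⟩
  · rw [hf i hi, hf j hj] at e
    simpa using f.injective e
  · rw [hf i hi, hf j hj, f.map_adj_iff, SimpleGraph.pathGraph_adj]
    simp only
    omega

end

end VertexMinor

theorem mainTheorem2 {V : Type*} [Finite V] (G : SimpleGraph V) (hG : VertexMinor.IsPrime G)
    (n : ℕ) (hn : 3 ≤ n) (hP : VertexMinor.HasInducedPath G ⌈(6.75 : ℝ) * (n : ℝ) ^ 7⌉₊) :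
    VertexMinor.HasVertexMinor G (SimpleGraph.cycleGraph n) := by
  obtain ⟨p, hp⟩ := hP.exists_isPath
  refine (VertexMinor.hasCyc_of_isPath hG hn hp ?_).hasVertexMinor hn
  have h := Nat.le_ceil ((6.75 : ℝ) * (n : ℝ) ^ 7)
  -- `6.75 = 27 / 4`; clearing the denominator moves the bound to the natural numbers.
  have h' : (27 : ℝ) * (n : ℝ) ^ 7 ≤ 4 * (⌈(6.75 : ℝ) * (n : ℝ) ^ 7⌉₊ : ℝ) := by linarith
  exact_mod_cast h'
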